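/- **Conventions.** Hilbert spaces are real; manifolds are Hausdorff and second countable; "smooth" means $C^\infty$. A *Floer space* $(\mathfrak B,CSD)$ is a Hilbert manifold $\mathfrak B$ with a smooth splitting $T\mathfrak B=T^+\mathfrak B\oplus T^-\mathfrak B$ into closed subbundles (with projections $\Pi^\pm$), a continuous function $CSD:\mathfrak B\to\mathbb R$, and a second topology, the weak topology, coarser than the given (strong) one. A set $S\subset\mathfrak B$ is *weakly precompact* if every sequence in $S$ has a subsequence converging weakly to a point of $\mathfrak B$. **lc-manifolds.** An *lc-manifold* is a second countable Hausdorff space $P$ with closed subsets $P=P^0\supset P^1\supset\dots\supset P^k\supset P^{k+1}=\emptyset$ (for some $k$) and structures of Hilbert manifold on the open strata $P^i\setminus P^{i+1}$, such that each point $p$ of the $i$-th open stratum has an *lc-chart*: an open embedding $\varphi:V\times[0,\varepsilon)^i\to P$, with $V$ an open neighbourhood of $p$ in that stratum, such that $\varphi(v,0)=v$ and, for each $m$, $\varphi$ restricts to a diffeomorphism from $\{(v,s): \text{exactly } m \text{ coordinates of } s \text{ vanish}\}$ onto an open subset of the $m$-th open stratum. A continuous map $\sigma:P\to\mathfrak B$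 to a Hilbert manifold is *lc-smooth* if it is smooth on each open stratum and each point has an lc-chart about it in which $\sigma(v,s)$ is smooth in $v$ and its first $v$-derivative is continuous on $V\times[0,\varepsilon)^i$. $D\sigma_p$ denotes the differential at $p$ of the restriction of $\sigma$ to the open stratum of $p$, $T_pP$ the tangent space of that stratum, and $\partial P=P^1$. **Chains.** A *chain* in $(\mathfrak B,CSD)$ is an lc-smooth map $\sigma:P\to\mathfrak B$ from an lc-manifold such that: 1. $CSD$ is bounded below on the image of $\sigma$, and if $\sigma(x_n)\to y\in\mathfrak B$ weakly then $\liminf CSD(\sigma(x_n))\ge CSD(y)$. 2. If $\sigma(x_n)\to y\in\mathfrak B$ weakly and $CSD(\sigma(x_n))\to CSD(y)$, then a subsequence of $(x_n)$ converges in $P$. 3. Each subset of the image of $\sigma$ on which $CSD$ is bounded is weakly precompact. 4. For each $p\in P$, $\Pi^-\circ D\sigma_p:T_pP\to T^-\mathfrak B$ is Fredholm and $\Pi^+\circ D\sigma_p:T_pP\to T^+\mathfrak B$ is compact. It has index $k$ if $\Pi^-\circ D\sigma_p$ has index $k$ for all $p\in P\setminus\partial P$. **Correspondences.** Let $(\mathfrak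 B_0,CSD_0)$ and $(\mathfrak B_1,CSD_1)$ be Floer spaces. A *correspondence* is a smooth map $f=(f_0,f_1):Z\to\mathfrak B_0\times\mathfrak B_1$ from a Hilbert manifold $Z$ with (possibly empty) boundary such that: 1′. $CSD_1(f_1(z))-CSD_0(f_0(z))$ is bounded below on $Z$, and if $f_0(z_n)\to y_0\in\mathfrak B_0$ and $f_1(z_n)\to y_1\in\mathfrak B_1$ weakly then $\liminf\,[CSD_1(f_1(z_n))-CSD_0(f_0(z_n))]\ge CSD_1(y_1)-CSD_0(y_0)$. 2′. If $CSD_1(f_1(z_n))$ is bounded above and $\{f_0(z_n)\}$ is weakly precompact, then $\{f_1(z_n)\}$ is weakly precompact. 3′. If $f_0(z_n)\to x_0$ strongly, $f_1(z_n)\to x_1$ weakly and $CSD_1(f_1(z_n))-CSD_0(f_0(z_n))\to CSD_1(x_1)-CSD_0(x_0)$, then a subsequence of $(z_n)$ converges in $Z$. 4′. For each $z\in Z$, $(\Pi_0^+\circ Df_0,\ \Pi_1^-\circ Df_1):T_zZ\to T^+\mathfrak B_0\oplus T^-\mathfrak B_1$ is Fredholm; its index is denoted $\mathrm{ind}(Df_z)$.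 If $(v_n)$ is a bounded sequence in $T_zZ$ and $\Pi_0^+Df_0(v_n)$ converges in norm, then $\{\Pi_1^+Df_1(v_n)\}$ is precompact. 5′. For each $z\in Z$, $Df_0:T_zZ\to T\mathfrak B_0$ has dense image, and for each $z\in\partial Z$ so does its restriction to $T_z\partial Z$. **Theorem.** Let $\sigma:P\to\mathfrak B_0$ be a chain in $(\mathfrak B_0,CSD_0)$ and $f:Z\to\mathfrak B_0\times\mathfrak B_1$ a correspondence satisfying Axioms 1′–5′. Then the fibre product $$P\times_{\mathfrak B_0}Z=\{(x,z)\in P\times Z:\ \sigma(x)=f_0(z)\}$$ with the subspace topology is an lc-manifold: its open strata are its intersections with the open strata of $P\times Z$ (where $Z$ has the open strata $Z\setminus\partial Z$ and $\partial Z$), each being an embedded submanifold of these whose tangent space at $(x,z)$ is $\{(p,v): D\sigma_x(p)=Df_0(v)\}$. With this structure the map $$P\times_{\mathfrak B_0}Z\to\mathfrak B_1,\qquad (x,z)\mapsto f_1(z),$$ is a chain in $(\mathfrak B_1,CSD_1)$. At each point $(x,z)$ with $x\in P\setminus\partial P$ and $z\in Z\setminus\partial Z$, its index is $\mathrm{ind}(Df_z)+\mathrm{ind}(\Pi_0^-\circ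 D\sigma_x)$. In particular, if $\sigma$ has index $k$ and $\mathrm{ind}(Df_z)=l$ for all $z\in Z\setminus\partial Z$, then the chain $P\times_{\mathfrak B_0}Z\to\mathfrak B_1$ has index $l+k$. -/

import Mathlib

open Set Filter Topology
open scoped Manifold ContDiff

universe u v w

noncomputable section

namespace FloerBordism

/-! ### Polarized Hilbert manifolds and Floer spaces

A Hilbert manifold without boundary `B` is modelled on a real Hilbert space `E`. The tangent space
at `b` is `E`, identified through the preferred chart at `b` (Mathlib's `TangentSpace`). -/

section FloerSpaces

variable (E : Type*) [NormedAddCommGroup E] [InnerProductSpace ℝ E]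
  (B : Type*) [strong : TopologicalSpace B] [ChartedSpace E B] [IsManifold 𝓘(ℝ, E) ∞ B]

/-- A polarization `TB = T⁺B ⊕ T⁻B`, given by the smooth family of continuous projections onto
`T⁻B` along `T⁺B`. -/
structure Polarization where
  proj : B → E →L[ℝ] E
  proj_idem : ∀ b v, proj b (proj b v) = proj b v
  smooth : ∀ b, ContMDiffAt 𝓘(ℝ, E) 𝓘(ℝ, E →L[ℝ] E) ∞
    (inTangentCoordinates 𝓘(ℝ, E) 𝓘(ℝ, E) id id proj b) b

/-- A Floer space structure on `B`: a polarization, a coarser "weak" topology,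
and a real function continuous for the given (strong) topology. -/
structure FloerSpace extends Polarization E B where
  csd : B → ℝ
  continuous_csd : Continuous[strong, _] csd
  weak : TopologicalSpace B
  weak_coarser : strong ≤ weak

variable {E B}

/-- The fibre `T⁻_b B`. -/
def Polarization.Tminus (F : Polarization E B) (b : B) : Submodule ℝ E := (F.proj b).range

/-- The fibre `T⁺_b B`. -/
def Polarization.Tplus (F : Polarization E B) (b : B) : Submodule ℝ E :=
  (ContinuousLinearMap.id ℝ E - F.proj b).range

/-- The projection `Π⁻ : T_b B → T⁻_b B`. -/
def Polarization.piMinus (F : Polarization E B) (b : B) : E →L[ℝ] F.Tminus b :=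
  (F.proj b).rangeRestrict

/-- The projection `Π⁺ : T_b B → T⁺_b B`. -/
def Polarization.piPlus (F : Polarization E B) (b : B) : E →L[ℝ] F.Tplus b :=
  (ContinuousLinearMap.id ℝ E - F.proj b).rangeRestrict

/-- Weak convergence of sequences. -/
def FloerSpace.WeakTendsto (F : FloerSpace E B) (u : ℕ → B) (y : B) : Prop :=
  Tendsto u atTop (@nhds B F.weak y)

/-- Weak precompactness: every sequence in `S` has a weakly convergent subsequence. -/
def FloerSpace.WeaklyPrecompact (F : FloerSpace E B) (S : Set B) : Prop :=
  ∀ u : ℕ → B, (∀ n, u n ∈ S) → ∃ k : ℕ → ℕ, StrictMono k ∧ ∃ y, F.WeakTendsto (u ∘ k) y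

end FloerSpaces

/-! ### Locally cubical Hilbert manifolds -/

section LC

/-- A chart, with values in a Hilbert space, of a subset `A` of a space `P`. The model Hilbert
space may vary from chart to chart. -/
structure HilbertChart {P : Type u} [TopologicalSpace P] (A : Set P) where
  E : Type w
  [normed : NormedAddCommGroup E]
  [inner : InnerProductSpace ℝ E]
  [complete : CompleteSpace E]
  coord : PartialEquiv P E
  source_eq : ∃ U : Set P, IsOpen U ∧ coord.source = U ∩ A
  isOpen_target : IsOpen coord.target
  continuousOn : ContinuousOn coord coord.source
  continuousOn_symm : ContinuousOn coord.symm coord.target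

attribute [instance] HilbertChart.normed HilbertChart.inner HilbertChart.complete

/-- A stratification by Hilbert manifolds, of finite depth, of a second countable Hausdorff space.
The closed strata are `P^i = {p | i ≤ codim p}`, the open strata `P^i - P^{i+1}` are
`{p | codim p = i}`, and `atlas i` is a smooth atlas of the `i`-th open stratum. -/
structure StratifiedSpace (P : Type u) [TopologicalSpace P] [T2Space P]
    [SecondCountableTopology P] where
  codim : P → ℕ
  isClosed_stratum : ∀ i, IsClosed {p | i ≤ codim p}
  finite_depth : ∃ k, ∀ p, codim p ≤ k
  atlas : ∀ i, Set (HilbertChart.{u, w} {p | codim p = i})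
  exists_chart : ∀ p, ∃ c ∈ atlas (codim p), p ∈ c.coord.source
  compatible : ∀ i, ∀ c ∈ atlas i, ∀ d ∈ atlas i,
    ContDiffOn ℝ ∞ (fun e => d.coord (c.coord.symm e))
      (c.coord.target ∩ c.coord.symm ⁻¹' d.coord.source)

/-- The cube `[0, ε)^i`. -/
def cube (i : ℕ) (ε : ℝ) : Set (Fin i → ℝ) := {s | ∀ j, 0 ≤ s j ∧ s j < ε}

variable {P : Type u} [TopologicalSpace P] [T2Space P] [SecondCountableTopology P]

/-- A locally cubical chart about an open subset `V` of the `i`-th open stratum: an open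
embedding `V × [0, ε)^i → P` of stratified Hilbert manifolds which is `v ↦ v` on `V × {0}`.
The open strata of `V × [0, ε)^i` are the sets where a given number of coordinates vanish; the map
has to restrict to diffeomorphisms from them onto open subsets of the open strata of `P`. -/
structure LCChart (S : StratifiedSpace.{u, w} P) (i : ℕ) where
  V : Set P
  ε : ℝ
  map : PartialEquiv (P × (Fin i → ℝ)) P
  isOpen_V : ∃ U : Set P, IsOpen U ∧ V = U ∩ {p | S.codim p = i}
  ε_pos : 0 < ε
  source_eq : map.source = V ×ˢ cube i ε
  isOpen_target : IsOpen map.target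
  continuousOn : ContinuousOn map map.source
  continuousOn_symm : ContinuousOn map.symm map.target
  map_zero : ∀ v ∈ V, map (v, 0) = v
  codim_map : ∀ v ∈ V, ∀ s ∈ cube i ε, S.codim (map (v, s)) = Set.ncard {j | s j = 0}
  smooth : ∀ c ∈ S.atlas i, ∀ m, ∀ d ∈ S.atlas m,
    ContDiffOn ℝ ∞ (fun q : c.E × (Fin i → ℝ) => d.coord (map (c.coord.symm q.1, q.2)))
      {q | q.1 ∈ c.coord.target ∧ (c.coord.symm q.1, q.2) ∈ map.source ∧
        map (c.coord.symm q.1, q.2) ∈ d.coord.source}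
  smooth_symm : ∀ c ∈ S.atlas i, ∀ m, ∀ d ∈ S.atlas m,
    ContDiffOn ℝ ∞
      (fun e : d.E => (c.coord (map.symm (d.coord.symm e)).1, (map.symm (d.coord.symm e)).2))
      {e | e ∈ d.coord.target ∧ d.coord.symm e ∈ map.target ∧
        (map.symm (d.coord.symm e)).1 ∈ c.coord.source}

variable (P) in
/-- A locally cubical Hilbert manifold. -/
structure LCManifold extends StratifiedSpace.{u, w} P where
  exists_lcChart : ∀ p, ∃ φ : LCChart toStratifiedSpace (codim p), p ∈ φ.V

variable {E : Type*} [NormedAddCommGroup E] [InnerProductSpace ℝ E]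
  {B : Type*} [TopologicalSpace B] [ChartedSpace E B] [IsManifold 𝓘(ℝ, E) ∞ B]

/-- A smooth map from an lc-manifold to a Hilbert manifold: it is continuous, smooth on
each open stratum, and about each point there is an lc-chart `V × [0, ε)^i` in which it is smooth in
the `V`-directions and its first derivative in the `V`-directions is continuous on `V × [0, ε)^i`
(in the norm topology). The lc-chart is taken small enough to be read in one chart `c` of
the stratum and in the preferred chart of `B` at `σ p`. -/
structure IsLCSmooth (E : Type*) [NormedAddCommGroup E] [InnerProductSpace ℝ E]
    {B : Type*} [TopologicalSpace B] [ChartedSpace E B]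
    (S : LCManifold.{u, w} P) (σ : P → B) : Prop where
  continuous : Continuous σ
  smooth_stratum : ∀ i, ∀ c ∈ S.atlas i,
    ContMDiffOn 𝓘(ℝ, c.E) 𝓘(ℝ, E) ∞ (fun e => σ (c.coord.symm e)) c.coord.target
  smooth_lcChart : ∀ p, ∃ φ : LCChart S.toStratifiedSpace (S.codim p),
    ∃ c ∈ S.atlas (S.codim p),
      p ∈ φ.V ∧ φ.V ⊆ c.coord.source ∧ (∀ x ∈ φ.map.target, σ x ∈ (chartAt E (σ p)).source) ∧
      (∀ s ∈ cube (S.codim p) φ.ε,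
        ContDiffOn ℝ ∞
          (fun e => extChartAt 𝓘(ℝ, E) (σ p) (σ (φ.map (c.coord.symm e, s))))
          (c.coord '' φ.V)) ∧
      ContinuousOn
        (fun q : c.E × (Fin (S.codim p) → ℝ) =>
          fderiv ℝ (fun e => extChartAt 𝓘(ℝ, E) (σ p) (σ (φ.map (c.coord.symm e, q.2)))) q.1)
        ((c.coord '' φ.V) ×ˢ cube (S.codim p) φ.ε)

/-- The differential `Dσ_p : T_p P → T_{σ p} B` of the restriction of `σ` to the open stratum
of `p`, where `T_p P` is identified with `c.E` by a chart `c` of that stratum about `p`. -/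
def diff (E : Type*) [NormedAddCommGroup E] [InnerProductSpace ℝ E]
    {B : Type*} [TopologicalSpace B] [ChartedSpace E B] {A : Set P} (c : HilbertChart.{u, w} A) (σ : P → B) (p : P) : c.E →L[ℝ] E :=
  mfderiv 𝓘(ℝ, c.E) 𝓘(ℝ, E) (fun e => σ (c.coord.symm e)) (c.coord p)

/-! ### Chains -/

/-- A chain `σ : P → B` in a Floer space. In `lsc` and `strong_conv` the limit `y` is a point
of `B`, not necessarily in the image of `σ`. The last two conditions say that at each point
`Π⁻ ∘ Dσ` is Fredholm and `Π⁺ ∘ Dσ` is compact. -/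
structure IsChain (S : LCManifold.{u, w} P) (F : FloerSpace E B) (σ : P → B) : Prop where
  smooth : IsLCSmooth E S σ
  bddBelow : ∃ C, ∀ p, C ≤ F.csd (σ p)
  lsc : ∀ (x : ℕ → P) (y : B), F.WeakTendsto (fun n => σ (x n)) y →
    ∀ a < F.csd y, ∀ᶠ n in atTop, a < F.csd (σ (x n))
  strong_conv : ∀ (x : ℕ → P) (y : B), F.WeakTendsto (fun n => σ (x n)) y →
    Tendsto (fun n => F.csd (σ (x n))) atTop (𝓝 (F.csd y)) →
    ∃ k : ℕ → ℕ, StrictMono k ∧ ∃ p, Tendsto (x ∘ k) atTop (𝓝 p)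
  precompact : ∀ T ⊆ range σ, (∃ C, ∀ b ∈ T, |F.csd b| ≤ C) → F.WeaklyPrecompact T
  fredholm : ∀ p, ∀ c ∈ S.atlas (S.codim p), p ∈ c.coord.source →
    ((F.piMinus (σ p)).comp (diff E c σ p)).IsFredholm
  compact : ∀ p, ∀ c ∈ S.atlas (S.codim p), p ∈ c.coord.source →
    IsCompactOperator ((F.piPlus (σ p)).comp (diff E c σ p))

/-- The Fredholm operator `Π⁻ ∘ Dσ_p` has index `k`. -/
def HasIndexAt (S : LCManifold.{u, w} P) (F : FloerSpace E B) (σ : P → B) (p : P) (k : ℤ) :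
    Prop :=
  ∀ c ∈ S.atlas (S.codim p), p ∈ c.coord.source →
    ((F.piMinus (σ p)).comp (diff E c σ p)).toLinearMap.index = k

/-- A chain has index `k` if `Π⁻ ∘ Dσ` has index `k` at each point of `P - ∂P`. -/
def HasIndex (S : LCManifold.{u, w} P) (F : FloerSpace E B) (σ : P → B) (k : ℤ) : Prop :=
  ∀ p, S.codim p = 0 → HasIndexAt S F σ p k

end LC

/-! ### Correspondences

`Z` is a Hilbert manifold with (possibly empty) boundary: its model with corners `I` has as range a
half-space `{v | 0 ≤ ℓ v}` of a Hilbert space `EZ`, where `ℓ` is a continuous linear functional.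
(For `ℓ = 0` this is all of `EZ`, and there is no boundary.) At a boundary point, `T_z ∂Z` is
the kernel of `ℓ` in `T_z Z = EZ`. -/

section Correspondences

variable {E₀ : Type*} [NormedAddCommGroup E₀] [InnerProductSpace ℝ E₀]
  {B₀ : Type*} [TopologicalSpace B₀] [ChartedSpace E₀ B₀]
  [IsManifold 𝓘(ℝ, E₀) ∞ B₀]
  {E₁ : Type*} [NormedAddCommGroup E₁] [InnerProductSpace ℝ E₁]
  {B₁ : Type*} [TopologicalSpace B₁] [ChartedSpace E₁ B₁]
  [IsManifold 𝓘(ℝ, E₁) ∞ B₁]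
  {EZ : Type w} [NormedAddCommGroup EZ] [InnerProductSpace ℝ EZ]
  {HZ : Type*} [TopologicalSpace HZ] (I : ModelWithCorners ℝ EZ HZ)
  {Z : Type v} [TopologicalSpace Z] [ChartedSpace HZ Z]

/-- `T_z Z → T B₀`. -/
def diff₀ (E₀ : Type*) [NormedAddCommGroup E₀] [InnerProductSpace ℝ E₀] [ChartedSpace E₀ B₀]
    (f : Z → B₀ × B₁) (z : Z) : EZ →L[ℝ] E₀ :=
  mfderiv I 𝓘(ℝ, E₀) (fun z => (f z).1) z

/-- `T_z Z → T B₁`. -/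
def diff₁ (E₁ : Type*) [NormedAddCommGroup E₁] [InnerProductSpace ℝ E₁] [ChartedSpace E₁ B₁]
    (f : Z → B₀ × B₁) (z : Z) : EZ →L[ℝ] E₁ :=
  mfderiv I 𝓘(ℝ, E₁) (fun z => (f z).2) z

/-- The operator `(π₀⁺, π₁⁻) ∘ Df : T_z Z → T⁺B₀ ⊕ T⁻B₁`. -/
def mixedDiff (F₀ : FloerSpace E₀ B₀) (F₁ : FloerSpace E₁ B₁) (f : Z → B₀ × B₁) (z : Z) :
    EZ →L[ℝ] F₀.Tplus (f z).1 × F₁.Tminus (f z).2 :=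
  ((F₀.piPlus (f z).1).comp (diff₀ I E₀ f z)).prod ((F₁.piMinus (f z).2).comp (diff₁ I E₁ f z))

/-- The index of a correspondence at `z`. -/
def corrIndex (F₀ : FloerSpace E₀ B₀) (F₁ : FloerSpace E₁ B₁) (f : Z → B₀ × B₁) (z : Z) : ℤ :=
  (mixedDiff I F₀ F₁ f z).toLinearMap.index

/-- A correspondence `f : Z → B₀ × B₁` between Floer spaces. The convergence assumed in
`compact` is in norm; norm convergent sequences being weakly convergent, this asks for less than the
same condition for all bounded sequences `v` such that `π₀⁺ Df(v n)` converges weakly. -/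
structure IsCorrespondence (ℓ : EZ →L[ℝ] ℝ) (F₀ : FloerSpace E₀ B₀) (F₁ : FloerSpace E₁ B₁)
    (f : Z → B₀ × B₁) : Prop where
  smooth : ContMDiff I (𝓘(ℝ, E₀).prod 𝓘(ℝ, E₁)) ∞ f
  bddBelow : ∃ C, ∀ z, C ≤ F₁.csd (f z).2 - F₀.csd (f z).1
  lsc : ∀ (z : ℕ → Z) (y₀ : B₀) (y₁ : B₁), F₀.WeakTendsto (fun n => (f (z n)).1) y₀ →
    F₁.WeakTendsto (fun n => (f (z n)).2) y₁ →
    ∀ a < F₁.csd y₁ - F₀.csd y₀, ∀ᶠ n in atTop, a < F₁.csd (f (z n)).2 - F₀.csd (f (z n)).1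
  precompact : ∀ z : ℕ → Z, BddAbove (range fun n => F₁.csd (f (z n)).2) →
    F₀.WeaklyPrecompact (range fun n => (f (z n)).1) →
    F₁.WeaklyPrecompact (range fun n => (f (z n)).2)
  strong_conv : ∀ (z : ℕ → Z) (x₀ : B₀) (x₁ : B₁),
    Tendsto (fun n => (f (z n)).1) atTop (𝓝 x₀) →
    F₁.WeakTendsto (fun n => (f (z n)).2) x₁ →
    Tendsto (fun n => F₁.csd (f (z n)).2 - F₀.csd (f (z n)).1) atTop
      (𝓝 (F₁.csd x₁ - F₀.csd x₀)) →
    ∃ k : ℕ → ℕ, StrictMono k ∧ ∃ z', Tendsto (z ∘ k) atTop (𝓝 z')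
  fredholm : ∀ z, (mixedDiff I F₀ F₁ f z).IsFredholm
  compact : ∀ z, ∀ v : ℕ → EZ, (∃ C, ∀ n, ‖v n‖ ≤ C) →
    (∃ y, Tendsto (fun n => F₀.piPlus (f z).1 (diff₀ I E₀ f z (v n))) atTop (𝓝 y)) →
    IsCompact (closure (range fun n => F₁.piPlus (f z).2 (diff₁ I E₁ f z (v n))))
  dense : ∀ z, Dense (range (diff₀ I E₀ f z))
  dense_boundary : ∀ z, I.IsBoundaryPoint z →
    Dense (diff₀ I E₀ f z '' {v | ℓ v = 0})

/-! ### Fibre products -/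

open Classical in
/-- The codimension of the open stratum (interior or boundary) of `Z` containing `z`. -/
def boundaryCodim (z : Z) : ℕ := if I.IsBoundaryPoint z then 1 else 0

/-- The fibre product `P ×_{B₀} Z`, with the subspace topology of `P × Z`. -/
abbrev FibreProduct {P : Type*} (σ : P → B₀) (f : Z → B₀ × B₁) : Type _ :=
  {q : P × Z // σ q.1 = (f q.2).1}

variable {P : Type u} [TopologicalSpace P] [T2Space P] [SecondCountableTopology P]
  [T2Space Z] [SecondCountableTopology Z]

instance {P Z B₀ B₁ : Type*} [TopologicalSpace P] [TopologicalSpace Z]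
    [SecondCountableTopology P] [SecondCountableTopology Z] (σ : P → B₀) (f : Z → B₀ × B₁) :
    SecondCountableTopology (FibreProduct σ f) :=
  TopologicalSpace.Subtype.secondCountableTopology {q : P × Z | σ q.1 = (f q.2).1}

/-- The map `π₁ ∘ f : P ×_{B₀} Z → B₁`. -/
def fibreMap (σ : P → B₀) (f : Z → B₀ × B₁) : FibreProduct σ f → B₁ := fun q => (f q.1.2).2

/-- The lc-structure `S` on the fibre product is the one induced from `P × Z`: the open strata are
the intersections with the open strata of `P × Z` (products of those of `P` and of `Z`), and they
are embedded submanifolds of these, with `T (P ×_{B₀} Z) = TP ×_{TB₀} TZ`. That is, for each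
chart `c` of an open stratum of the fibre product, the inclusion is smooth, and its
differential is injective with the fibre product of the tangent spaces as its image. -/
structure IsInducedStructure (ℓ : EZ →L[ℝ] ℝ) (SP : LCManifold.{u, w} P) (σ : P → B₀)
    (f : Z → B₀ × B₁) (S : LCManifold.{max u v, w} (FibreProduct σ f)) : Prop where
  codim_eq : ∀ q, S.codim q = SP.codim q.1.1 + boundaryCodim I q.1.2
  smooth_fst : ∀ m, ∀ c ∈ S.atlas m, ∀ i, ∀ d ∈ SP.atlas i,
    ContDiffOn ℝ ∞ (fun e => d.coord (c.coord.symm e).1.1)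
      {e | e ∈ c.coord.target ∧ (c.coord.symm e).1.1 ∈ d.coord.source}
  smooth_snd : ∀ m, ∀ c ∈ S.atlas m,
    ContMDiffOn 𝓘(ℝ, c.E) I ∞ (fun e => (c.coord.symm e).1.2) c.coord.target
  tangent : ∀ m, ∀ c ∈ S.atlas m, ∀ q ∈ c.coord.source,
    ∀ d ∈ SP.atlas (SP.codim q.1.1), q.1.1 ∈ d.coord.source →
    let D : c.E →L[ℝ] d.E × EZ :=
      (fderiv ℝ (fun e => d.coord (c.coord.symm e).1.1) (c.coord q)).prod
        (mfderiv 𝓘(ℝ, c.E) I (fun e => (c.coord.symm e).1.2) (c.coord q))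
    Function.Injective D ∧
      range D = {t | (I.IsBoundaryPoint q.1.2 → ℓ t.2 = 0) ∧
        diff E₀ d σ q.1.1 t.1 = diff₀ I E₀ f q.1.2 t.2}

end Correspondences

end FloerBordism

end

/-!
The fibre product of a chain `σ : P → B₀` and a correspondence `f = (f₀, f₁) : Z → B₀ × B₁` is the
set of solutions of the equation `σ x = f₀ z` on the lc-manifold `P × Z`. The equation is
transverse on each stratum, and an inverse function theorem with the corner coordinates as
parameters solves it.

*Transversality.* Let `x` and `z` satisfy `σ x = f₀ z`. In terms of the polarization of `B₀`, the
operator `(p, v) ↦ (Π₀⁻ (Df₀ v - Dσ p), Π₀⁺ (Df₀ v - Dσ p), Π₁⁻ Df₁ v)` is the sum of a compact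
operator, made from `Π₀⁺ Dσ`, and a triangular one, whose diagonal entries `-Π₀⁻ Dσ` and
`(Π₀⁺ Df₀, Π₁⁻ Df₁)` are Fredholm. Hence it is Fredholm, and its index is the sum of their indices
(`algFredholm_fibreOperator`). So `Df₀ - Dσ` has closed range, and since the image of `Df₀` is
dense it is onto (`surjective_sub`, `exists_diff_sub_eq`). Consequently the restriction of
`Π₁⁻ Df₁` to the fibre product of the tangent spaces has the kernel and the cokernel of the operator
above (`algFredholm_fibre`), which gives the Fredholm axiom and the index formula for `f₁`. At
boundary points of `Z` the same argument applies to the tangent space of `∂Z`.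

*Local structure.* An lc-chart of `P` and a chart of `Z` adapted to its boundary give coordinates
`(a, s)` on `P × Z` (`LocalChart`), in which the equation becomes `G (a, s) = 0`. The function `G`
is smooth in `a`, with first derivative continuous up to the corners, and is smooth jointly only
where the set of vanishing corner coordinates is constant. At the base point its derivative in `a`
is onto. With `κ` a projection onto the kernel of that derivative, `(κ, G)` has an inverse which
depends continuously on `s` (`exists_parametric_inverse`), so `κ a` and `s` are coordinates on the
fibre product (`FibreChart`). Along the sets where the vanishing corner coordinates are constant,
they are smooth (`contDiffWithinAt_sol`).

*Smooth structure.* The atlas of a stratum consists of all charts for which the inclusion into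
`P × Z` is smooth with injective differential, whose image is the fibre product of the tangent spaces
(`fibreAtlas`). A continuous map whose composition with an immersion is smooth is itself smooth
(`contDiffWithinAt_of_comp_immersion`), so these charts are compatible, and the lc-charts obtained
from `FibreChart` are diffeomorphisms on the strata.

*The remaining chain axioms* are obtained by passing to subsequences. If `CSD₁` is bounded above
along a sequence in the fibre product, then so is `CSD₀`, and the images in `B₀` have a weakly
convergent subsequence. The semicontinuity of `CSD₀` and of `CSD₁ - CSD₀` gives that of `CSD₁`;
when `CSD₁` converges to its value at the weak limit, so does `CSD₀`, and the strong convergence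
axioms of `σ` and of `f` apply in turn (`fibreMap_lsc`, `fibreMap_strong_conv`).
-/

namespace FloerBordism

/-! ### Fredholm operators and their index -/

section AlgFredholm

variable {X Y W : Type*} [AddCommGroup X] [Module ℝ X] [AddCommGroup Y] [Module ℝ Y]
  [AddCommGroup W] [Module ℝ W]

/-- A linear map with finite-dimensional kernel and cokernel. -/
def AlgFredholm (u : X →ₗ[ℝ] Y) : Prop :=
  FiniteDimensional ℝ u.ker ∧ FiniteDimensional ℝ (Y ⧸ u.range)

theorem finiteDimensional_of_ker (φ : X →ₗ[ℝ] Y) [FiniteDimensional ℝ Y]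
    [FiniteDimensional ℝ φ.ker] : FiniteDimensional ℝ X := by
  have h : FiniteDimensional ℝ (Submodule.comap φ ⊤) := inferInstance
  rw [Submodule.comap_top] at h
  exact Module.Finite.equiv (Submodule.topEquiv (R := ℝ) (M := X))

theorem AlgFredholm.comp {g : Y →ₗ[ℝ] W} {f : X →ₗ[ℝ] Y} (hg : AlgFredholm g)
    (hf : AlgFredholm f) : AlgFredholm (g ∘ₗ f) := by
  obtain ⟨_, _⟩ := hg
  obtain ⟨_, _⟩ := hf
  constructor
  · rw [LinearMap.ker_comp]; infer_instance
  · rw [LinearMap.range_comp]; infer_instance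

theorem AlgFredholm.index_comp {g : Y →ₗ[ℝ] W} {f : X →ₗ[ℝ] Y} (hg : AlgFredholm g)
    (hf : AlgFredholm f) : (g ∘ₗ f).index = g.index + f.index := by
  obtain ⟨_, _⟩ := hg
  obtain ⟨_, _⟩ := hf
  exact LinearMap.index_comp g

/-- The kernel of `g` maps to the cokernel of `f`, with kernel a quotient of `ker (g ∘ f)`; the
cokernel of `g` is a quotient of that of `g ∘ f`. -/
theorem AlgFredholm.of_comp_right {g : Y →ₗ[ℝ] W} {f : X →ₗ[ℝ] Y} (h : AlgFredholm (g ∘ₗ f))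
    (hf : AlgFredholm f) : AlgFredholm g := by
  obtain ⟨_, _⟩ := h
  obtain ⟨_, _⟩ := hf
  constructor
  · let φ : g.ker →ₗ[ℝ] Y ⧸ f.range := f.range.mkQ ∘ₗ g.ker.subtype
    have hφ : FiniteDimensional ℝ φ.ker := by
      have : FiniteDimensional ℝ g.ker.subtype.ker := by
        rw [Submodule.ker_subtype]; infer_instance
      have h2 : FiniteDimensional ℝ
          (Submodule.comap g.ker.subtype (Submodule.map f (g ∘ₗ f).ker)) := inferInstance
      refine Submodule.finiteDimensional_of_le (S₂ := Submodule.comap g.ker.subtype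
        (Submodule.map f (g ∘ₗ f).ker)) ?_
      intro y hy
      have hy' : (y : Y) ∈ f.range := by simpa [φ] using hy
      obtain ⟨x, hx⟩ := hy'
      have h3 : g (y : Y) = 0 := y.2
      exact ⟨x, by simp [hx, h3], hx⟩
    exact finiteDimensional_of_ker φ
  · exact Module.Finite.of_surjective _
      (Submodule.factor_surjective (LinearMap.range_comp_le_range f g))

/-- Dually, the cokernel of `f` maps to that of `g ∘ f`, with kernel a quotient of `ker g`. -/
theorem AlgFredholm.of_comp_left {g : Y →ₗ[ℝ] W} {f : X →ₗ[ℝ] Y} (h : AlgFredholm (g ∘ₗ f))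
    (hg : AlgFredholm g) : AlgFredholm f := by
  obtain ⟨_, _⟩ := h
  obtain ⟨_, _⟩ := hg
  constructor
  · exact Submodule.finiteDimensional_of_le (LinearMap.ker_le_ker_comp f g)
  · have aux : f.range ≤ Submodule.comap g (g ∘ₗ f).range := by
      rw [← Submodule.map_le_iff_le_comap, LinearMap.range_comp]
    let φ : (Y ⧸ f.range) →ₗ[ℝ] W ⧸ (g ∘ₗ f).range := f.range.mapQ (g ∘ₗ f).range g aux
    have hφ : FiniteDimensional ℝ φ.ker := by
      have h2 : FiniteDimensional ℝ (Submodule.map f.range.mkQ g.ker) := inferInstance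
      refine Submodule.finiteDimensional_of_le (S₂ := Submodule.map f.range.mkQ g.ker) ?_
      intro y hy
      obtain ⟨y, rfl⟩ := f.range.mkQ_surjective y
      have hy' : g y ∈ (g ∘ₗ f).range := by simpa [φ] using hy
      obtain ⟨x, hx⟩ := hy'
      refine ⟨y - f x, by simpa [sub_eq_zero] using hx.symm, ?_⟩
      rw [map_sub, sub_eq_self]
      simp
    exact finiteDimensional_of_ker φ

theorem algFredholm_of_bijective {f : X →ₗ[ℝ] Y} (hf : Function.Bijective f) : AlgFredholm f := by
  constructor
  · rw [LinearMap.ker_eq_bot.2 hf.1]; infer_instance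
  · rw [LinearMap.range_eq_top.2 hf.2]; infer_instance

theorem index_of_bijective {f : X →ₗ[ℝ] Y} (hf : Function.Bijective f) : f.index = 0 := by
  exact LinearEquiv.index_eq_zero (e := LinearEquiv.ofBijective f hf)

theorem algFredholm_subtype (N : Submodule ℝ X) [FiniteDimensional ℝ (X ⧸ N)] :
    AlgFredholm N.subtype := by
  constructor
  · rw [Submodule.ker_subtype]; infer_instance
  · rw [Submodule.range_subtype]; infer_instance

/-- The index is unchanged by a perturbation of finite rank, because the two maps agree on a
subspace of finite codimension. -/
theorem AlgFredholm.add_finiteRank {u : X →ₗ[ℝ] Y} (hu : AlgFredholm u) (r : X →ₗ[ℝ] Y)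
    [FiniteDimensional ℝ r.range] :
    AlgFredholm (u + r) ∧ (u + r).index = u.index := by
  have : FiniteDimensional ℝ (X ⧸ r.ker) := Module.Finite.equiv r.quotKerEquivRange.symm
  have hι := algFredholm_subtype r.ker
  have heq : (u + r) ∘ₗ r.ker.subtype = u ∘ₗ r.ker.subtype := by
    ext x
    have : r (x : X) = 0 := x.2
    simp [this]
  have h1 : AlgFredholm (u + r) := by
    refine AlgFredholm.of_comp_right (f := r.ker.subtype) ?_ hι
    rw [heq]; exact hu.comp hι
  refine ⟨h1, ?_⟩
  have h2 := h1.index_comp hι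
  rw [heq, hu.index_comp hι] at h2
  omega

theorem AlgFredholm.prodMap {X' Y' : Type*} [AddCommGroup X'] [Module ℝ X'] [AddCommGroup Y']
    [Module ℝ Y'] {u : X →ₗ[ℝ] Y} {u' : X' →ₗ[ℝ] Y'} (hu : AlgFredholm u) (hu' : AlgFredholm u') :
    AlgFredholm (u.prodMap u') ∧ (u.prodMap u').index = u.index + u'.index := by
  obtain ⟨_, _⟩ := hu
  obtain ⟨_, _⟩ := hu'
  let e1 : (u.prodMap u').ker ≃ₗ[ℝ] u.ker × u'.ker :=
    { toFun := fun x => (⟨x.1.1, congrArg Prod.fst x.2⟩, ⟨x.1.2, congrArg Prod.snd x.2⟩)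
      invFun := fun x => ⟨(x.1, x.2), Prod.ext x.1.2 x.2.2⟩
      map_add' := fun _ _ => rfl
      map_smul' := fun _ _ => rfl
      left_inv := fun _ => rfl
      right_inv := fun _ => rfl }
  let φ : (Y × Y') →ₗ[ℝ] (Y ⧸ u.range) × (Y' ⧸ u'.range) := u.range.mkQ.prodMap u'.range.mkQ
  have hφ : Function.Surjective φ :=
    Function.Surjective.prodMap u.range.mkQ_surjective u'.range.mkQ_surjective
  have hk : φ.ker = (u.prodMap u').range := by
    simp only [φ, LinearMap.ker_prodMap, LinearMap.range_prodMap, Submodule.ker_mkQ]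
  have e2 : ((Y × Y') ⧸ (u.prodMap u').range) ≃ₗ[ℝ] (Y ⧸ u.range) × (Y' ⧸ u'.range) :=
    (Submodule.quotEquivOfEq _ _ hk.symm).trans (φ.quotKerEquivOfSurjective hφ)
  refine ⟨⟨Module.Finite.equiv e1.symm, Module.Finite.equiv e2.symm⟩, ?_⟩
  simp only [LinearMap.index_eq_finrank_sub]
  rw [e1.finrank_eq, e2.finrank_eq, Module.finrank_prod, Module.finrank_prod]
  push_cast; ring

end AlgFredholm

section Banach

variable {X Y : Type*} [NormedAddCommGroup X] [NormedSpace ℝ X] [CompleteSpace X]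
  [NormedAddCommGroup Y] [NormedSpace ℝ Y] [CompleteSpace Y]

theorem algFredholm_of_isFredholm {X Y : Type*} [NormedAddCommGroup X] [NormedSpace ℝ X]
    [NormedAddCommGroup Y] [NormedSpace ℝ Y] {u : X →L[ℝ] Y} (hu : u.IsFredholm) :
    AlgFredholm (u : X →ₗ[ℝ] Y) :=
  ⟨hu.finite_ker, hu.finite_coker⟩

/-- The range of a bounded operator with complemented kernel and finite-dimensional cokernel is
closed. -/
theorem isClosed_range_of_finiteDimensional_coker (u : X →L[ℝ] Y)
    (hk : u.ker.ClosedComplemented) [FiniteDimensional ℝ (Y ⧸ u.range)] :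
    IsClosed (u.range : Set Y) := by
  obtain ⟨N, hN, hc⟩ := hk.exists_isClosed_isCompl
  have : CompleteSpace N := hN.completeSpace_coe
  have hr : (u ∘L N.subtypeL).range = u.range := by
    ext y
    constructor
    · rintro ⟨x, rfl⟩; exact ⟨x, rfl⟩
    · rintro ⟨x, rfl⟩
      obtain ⟨a, ha, b, hb, rfl⟩ := Submodule.mem_sup.1 (hc.sup_eq_top ▸ Submodule.mem_top (x := x))
      refine ⟨⟨b, hb⟩, ?_⟩
      have : u a = 0 := ha
      simp [this]
  have hi : (u ∘L N.subtypeL).ker = ⊥ := by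
    rw [LinearMap.ker_eq_bot']
    rintro ⟨x, hx⟩ h
    have : x ∈ u.ker := h
    ext
    exact Submodule.disjoint_def.1 hc.disjoint x this hx
  obtain ⟨G, hG⟩ := u.range.exists_isCompl
  have : FiniteDimensional ℝ G := Module.Finite.equiv (Submodule.quotientEquivOfIsCompl _ _ hG)
  have := ContinuousLinearMap.closed_complemented_range_of_isCompl_of_ker_eq_bot
    (u ∘L N.subtypeL) G (by rw [hr]; exact hG) G.closed_of_finiteDimensional hi
  rwa [hr] at this

/-- For operators between Banach spaces the topological conditions in `IsFredholm` are automatic: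
the kernel is complemented, the range is closed, and the open mapping theorem applies. -/
theorem AlgFredholm.isFredholm {u : X →L[ℝ] Y} (hu : AlgFredholm (u : X →ₗ[ℝ] Y)) :
    u.IsFredholm := by
  obtain ⟨h1, h2⟩ := hu
  have hk : u.ker.ClosedComplemented := Submodule.ClosedComplemented.of_finiteDimensional _
  have hcl := isClosed_range_of_finiteDimensional_coker u hk
  refine ⟨?_, hcl, h1, h2, hk⟩
  have : CompleteSpace u.range := hcl.completeSpace_coe
  have hs : Function.Surjective u.rangeRestrict := by
    rintro ⟨_, x, rfl⟩; exact ⟨x, rfl⟩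
  exact (u.rangeRestrict.isOpenMap hs).isQuotientMap u.rangeRestrict.continuous hs

/-- Fredholm operators form an open set, on which the index is locally constant: with `ι` the
inclusion of a complement of the kernel and `p` the projection onto the range, `p ∘ u ∘ ι` is
invertible, and hence so is `p ∘ (u + t) ∘ ι` for small `t`. -/
theorem AlgFredholm.exists_add_of_norm_lt {u : X →L[ℝ] Y} (hu : AlgFredholm (u : X →ₗ[ℝ] Y)) :
    ∃ δ > 0, ∀ t : X →L[ℝ] Y, ‖t‖ < δ →
      AlgFredholm ((u + t : X →L[ℝ] Y) : X →ₗ[ℝ] Y) ∧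
        ((u + t : X →L[ℝ] Y) : X →ₗ[ℝ] Y).index = (u : X →ₗ[ℝ] Y).index := by
  obtain ⟨pkg⟩ := hu.isFredholm.nonempty_fredholmPackage
  set ι := pkg.decDom.X₁.subtypeL with hι
  set p := pkg.decCodom.proj with hp
  have h0 := pkg.decDom.finite_X₀
  have h0' := pkg.decCodom.finite_X₀
  have : FiniteDimensional ℝ (X ⧸ pkg.decDom.X₁) :=
    Module.Finite.equiv
      (Submodule.quotientEquivOfIsCompl _ _ pkg.decDom.isTopCompl.isCompl).symm
  have hcl : IsClosed (pkg.decDom.X₁ : Set X) := pkg.decDom.isTopCompl.isClosed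
  have : CompleteSpace pkg.decDom.X₁ := hcl.completeSpace_coe
  have hιF : AlgFredholm (ι : pkg.decDom.X₁ →ₗ[ℝ] X) := algFredholm_subtype _
  have hps : Function.Surjective p := fun y => ⟨y, by simp [hp]⟩
  have hpF : AlgFredholm (p : Y →ₗ[ℝ] pkg.decCodom.X₁) := by
    constructor
    · have : (p : Y →ₗ[ℝ] pkg.decCodom.X₁).ker = pkg.decCodom.X₀ := by
        simp [hp]
      rw [this]; exact h0'
    · rw [LinearMap.range_eq_top.2 hps]; infer_instance
  have hu' : p ∘L u ∘L ι = (pkg.equiv : pkg.decDom.X₁ →L[ℝ] pkg.decCodom.X₁) := by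
    ext x
    have h := DFunLike.congr_fun pkg.eq_equiv (x : X)
    have h' : u (x : X) = (pkg.equiv x : Y) := by
      rw [h]; simp
    simp [hp, hι, h']
  have hev : ∀ᶠ t : X →L[ℝ] Y in 𝓝 0, p ∘L (u + t) ∘L ι ∈
      range ((↑) : (pkg.decDom.X₁ ≃L[ℝ] pkg.decCodom.X₁) → _) := by
    have hc : Continuous fun t : X →L[ℝ] Y => p ∘L (u + t) ∘L ι := by fun_prop
    have := hc.tendsto 0
    rw [add_zero, hu'] at this
    exact this (ContinuousLinearEquiv.nhds pkg.equiv)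
  obtain ⟨δ, hδ, hb⟩ := Metric.eventually_nhds_iff.1 hev
  refine ⟨δ, hδ, fun t ht => ?_⟩
  have key : ∀ s : X →L[ℝ] Y, p ∘L s ∘L ι ∈
      range ((↑) : (pkg.decDom.X₁ ≃L[ℝ] pkg.decCodom.X₁) → _) →
      AlgFredholm (s : X →ₗ[ℝ] Y) ∧ (s : X →ₗ[ℝ] Y).index =
        - (p : Y →ₗ[ℝ] pkg.decCodom.X₁).index - (ι : pkg.decDom.X₁ →ₗ[ℝ] X).index := by
    rintro s ⟨e, he⟩
    have hbij : Function.Bijective ((p : Y →ₗ[ℝ] pkg.decCodom.X₁) ∘ₗ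
        ((s : X →ₗ[ℝ] Y) ∘ₗ (ι : pkg.decDom.X₁ →ₗ[ℝ] X))) := by
      have : ⇑((p : Y →ₗ[ℝ] pkg.decCodom.X₁) ∘ₗ
        ((s : X →ₗ[ℝ] Y) ∘ₗ (ι : pkg.decDom.X₁ →ₗ[ℝ] X))) = e := by
        ext x; exact congrArg Subtype.val (DFunLike.congr_fun he x).symm
      rw [this]; exact e.bijective
    have h1 := (algFredholm_of_bijective hbij).of_comp_left hpF
    have h2 := h1.of_comp_right hιF
    refine ⟨h2, ?_⟩
    have h3 := index_of_bijective hbij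
    rw [hpF.index_comp h1, h2.index_comp hιF] at h3
    omega
  have k1 := key (u + t) (hb (by simpa using ht))
  have k2 := key u ⟨pkg.equiv, hu'.symm⟩
  exact ⟨k1.1, k1.2.trans k2.2.symm⟩

end Banach

section Approximable

variable {X Y W : Type*} [NormedAddCommGroup X] [NormedSpace ℝ X]
  [NormedAddCommGroup Y] [NormedSpace ℝ Y] [NormedAddCommGroup W] [NormedSpace ℝ W]

/-- An operator which is a norm limit of operators of finite rank. -/
def Approximable (t : X →L[ℝ] Y) : Prop :=
  ∀ ε > 0, ∃ r : X →L[ℝ] Y, FiniteDimensional ℝ r.range ∧ ‖t - r‖ < ε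

/-- The part of `t` of small norm and the part of finite rank are added one after the other. -/
theorem AlgFredholm.add_approximable [CompleteSpace X] [CompleteSpace Y] {u t : X →L[ℝ] Y}
    (hu : AlgFredholm (u : X →ₗ[ℝ] Y)) (ht : Approximable t) :
    AlgFredholm ((u + t : X →L[ℝ] Y) : X →ₗ[ℝ] Y) ∧
        ((u + t : X →L[ℝ] Y) : X →ₗ[ℝ] Y).index = (u : X →ₗ[ℝ] Y).index := by
  obtain ⟨δ, hδ, h⟩ := hu.exists_add_of_norm_lt
  obtain ⟨r, hr, hrt⟩ := ht δ hδ
  obtain ⟨h1, h2⟩ := h _ hrt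
  have : FiniteDimensional ℝ (r : X →ₗ[ℝ] Y).range := hr
  obtain ⟨h3, h4⟩ := h1.add_finiteRank (r : X →ₗ[ℝ] Y)
  have heq : ((u + (t - r) : X →L[ℝ] Y) : X →ₗ[ℝ] Y) + (r : X →ₗ[ℝ] Y) =
      ((u + t : X →L[ℝ] Y) : X →ₗ[ℝ] Y) := by
    ext x; simp [add_assoc]
  rw [heq] at h3 h4
  exact ⟨h3, h4.trans h2⟩

theorem Approximable.comp_left {t : X →L[ℝ] Y} (ht : Approximable t) (g : Y →L[ℝ] W) :
    Approximable (g ∘L t) := by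
  intro ε hε
  obtain ⟨r, hr, h⟩ := ht (ε / (‖g‖ + 1)) (by positivity)
  refine ⟨g ∘L r, ?_, ?_⟩
  · have : (g ∘L r).range = Submodule.map (g : Y →ₗ[ℝ] W) r.range := LinearMap.range_comp _ _
    rw [this]; infer_instance
  · rw [← ContinuousLinearMap.comp_sub]
    refine (g.opNorm_comp_le _).trans_lt ?_
    rw [lt_div_iff₀ (by positivity)] at h
    nlinarith [norm_nonneg (t - r), norm_nonneg g]

theorem Approximable.comp_right {t : X →L[ℝ] Y} (ht : Approximable t) (g : W →L[ℝ] X) :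
    Approximable (t ∘L g) := by
  intro ε hε
  obtain ⟨r, hr, h⟩ := ht (ε / (‖g‖ + 1)) (by positivity)
  refine ⟨r ∘L g, ?_, ?_⟩
  · exact Submodule.finiteDimensional_of_le
      (LinearMap.range_comp_le_range (g : W →ₗ[ℝ] X) (r : X →ₗ[ℝ] Y))
  · rw [← ContinuousLinearMap.sub_comp]
    refine ((t - r).opNorm_comp_le _).trans_lt ?_
    rw [lt_div_iff₀ (by positivity)] at h
    nlinarith [norm_nonneg (t - r), norm_nonneg g]

/-- A compact operator into a Hilbert space is approximated by its compositions with the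
orthogonal projections onto the spans of finite nets in the image of the unit ball. -/
theorem approximable_of_isCompactOperator {H : Type*} [NormedAddCommGroup H]
    [InnerProductSpace ℝ H] {t : X →L[ℝ] H} (ht : IsCompactOperator t) :
    Approximable t := by
  intro ε hε
  have hK : IsCompact (closure (t '' Metric.closedBall 0 1)) :=
    ht.isCompact_closure_image_closedBall 1
  obtain ⟨s, hs, hsf, hcov⟩ := Metric.finite_approx_of_totallyBounded
    (hK.totallyBounded) (ε / 3) (by positivity)
  let N := Submodule.span ℝ s
  have : FiniteDimensional ℝ N := FiniteDimensional.span_of_finite ℝ hsf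
  refine ⟨N.starProjection ∘L t, ?_, ?_⟩
  · have hle : (N.starProjection ∘L t).range ≤ N := by
      rintro _ ⟨x, rfl⟩
      exact N.starProjection_apply_mem _
    exact Submodule.finiteDimensional_of_le hle
  · refine lt_of_le_of_lt (ContinuousLinearMap.opNorm_le_of_unit_norm (C := ε * (2/3))
      (by positivity) fun x hx => ?_) (by linarith)
    have hx' : t x ∈ closure (t '' Metric.closedBall 0 1) :=
      subset_closure ⟨x, by simp [hx], rfl⟩
    obtain ⟨y, hy, hxy⟩ := mem_iUnion₂.1 (hcov hx')
    have hyN : N.starProjection y = y := N.starProjection_eq_self_iff.2 (Submodule.subset_span hy)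
    have h1 : (t - N.starProjection ∘L t) x = (t x - y) - N.starProjection (t x - y) := by
      simp [hyN]
    rw [h1]
    have h2 : ‖N.starProjection (t x - y)‖ ≤ ‖t x - y‖ := N.norm_starProjection_apply_le _
    have h3 : ‖t x - y‖ < ε / 3 := by rwa [← dist_eq_norm]
    calc _ ≤ ‖t x - y‖ + ‖N.starProjection (t x - y)‖ := norm_sub_le _ _
      _ ≤ ε * (2/3) := by linarith

end Approximable

section FibreProductFredholm

/-- Closed subspaces of a Banach space isomorphic to a Hilbert space are complemented. -/
theorem closedComplemented_of_equiv {V H : Type*} [NormedAddCommGroup V] [NormedSpace ℝ V]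
    [NormedAddCommGroup H] [InnerProductSpace ℝ H] [CompleteSpace H] (e : H ≃L[ℝ] V)
    (N : Submodule ℝ V) (hN : IsClosed (N : Set V)) : N.ClosedComplemented := by
  let N' : Submodule ℝ H := N.comap (e : H →ₗ[ℝ] V)
  have hN' : IsClosed (N' : Set H) := hN.preimage e.continuous
  have : CompleteSpace N' := hN'.completeSpace_coe
  refine ⟨((e : H →L[ℝ] V) ∘L N'.starProjection ∘L (e.symm : V →L[ℝ] H)).codRestrict N
    (fun x => N'.starProjection_apply_mem _), fun x => ?_⟩
  have hx : e.symm x ∈ N' := by simp [N']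
  refine Subtype.ext ?_
  change e (N'.starProjection (e.symm x)) = x
  rw [N'.starProjection_eq_self_iff.2 hx, e.apply_symm_apply]

theorem closedComplemented_prod {X Y : Type*} [NormedAddCommGroup X] [InnerProductSpace ℝ X]
    [CompleteSpace X] [NormedAddCommGroup Y] [InnerProductSpace ℝ Y] [CompleteSpace Y]
    (N : Submodule ℝ (X × Y)) (hN : IsClosed (N : Set (X × Y))) : N.ClosedComplemented :=
  closedComplemented_of_equiv (WithLp.prodContinuousLinearEquiv 2 ℝ X Y) N hN

variable {X Y E T₀ T₁ T₂ : Type*} [NormedAddCommGroup X] [InnerProductSpace ℝ X]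
  [CompleteSpace X] [NormedAddCommGroup Y] [InnerProductSpace ℝ Y] [CompleteSpace Y]
  [NormedAddCommGroup E] [NormedSpace ℝ E]
  [NormedAddCommGroup T₀] [InnerProductSpace ℝ T₀] [CompleteSpace T₀]
  [NormedAddCommGroup T₁] [InnerProductSpace ℝ T₁] [CompleteSpace T₁]
  [NormedAddCommGroup T₂] [InnerProductSpace ℝ T₂] [CompleteSpace T₂]
  {a : X →L[ℝ] E} {b : Y →L[ℝ] E} {p₀ : E →L[ℝ] T₀} {p₁ : E →L[ℝ] T₁} {m : Y →L[ℝ] T₂}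

variable (a b p₀ p₁ m) in
/-- The operator `(x, y) ↦ (p₁ (b y - a x), p₀ (b y - a x), m y)`, whose restriction to the fibre
product of `a` and `b` is `m`. -/
def fibreOperator : X × Y →L[ℝ] T₁ × T₀ × T₂ :=
  (p₁ ∘L (b ∘L .snd ℝ X Y - a ∘L .fst ℝ X Y)).prod
    ((p₀ ∘L (b ∘L .snd ℝ X Y - a ∘L .fst ℝ X Y)).prod (m ∘L .snd ℝ X Y))

/-- Up to the compact summand `p₀ ∘ a`, the operator `fibreOperator` is triangular, with diagonal
entries `p₁ ∘ a` and `(p₀ ∘ b, m)`. -/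
theorem algFredholm_fibreOperator (ha : AlgFredholm ((p₁ ∘L a : X →L[ℝ] T₁) : X →ₗ[ℝ] T₁))
    (hc : IsCompactOperator (p₀ ∘L a))
    (hm : AlgFredholm (((p₀ ∘L b).prod m : Y →L[ℝ] T₀ × T₂) : Y →ₗ[ℝ] T₀ × T₂)) :
    AlgFredholm (fibreOperator a b p₀ p₁ m : X × Y →ₗ[ℝ] T₁ × T₀ × T₂) ∧
      (fibreOperator a b p₀ p₁ m : X × Y →ₗ[ℝ] T₁ × T₀ × T₂).index =
        (((p₀ ∘L b).prod m : Y →L[ℝ] T₀ × T₂) : Y →ₗ[ℝ] T₀ × T₂).index +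
        ((p₁ ∘L a : X →L[ℝ] T₁) : X →ₗ[ℝ] T₁).index := by
  -- the triangular part is `u₃ ∘ u₂ ∘ u₁`, with `p₁ ∘ a` in `u₁`, `(p₀ ∘ b, m)` in `u₃`, and the
  -- involution `u₂ (t, y) = (p₁ (b y) - t, y)`
  let u₁ : X × Y →ₗ[ℝ] T₁ × Y :=
    LinearMap.prodMap ((p₁ ∘L a : X →L[ℝ] T₁) : X →ₗ[ℝ] T₁) LinearMap.id
  let u₂ : T₁ × Y →ₗ[ℝ] T₁ × Y :=
    ((p₁ ∘L b : Y →L[ℝ] T₁) : Y →ₗ[ℝ] T₁).comp (LinearMap.snd ℝ T₁ Y) - LinearMap.fst ℝ T₁ Y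
      |>.prod (LinearMap.snd ℝ T₁ Y)
  let u₃ : T₁ × Y →ₗ[ℝ] T₁ × T₀ × T₂ := LinearMap.prodMap LinearMap.id
    (((p₀ ∘L b).prod m : Y →L[ℝ] T₀ × T₂) : Y →ₗ[ℝ] T₀ × T₂)
  have id1 : AlgFredholm (LinearMap.id : Y →ₗ[ℝ] Y) :=
    algFredholm_of_bijective Function.bijective_id
  have id2 : AlgFredholm (LinearMap.id : T₁ →ₗ[ℝ] T₁) :=
    algFredholm_of_bijective Function.bijective_id
  obtain ⟨h1, i1⟩ := ha.prodMap id1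
  obtain ⟨h3, i3⟩ := id2.prodMap hm
  have hinv : Function.Involutive u₂ := by
    rintro ⟨t, y⟩
    simp [u₂]
  have h2 : AlgFredholm u₂ := algFredholm_of_bijective hinv.bijective
  have i2 : u₂.index = 0 := index_of_bijective hinv.bijective
  have h32 := h3.comp (h2.comp h1)
  have i32 := h3.index_comp (h2.comp h1)
  rw [h2.index_comp h1, i1, i2, i3] at i32
  let M₀ : X × Y →L[ℝ] T₁ × T₀ × T₂ :=
    (p₁ ∘L (b ∘L .snd ℝ X Y - a ∘L .fst ℝ X Y)).prod
      (((p₀ ∘L b).prod m : Y →L[ℝ] T₀ × T₂) ∘L .snd ℝ X Y)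
  have hM₀ : (M₀ : X × Y →ₗ[ℝ] T₁ × T₀ × T₂) = u₃ ∘ₗ u₂ ∘ₗ u₁ := by
    ext x <;> simp [M₀, u₁, u₂, u₃]
  have hM : fibreOperator a b p₀ p₁ m =
      M₀ + (ContinuousLinearMap.inr ℝ T₁ (T₀ × T₂) ∘L ContinuousLinearMap.inl ℝ T₀ T₂) ∘L
        ((p₀ ∘L a) ∘L (-ContinuousLinearMap.fst ℝ X Y)) := by
    ext x <;> simp [M₀, fibreOperator]
  have hap := ((approximable_of_isCompactOperator hc).comp_right
    (-ContinuousLinearMap.fst ℝ X Y)).comp_left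
    (ContinuousLinearMap.inr ℝ T₁ (T₀ × T₂) ∘L ContinuousLinearMap.inl ℝ T₀ T₂)
  obtain ⟨r1, r2⟩ := AlgFredholm.add_approximable (u := M₀) (by rw [hM₀]; exact h32) hap
  rw [hM]
  refine ⟨r1, r2.trans ?_⟩
  rw [hM₀, i32]
  simp only [LinearMap.index_id]
  ring

/-- Transversality: the cokernel of `(x, y) ↦ b y - a x` is a quotient of that of `fibreOperator`,
so it is finite-dimensional and the range is closed; since `b` has dense image, the range is
everything. -/
theorem surjective_sub [CompleteSpace E] (hp : Function.Bijective (p₁.prod p₀))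
    (ha : AlgFredholm ((p₁ ∘L a : X →L[ℝ] T₁) : X →ₗ[ℝ] T₁))
    (hc : IsCompactOperator (p₀ ∘L a))
    (hm : AlgFredholm (((p₀ ∘L b).prod m : Y →L[ℝ] T₀ × T₂) : Y →ₗ[ℝ] T₀ × T₂))
    (hb : Dense (range b)) (e : E) : ∃ x y, b y - a x = e := by
  obtain ⟨⟨_, hM⟩, -⟩ := algFredholm_fibreOperator ha hc hm
  let S : X × Y →L[ℝ] E := b ∘L .snd ℝ X Y - a ∘L .fst ℝ X Y
  let J : E ≃ₗ[ℝ] T₁ × T₀ := LinearEquiv.ofBijective (p₁.prod p₀ : E →ₗ[ℝ] T₁ × T₀) hp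
  let q : T₁ × T₀ × T₂ →ₗ[ℝ] T₁ × T₀ :=
    LinearMap.prodMap LinearMap.id (LinearMap.fst ℝ T₀ T₂)
  let φ : T₁ × T₀ × T₂ →ₗ[ℝ] E ⧸ S.range := S.range.mkQ ∘ₗ J.symm.toLinearMap ∘ₗ q
  have hφ : (fibreOperator a b p₀ p₁ m : X × Y →ₗ[ℝ] T₁ × T₀ × T₂).range ≤ φ.ker := by
    rintro _ ⟨z, rfl⟩
    have : q (fibreOperator a b p₀ p₁ m z) = J (S z) := rfl
    simp only [LinearMap.mem_ker, φ, LinearMap.comp_apply]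
    erw [this]
    simp
  have hs : Function.Surjective ((fibreOperator a b p₀ p₁ m :
      X × Y →ₗ[ℝ] T₁ × T₀ × T₂).range.liftQ φ hφ) := by
    intro y
    obtain ⟨y, rfl⟩ := S.range.mkQ_surjective y
    refine ⟨Submodule.Quotient.mk ((J y).1, (J y).2, 0), ?_⟩
    have : q ((J y).1, (J y).2, 0) = J y := rfl
    simp [φ, this]
  have : FiniteDimensional ℝ (E ⧸ S.range) := Module.Finite.of_surjective _ hs
  have hcl := isClosed_range_of_finiteDimensional_coker S
    (closedComplemented_prod _ S.isClosed_ker)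
  have hbS : range b ⊆ (S.range : Set E) := by
    rintro _ ⟨y, rfl⟩
    exact ⟨(0, y), by simp [S]⟩
  have he : e ∈ (S.range : Set E) := by
    have := hb.mono hbS
    rw [dense_iff_closure_eq, hcl.closure_eq] at this
    rw [this]; trivial
  obtain ⟨⟨x, y⟩, h⟩ := he
  exact ⟨x, y, h⟩

/-- The restriction of `m` to the fibre product of `a` and `b` has the kernel and the cokernel of
`fibreOperator`. The fibre product is given as the image of an injective map `D`. -/
theorem algFredholm_fibre [CompleteSpace E] (hp : Function.Bijective (p₁.prod p₀))
    (ha : AlgFredholm ((p₁ ∘L a : X →L[ℝ] T₁) : X →ₗ[ℝ] T₁))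
    (hc : IsCompactOperator (p₀ ∘L a))
    (hm : AlgFredholm (((p₀ ∘L b).prod m : Y →L[ℝ] T₀ × T₂) : Y →ₗ[ℝ] T₀ × T₂))
    (hb : Dense (range b)) {T : Type*} [AddCommGroup T] [Module ℝ T] (D : T →ₗ[ℝ] X × Y)
    (hD : Function.Injective D) (hr : range D = {t | a t.1 = b t.2}) :
    AlgFredholm ((m : Y →ₗ[ℝ] T₂) ∘ₗ LinearMap.snd ℝ X Y ∘ₗ D) ∧
      ((m : Y →ₗ[ℝ] T₂) ∘ₗ LinearMap.snd ℝ X Y ∘ₗ D).index =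
        (((p₀ ∘L b).prod m : Y →L[ℝ] T₀ × T₂) : Y →ₗ[ℝ] T₀ × T₂).index +
        ((p₁ ∘L a : X →L[ℝ] T₁) : X →ₗ[ℝ] T₁).index := by
  obtain ⟨⟨h1, h2⟩, hi⟩ := algFredholm_fibreOperator ha hc hm
  have hsurj := surjective_sub hp ha hc hm hb
  set M := (fibreOperator a b p₀ p₁ m : X × Y →ₗ[ℝ] T₁ × T₀ × T₂) with hMdef
  set L := (m : Y →ₗ[ℝ] T₂) ∘ₗ LinearMap.snd ℝ X Y ∘ₗ D with hL
  have hMapp : ∀ z : X × Y, M z = (p₁ (b z.2 - a z.1), p₀ (b z.2 - a z.1), m z.2) := fun z => rfl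
  have hDk : ∀ t, b (D t).2 - a (D t).1 = 0 := fun t => by
    have : D t ∈ range D := ⟨t, rfl⟩
    rw [hr] at this
    exact sub_eq_zero.2 this.symm
  have hp0 : ∀ v, p₁ v = 0 → p₀ v = 0 → v = 0 := fun v hv hv' =>
    hp.1 (by simp [hv, hv'])
  -- `α` identifies the kernels
  let α : L.ker →ₗ[ℝ] M.ker := D.restrict (fun t ht => by
    have ht' : m (D t).2 = 0 := ht
    rw [LinearMap.mem_ker, hMapp, hDk, ht']; simp)
  have hα : Function.Bijective α := by
    constructor
    · intro t t' h
      exact Subtype.ext (hD (congrArg Subtype.val h))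
    · rintro ⟨z, hz⟩
      rw [LinearMap.mem_ker, hMapp] at hz
      have hz1 := congrArg Prod.fst hz
      have hz2 := congrArg (fun t => t.2.1) hz
      have hz3 := congrArg (fun t => t.2.2) hz
      have h0 := hp0 _ hz1 hz2
      have : z ∈ range D := by
        rw [hr]; exact (sub_eq_zero.1 h0).symm
      obtain ⟨t, rfl⟩ := this
      exact ⟨⟨t, hz3⟩, rfl⟩
  -- `β` induces the isomorphism of cokernels; it is onto because `b y - a x` takes all values
  let β : T₂ →ₗ[ℝ] (T₁ × T₀ × T₂) ⧸ M.range :=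
    M.range.mkQ ∘ₗ LinearMap.inr ℝ T₁ (T₀ × T₂) ∘ₗ LinearMap.inr ℝ T₀ T₂
  have hβ : Function.Surjective β := by
    intro y
    obtain ⟨⟨y₁, y₀, y₂⟩, rfl⟩ := M.range.mkQ_surjective y
    obtain ⟨e, he⟩ := hp.2 (y₁, y₀)
    obtain ⟨x, z, hxz⟩ := hsurj e
    refine ⟨y₂ - m z, ?_⟩
    have : β (y₂ - m z) = M.range.mkQ (0, 0, y₂ - m z) := rfl
    rw [this, ← sub_eq_zero, ← map_sub, Submodule.mkQ_apply, Submodule.Quotient.mk_eq_zero]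
    refine ⟨-(x, z), ?_⟩
    rw [map_neg, hMapp, hxz]
    have e1 : p₁ e = y₁ := congrArg Prod.fst he
    have e0 : p₀ e = y₀ := congrArg Prod.snd he
    simp [e1, e0]
  have hk : β.ker = L.range := by
    ext t
    have : β t = M.range.mkQ (0, 0, t) := rfl
    rw [LinearMap.mem_ker, this, Submodule.mkQ_apply, Submodule.Quotient.mk_eq_zero]
    constructor
    · rintro ⟨z, hz⟩
      rw [hMapp] at hz
      have hz1 := congrArg Prod.fst hz
      have hz2 := congrArg (fun t => t.2.1) hz
      have hz3 := congrArg (fun t => t.2.2) hz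
      have h0 := hp0 _ hz1 hz2
      have : z ∈ range D := by
        rw [hr]; exact (sub_eq_zero.1 h0).symm
      obtain ⟨t', rfl⟩ := this
      exact ⟨t', hz3⟩
    · rintro ⟨t', rfl⟩
      refine ⟨D t', ?_⟩
      rw [hMapp, hDk]
      simp [hL]
  let e1 := LinearEquiv.ofBijective α hα
  let e2 : (T₂ ⧸ L.range) ≃ₗ[ℝ] _ :=
    (Submodule.quotEquivOfEq _ _ hk.symm).trans (β.quotKerEquivOfSurjective hβ)
  refine ⟨⟨Module.Finite.equiv e1.symm, Module.Finite.equiv e2.symm⟩, ?_⟩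
  rw [← hi, LinearMap.index_eq_finrank_sub, LinearMap.index_eq_finrank_sub, e1.finrank_eq,
    e2.finrank_eq]

end FibreProductFredholm

/-! ### Inverse functions depending continuously on a parameter -/

section InverseFunction

/-- A continuous map is smooth as soon as its composition with an immersion is: near a point, the
immersion followed by a left inverse of its derivative is a local diffeomorphism. -/
theorem contDiffWithinAt_of_comp_immersion {X Y T : Type*} [NormedAddCommGroup X]
    [NormedSpace ℝ X] [CompleteSpace X] [NormedAddCommGroup Y] [NormedSpace ℝ Y]
    [NormedAddCommGroup T] [NormedSpace ℝ T] {Ψ : X → Y} {h : T → X} {s : Set T} {t : T}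
    (hΨ : ContDiffAt ℝ ∞ Ψ (h t)) {R : Y →L[ℝ] X}
    (hR : R ∘L fderiv ℝ Ψ (h t) = ContinuousLinearMap.id ℝ X)
    (hc : ContinuousWithinAt h s t) (hcomp : ContDiffWithinAt ℝ ∞ (Ψ ∘ h) s t) :
    ContDiffWithinAt ℝ ∞ h s t := by
  have hφ : ContDiffAt ℝ ∞ (R ∘ Ψ) (h t) := R.contDiff.contDiffAt.comp _ hΨ
  have hd : HasFDerivAt (R ∘ Ψ) ((ContinuousLinearEquiv.refl ℝ X : X ≃L[ℝ] X) : X →L[ℝ] X)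
      (h t) := by
    have h1 := R.hasFDerivAt.comp (h t) (hΨ.differentiableAt (by simp)).hasFDerivAt
    rw [hR] at h1
    exact h1
  have hn : (∞ : WithTop ℕ∞) ≠ 0 := by simp
  have hinv := hφ.to_localInverse hd hn
  have hev := (hφ.hasStrictFDerivAt' hd hn).eventually_left_inverse
  have h1 : ContDiffWithinAt ℝ ∞ (hφ.localInverse hd hn ∘ (R ∘ Ψ ∘ h)) s t :=
    hinv.comp_contDiffWithinAt t (R.contDiff.comp_contDiffWithinAt hcomp)
  refine h1.congr_of_eventuallyEq ?_ ?_
  · filter_upwards [hc hev] with x hx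
    exact hx.symm
  · exact hev.self_of_nhds.symm

/-- The inverse function theorem for a family `Ψ(·, s)` of `C¹` maps depending continuously,
together with the derivative, on a parameter `s` in a subset `C` of a topological space. On a ball
that does not depend on `s`, each `Ψ(·, s)` is uniformly approximated by one invertible linear map.
-/
theorem exists_parametric_inverse {A Y S : Type*} [NormedAddCommGroup A] [NormedSpace ℝ A]
    [CompleteSpace A] [NormedAddCommGroup Y] [NormedSpace ℝ Y] [TopologicalSpace S]
    {C : Set S} {U : Set A} (hU : IsOpen U) {a₀ : A} {s₀ : S} (ha₀ : a₀ ∈ U) (hs₀ : s₀ ∈ C)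
    {Ψ : A × S → Y} (hΨ : ContinuousOn Ψ (U ×ˢ C))
    (hd : ∀ s ∈ C, DifferentiableOn ℝ (fun a => Ψ (a, s)) U)
    (hd' : ContinuousOn (fun q : A × S => fderiv ℝ (fun a => Ψ (a, q.2)) q.1) (U ×ˢ C))
    (h0 : Ψ (a₀, s₀) = 0) (hL : (fderiv ℝ (fun a => Ψ (a, s₀)) a₀).IsInvertible) :
    ∃ ρ > 0, ∃ r > 0, ∃ N ∈ 𝓝 s₀, ∃ g : Y × S → A, Metric.ball a₀ ρ ⊆ U ∧
      (∀ y ∈ Metric.ball (0 : Y) r, ∀ s ∈ N ∩ C, g (y, s) ∈ Metric.ball a₀ ρ ∧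
        Ψ (g (y, s), s) = y) ∧
      (∀ a ∈ Metric.ball a₀ ρ, ∀ s ∈ N ∩ C, Ψ (a, s) ∈ Metric.ball (0 : Y) r →
        g (Ψ (a, s), s) = a) ∧
      ContinuousOn g (Metric.ball (0 : Y) r ×ˢ (N ∩ C)) ∧
      ∀ a ∈ Metric.ball a₀ ρ, ∀ s ∈ N ∩ C, (fderiv ℝ (fun a => Ψ (a, s)) a).IsInvertible := by
  obtain ⟨L, hL⟩ := hL
  set n : NNReal := ‖(L.symm : Y →L[ℝ] A)‖₊ + 1 with hn
  have hn0 : (0 : ℝ) < n := by positivity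
  have hnb : ∀ y, ‖L.symm y‖ ≤ n * ‖y‖ := fun y => by
    have := (L.symm : Y →L[ℝ] A).le_opNorm y
    refine this.trans ?_
    gcongr
    simp [hn]
  let Linv : (L : A →L[ℝ] Y).NonlinearRightInverse :=
    ⟨L.symm, n, hnb, fun y => L.apply_symm_apply y⟩
  -- since `‖L⁻¹‖ ≤ n`, a perturbation of `L` with Lipschitz constant `c` expands distances by at
  -- least the factor `1 / n - c = c`
  set c : NNReal := (2 * n)⁻¹ with hc
  have hc0 : (0 : ℝ) < c := by positivity
  have hcn : (n : ℝ)⁻¹ - c = c := by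
    rw [hc]; push_cast; field_simp; ring
  have hev : ∀ᶠ q : A × S in 𝓝 a₀ ×ˢ 𝓝[C] s₀, q.1 ∈ U ∧
      ‖fderiv ℝ (fun a => Ψ (a, q.2)) q.1 - L‖ ≤ c ∧
      (fderiv ℝ (fun a => Ψ (a, q.2)) q.1).IsInvertible := by
    have h1 : 𝓝 a₀ ×ˢ 𝓝[C] s₀ = 𝓝[U ×ˢ C] (a₀, s₀) := by
      rw [nhdsWithin_prod_eq, hU.nhdsWithin_eq ha₀]
    have h2 : Tendsto (fun q : A × S => fderiv ℝ (fun a => Ψ (a, q.2)) q.1)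
        (𝓝 a₀ ×ˢ 𝓝[C] s₀) (𝓝 (L : A →L[ℝ] Y)) := by
      rw [h1, hL]; exact hd' (a₀, s₀) ⟨ha₀, hs₀⟩
    have h3 := h2.eventually (ContinuousLinearEquiv.nhds L)
    have h4 := h2.eventually (Metric.closedBall_mem_nhds (L : A →L[ℝ] Y) hc0)
    have h5 : ∀ᶠ q : A × S in 𝓝 a₀ ×ˢ 𝓝[C] s₀, q.1 ∈ U :=
      tendsto_fst.eventually (hU.mem_nhds ha₀)
    filter_upwards [h3, h4, h5] with q h3 h4 h5
    exact ⟨h5, by simpa [dist_eq_norm] using h4, h3⟩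
  obtain ⟨pa, hpa, ps, hps, hprod⟩ := eventually_prod_iff.1 hev
  obtain ⟨ρ, hρ, hball⟩ := Metric.eventually_nhds_iff_ball.1 hpa
  set r := c * (ρ / 2) / 2 with hr
  have hr0 : 0 < r := by positivity
  have hΨs : ∀ᶠ s in 𝓝[C] s₀, ‖Ψ (a₀, s)‖ < r := by
    have h1 : ContinuousOn (fun s => Ψ (a₀, s)) C :=
      hΨ.comp (by fun_prop) (fun s hs => ⟨ha₀, hs⟩)
    have h2 := (h1 s₀ hs₀).norm
    simp only [ContinuousWithinAt, h0, norm_zero] at h2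
    exact h2.eventually (gt_mem_nhds hr0)
  obtain ⟨N, hN, hNC⟩ := mem_nhdsWithin_iff_exists_mem_nhds_inter.1 (hps.and hΨs)
  have hUb : Metric.ball a₀ ρ ⊆ U := fun a ha =>
    (hprod (hball a ha) (hNC ⟨mem_of_mem_nhds hN, hs₀⟩).1).1
  have happ : ∀ s ∈ N ∩ C, ApproximatesLinearOn (fun a => Ψ (a, s)) (L : A →L[ℝ] Y)
      (Metric.ball a₀ ρ) c := by
    intro s hs x hx y hy
    refine (convex_ball a₀ ρ).norm_image_sub_le_of_norm_hasFDerivWithin_le' (𝕜 := ℝ)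
      (f := fun a => Ψ (a, s)) (φ := (L : A →L[ℝ] Y))
      (f' := fun a => fderiv ℝ (fun a => Ψ (a, s)) a) ?_ ?_ hy hx
    · intro a ha
      exact ((hd s hs.2 a (hUb ha)).differentiableAt
        (hU.mem_nhds (hUb ha))).hasFDerivAt.hasFDerivWithinAt
    · intro a ha
      exact (hprod (hball a ha) (hNC hs).1).2.1
  have hanti : ∀ s ∈ N ∩ C, ∀ x ∈ Metric.ball a₀ ρ, ∀ y ∈ Metric.ball a₀ ρ,
      ‖x - y‖ ≤ 2 * n * ‖Ψ (x, s) - Ψ (y, s)‖ := by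
    intro s hs x hx y hy
    have h1 := happ s hs x hx y hy
    have h2 : ‖x - y‖ ≤ n * ‖L (x - y)‖ := by
      have := hnb (L (x - y))
      rwa [L.symm_apply_apply] at this
    have h3 : ‖L (x - y)‖ ≤ ‖Ψ (x, s) - Ψ (y, s)‖ + c * ‖x - y‖ := by
      have := norm_sub_norm_le (L (x - y)) (Ψ (x, s) - Ψ (y, s))
      rw [norm_sub_rev (L (x - y)) (Ψ (x, s) - Ψ (y, s))] at this
      have h1' : ‖Ψ (x, s) - Ψ (y, s) - L (x - y)‖ ≤ c * ‖x - y‖ := h1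
      linarith
    have h4 : (n : ℝ) * (c * ‖x - y‖) = ‖x - y‖ / 2 := by
      rw [hc]; push_cast; field_simp
    have h5 : ‖x - y‖ ≤ n * ‖Ψ (x, s) - Ψ (y, s)‖ + ‖x - y‖ / 2 := by
      calc _ ≤ n * ‖L (x - y)‖ := h2
        _ ≤ n * (‖Ψ (x, s) - Ψ (y, s)‖ + c * ‖x - y‖) := by gcongr
        _ = _ := by rw [mul_add, h4]
    linarith
  have hex : ∀ q : Y × S, ∃ a, q.1 ∈ Metric.ball (0 : Y) r → q.2 ∈ N ∩ C →
      a ∈ Metric.ball a₀ ρ ∧ Ψ (a, q.2) = q.1 := by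
    rintro ⟨y, s⟩
    by_cases hy : y ∈ Metric.ball (0 : Y) r ∧ s ∈ N ∩ C
    · have hsub : Metric.closedBall a₀ (ρ / 2) ⊆ Metric.ball a₀ ρ :=
        Metric.closedBall_subset_ball (by linarith)
      have hsurj := (happ s hy.2).surjOn_closedBall_of_nonlinearRightInverse Linv
        (by positivity : 0 ≤ ρ / 2) hsub
      have hmem : y ∈ Metric.closedBall (Ψ (a₀, s)) (((Linv.nnnorm : ℝ)⁻¹ - c) * (ρ / 2)) := by
        have : ((Linv.nnnorm : ℝ)⁻¹ - c) * (ρ / 2) = r + r := by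
          change ((n : ℝ)⁻¹ - c) * (ρ / 2) = r + r
          rw [hcn, hr]; ring
        rw [this, mem_closedBall_iff_norm]
        have h1 : ‖y‖ < r := by simpa using hy.1
        have h2 : ‖Ψ (a₀, s)‖ < r := (hNC hy.2).2
        exact (norm_sub_le _ _).trans (by linarith)
      obtain ⟨a, ha, hay⟩ := hsurj hmem
      exact ⟨a, fun _ _ => ⟨hsub ha, hay⟩⟩
    · exact ⟨a₀, fun h1 h2 => absurd ⟨h1, h2⟩ hy⟩
  choose g hg using hex
  have hg' : ∀ y ∈ Metric.ball (0 : Y) r, ∀ s ∈ N ∩ C, g (y, s) ∈ Metric.ball a₀ ρ ∧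
        Ψ (g (y, s), s) = y := fun y hy s hs => hg (y, s) hy hs
  refine ⟨ρ, hρ, r, hr0, N, hN, g, hUb, hg', ?_, ?_, ?_⟩
  · intro a ha s hs has
    obtain ⟨h1, h2⟩ := hg' _ has s hs
    have := hanti s hs _ h1 _ ha
    rw [h2, sub_self, norm_zero, mul_zero] at this
    exact sub_eq_zero.1 (norm_le_zero_iff.1 this)
  · rintro ⟨y', s'⟩ ⟨hy', hs'⟩
    obtain ⟨h1, h2⟩ := hg' y' hy' s' hs'
    rw [ContinuousWithinAt, tendsto_iff_norm_sub_tendsto_zero]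
    have h3 : Tendsto (fun q : Y × S => 2 * n * ‖q.1 - Ψ (g (y', s'), q.2)‖)
        (𝓝[Metric.ball (0 : Y) r ×ˢ (N ∩ C)] (y', s')) (𝓝 0) := by
      have h4 : ContinuousOn (fun q : Y × S => 2 * n * ‖q.1 - Ψ (g (y', s'), q.2)‖)
          (Metric.ball (0 : Y) r ×ˢ (N ∩ C)) := by
        refine continuousOn_const.mul (ContinuousOn.norm (continuousOn_fst.sub ?_))
        exact hΨ.comp (by fun_prop) (fun q hq => ⟨hUb h1, hq.2.2⟩)
      have h5 := h4 (y', s') ⟨hy', hs'⟩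
      simp only [ContinuousWithinAt] at h5
      rw [h2, sub_self, norm_zero, mul_zero] at h5
      exact h5
    refine tendsto_of_tendsto_of_tendsto_of_le_of_le' tendsto_const_nhds h3
      (Eventually.of_forall fun _ => norm_nonneg _) ?_
    filter_upwards [self_mem_nhdsWithin] with q hq
    obtain ⟨h6, h7⟩ := hg' q.1 hq.1 q.2 hq.2
    have := hanti q.2 hq.2 _ h6 _ h1
    rwa [h7] at this
  · intro a ha s hs
    exact (hprod (hball a ha) (hNC hs).1).2.2

/-- Smoothness of a parametric inverse `g` along a subset `T` of the parameter space that is locally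
the image of a smooth projection `π`. The composition with `π` extends `Ψ` smoothly to an open set
of parameters; there the usual argument applies to `(a, s) ↦ (Ψ (a, s), s)`. -/
theorem contDiffWithinAt_parametric_inverse {A Y S : Type*} [NormedAddCommGroup A]
    [NormedSpace ℝ A] [CompleteSpace A] [NormedAddCommGroup Y] [NormedSpace ℝ Y]
    [NormedAddCommGroup S] [NormedSpace ℝ S] [CompleteSpace S] {T : Set S} {U : Set A}
    (hU : IsOpen U)
    {Ψ : A × S → Y} (hΨ : ContDiffOn ℝ ∞ Ψ (U ×ˢ T)) {g : Y × S → A} {V : Set Y} {y : Y} {s : S}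
    (hs : s ∈ T) {π : S → S} (hπ : ContDiff ℝ ∞ π) (hπs : ∀ᶠ t in 𝓝 s, π t ∈ T)
    (hπT : ∀ᶠ t in 𝓝[T] s, π t = t) (hgU : g (y, s) ∈ U)
    (hg : ContinuousWithinAt g (V ×ˢ T) (y, s)) (hy : y ∈ V)
    (hgΨ : ∀ q ∈ V ×ˢ T, Ψ (g q, q.2) = q.1)
    (hinv : (fderiv ℝ (fun a => Ψ (a, s)) (g (y, s))).IsInvertible) :
    ContDiffWithinAt ℝ ∞ g (V ×ˢ T) (y, s) := by
  have hπs0 : π s = s := hπT.self_of_nhdsWithin hs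
  let Φ : A × S → Y × S := fun q => (Ψ (q.1, π q.2), q.2)
  let h : Y × S → A × S := fun q => (g q, q.2)
  have hΨ' : ContDiffAt ℝ ∞ (fun q : A × S => Ψ (q.1, π q.2)) (g (y, s), s) := by
    have h1 : ContDiffWithinAt ℝ ∞ Ψ (U ×ˢ T) (g (y, s), π s) := by
      rw [hπs0]; exact hΨ _ ⟨hgU, hs⟩
    have h2 : ContDiffAt ℝ ∞ (fun q : A × S => (q.1, π q.2)) (g (y, s), s) := by fun_prop
    have h3 : ∀ᶠ q : A × S in 𝓝 (g (y, s), s), (q.1, π q.2) ∈ U ×ˢ T := by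
      rw [nhds_prod_eq]
      exact (hU.eventually_mem hgU).prod_mk hπs
    have h4 := ContDiffWithinAt.comp_of_preimage_mem_nhdsWithin (g (y, s), s) (s := univ) h1
      h2.contDiffWithinAt (by rw [nhdsWithin_univ]; exact h3)
    exact h4.contDiffAt univ_mem
  have hΦ : ContDiffAt ℝ ∞ Φ (h (y, s)) := hΨ'.prodMk contDiffAt_snd
  obtain ⟨M, hM⟩ := hinv
  set F := fderiv ℝ (fun q : A × S => Ψ (q.1, π q.2)) (g (y, s), s) with hF
  have hFd : HasFDerivAt (fun q : A × S => Ψ (q.1, π q.2)) F (g (y, s), s) :=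
    (hΨ'.differentiableAt (by simp)).hasFDerivAt
  have hΦd : fderiv ℝ Φ (h (y, s)) = F.prod (ContinuousLinearMap.snd ℝ A S) :=
    (hFd.prodMk hasFDerivAt_snd).fderiv
  have hFa : F ∘L ContinuousLinearMap.inl ℝ A S = M := by
    have h1 : HasFDerivAt (fun a : A => (a, s)) (ContinuousLinearMap.inl ℝ A S) (g (y, s)) :=
      hasFDerivAt_prodMk_left _ _
    have h2 := (HasFDerivAt.comp (g (y, s)) hFd h1).fderiv
    rw [hM, ← h2]
    congr 1
    ext a
    simp [Function.comp, hπs0]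
  -- the inverse of the triangular derivative `F.prod (snd)` of `Φ`
  let R : Y × S →L[ℝ] A × S :=
    ((M.symm : Y →L[ℝ] A) ∘L (ContinuousLinearMap.fst ℝ Y S -
      (F ∘L ContinuousLinearMap.inr ℝ A S) ∘L ContinuousLinearMap.snd ℝ Y S)).prod
      (ContinuousLinearMap.snd ℝ Y S)
  have hR : R ∘L fderiv ℝ Φ (h (y, s)) = ContinuousLinearMap.id ℝ (A × S) := by
    rw [hΦd]
    have hFs : ∀ q : A × S, F q - F (0, q.2) = M q.1 := fun q => by
      rw [← map_sub, ← ContinuousLinearEquiv.coe_coe, ← hFa]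
      simp [Prod.sub_def]
    refine ContinuousLinearMap.ext fun q => ?_
    change (M.symm (F q - F (0, q.2)), q.2) = q
    rw [hFs, M.symm_apply_apply]
  have hcomp : ContDiffWithinAt ℝ ∞ (Φ ∘ h) (V ×ˢ T) (y, s) := by
    refine (contDiffWithinAt_id (n := ∞)).congr_of_eventuallyEq ?_ ?_
    · have h1 : ∀ᶠ q : Y × S in 𝓝[V ×ˢ T] (y, s), π q.2 = q.2 := by
        rw [nhdsWithin_prod_eq]
        exact tendsto_snd.eventually hπT
      filter_upwards [h1, self_mem_nhdsWithin] with q hq hq'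
      simp [Φ, h, hq, hgΨ q hq']
    · simp [Φ, h, hπs0, hgΨ (y, s) ⟨hy, hs⟩]
  have := contDiffWithinAt_of_comp_immersion hΦ hR
    (hg.prodMk continuousWithinAt_snd) hcomp
  exact contDiff_fst.comp_contDiffWithinAt this

end InverseFunction

/-! ### Smooth maps into the open strata of a stratified space -/

section StratSmooth

theorem HilbertChart.eventually_mem_source {P : Type u} [TopologicalSpace P] {A : Set P}
    (c : HilbertChart.{u, w} A) {p : P} (hp : p ∈ c.coord.source) :
    ∀ᶠ p' in 𝓝[A] p, p' ∈ c.coord.source := by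
  obtain ⟨U, hU, hs⟩ := c.source_eq
  rw [hs] at hp ⊢
  filter_upwards [mem_nhdsWithin_of_mem_nhds (hU.mem_nhds hp.1), self_mem_nhdsWithin] with x h1 h2
  exact ⟨h1, h2⟩

variable {P : Type u} [TopologicalSpace P] [T2Space P] [SecondCountableTopology P]

theorem HilbertChart.codim_eq {S : StratifiedSpace.{u, w} P} {i : ℕ}
    (c : HilbertChart.{u, w} {p | S.codim p = i}) {p : P} (hp : p ∈ c.coord.source) :
    S.codim p = i := by
  obtain ⟨U, -, hU⟩ := c.source_eq
  rw [hU] at hp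
  exact hp.2

theorem StratifiedSpace.exists_chart_of_codim_eq (S : StratifiedSpace.{u, w} P) {i : ℕ} {p : P}
    (hp : S.codim p = i) : ∃ c ∈ S.atlas i, p ∈ c.coord.source := by
  subst hp
  exact S.exists_chart p

/-- Near a point, the codimension does not increase. -/
theorem StratifiedSpace.eventually_codim_le (S : StratifiedSpace.{u, w} P) (p : P) :
    ∀ᶠ p' in 𝓝 p, S.codim p' ≤ S.codim p := by
  have h : IsOpen {p' | S.codim p + 1 ≤ S.codim p'}ᶜ := (S.isClosed_stratum _).isOpen_compl
  filter_upwards [h.mem_nhds (by simp : p ∈ {p' | S.codim p + 1 ≤ S.codim p'}ᶜ)] with p' hp'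
  simp only [mem_compl_iff, mem_ofPred_eq] at hp'
  omega

/-- Smoothness within `s` at `t` of a map `h` with values in a stratified space, as a map into the
open stratum of `h t`. -/
structure StratSmoothAt (S : StratifiedSpace.{u, w} P) {T : Type*} [NormedAddCommGroup T]
    [NormedSpace ℝ T] (h : T → P) (s : Set T) (t : T) : Prop where
  continuousWithinAt : ContinuousWithinAt h s t
  codim_eq : ∀ᶠ t' in 𝓝[s] t, S.codim (h t') = S.codim (h t)
  contDiff : ∀ d ∈ S.atlas (S.codim (h t)), h t ∈ d.coord.source →
    ContDiffWithinAt ℝ ∞ (fun t' => d.coord (h t')) s t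

variable {S : StratifiedSpace.{u, w} P} {T : Type*} [NormedAddCommGroup T] [NormedSpace ℝ T]
  {h : T → P} {s : Set T} {t : T}

theorem StratSmoothAt.eventually_mem_source (hh : StratSmoothAt S h s t)
    {d : HilbertChart.{u, w} {p | S.codim p = S.codim (h t)}} (hd : h t ∈ d.coord.source) :
    ∀ᶠ t' in 𝓝[s] t, h t' ∈ d.coord.source := by
  have h1 : Tendsto h (𝓝[s] t) (𝓝[{p | S.codim p = S.codim (h t)}] (h t)) :=
    tendsto_nhdsWithin_iff.2 ⟨hh.continuousWithinAt, hh.codim_eq⟩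
  exact h1.eventually (d.eventually_mem_source hd)

/-- Smoothness into a stratum may be checked in a single chart. -/
theorem stratSmoothAt_of_chart {i : ℕ} (hi : S.codim (h t) = i)
    (hc : ContinuousWithinAt h s t) (hcod : ∀ᶠ t' in 𝓝[s] t, S.codim (h t') = i)
    {c : HilbertChart.{u, w} {p | S.codim p = i}} (hcA : c ∈ S.atlas i)
    (hct : h t ∈ c.coord.source) (hsm : ContDiffWithinAt ℝ ∞ (fun t' => c.coord (h t')) s t) :
    StratSmoothAt S h s t := by
  subst hi
  refine ⟨hc, hcod, fun d hd hdt => ?_⟩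
  have hev : ∀ᶠ t' in 𝓝[s] t, h t' ∈ c.coord.source ∧ h t' ∈ d.coord.source := by
    have h1 : Tendsto h (𝓝[s] t) (𝓝[{p | S.codim p = S.codim (h t)}] (h t)) :=
      tendsto_nhdsWithin_iff.2 ⟨hc, hcod⟩
    exact h1.eventually ((c.eventually_mem_source hct).and (d.eventually_mem_source hdt))
  have h2 := S.compatible _ c hcA d hd (c.coord (h t))
    ⟨c.coord.map_source hct, by simpa [c.coord.left_inv hct] using hdt⟩
  have h3 := h2.comp_of_preimage_mem_nhdsWithin t hsm (by
    filter_upwards [hev] with t' ht'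
    exact ⟨c.coord.map_source ht'.1, by simpa [c.coord.left_inv ht'.1] using ht'.2⟩)
  refine h3.congr_of_eventuallyEq ?_ ?_
  · filter_upwards [hev] with t' ht'
    simp [c.coord.left_inv ht'.1]
  · simp [c.coord.left_inv hct]

theorem StratSmoothAt.comp {T' : Type*} [NormedAddCommGroup T'] [NormedSpace ℝ T'] {k : T' → T}
    {s' : Set T'} {t' : T'} (hh : StratSmoothAt S h s (k t'))
    (hk : ContDiffWithinAt ℝ ∞ k s' t') (hm : MapsTo k s' s) :
    StratSmoothAt S (fun x => h (k x)) s' t' := by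
  have hkc : Tendsto k (𝓝[s'] t') (𝓝[s] (k t')) := hk.continuousWithinAt.tendsto_nhdsWithin hm
  exact ⟨hh.continuousWithinAt.comp hk.continuousWithinAt hm, hkc.eventually hh.codim_eq,
    fun d hd hdt => (hh.contDiff d hd hdt).comp t' hk hm⟩

theorem StratSmoothAt.congr {h' : T → P} (hh : StratSmoothAt S h s t) (heq : ∀ x ∈ s, h' x = h x)
    (ht : h' t = h t) : StratSmoothAt S h' s t := by
  have hev : ∀ᶠ x in 𝓝[s] t, h' x = h x := by
    filter_upwards [self_mem_nhdsWithin] with x hx using heq x hx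
  refine ⟨hh.continuousWithinAt.congr heq ht, ?_, fun d hd hdt => ?_⟩
  · filter_upwards [hev, hh.codim_eq] with x hx hx'
    rw [hx, hx', ht]
  · obtain ⟨i, hi⟩ : ∃ i, S.codim (h' t) = i := ⟨_, rfl⟩
    revert d
    rw [ht]
    intro d hd hdt
    exact (hh.contDiff d hd hdt).congr_of_eventuallyEq (hev.mono fun x hx => by simp only [hx])
      (by simp only [ht])

theorem stratSmoothAt_chart_symm {i : ℕ} {c : HilbertChart.{u, w} {p | S.codim p = i}}
    (hc : c ∈ S.atlas i) {e : c.E} (he : e ∈ c.coord.target) :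
    StratSmoothAt S c.coord.symm c.coord.target e := by
  refine stratSmoothAt_of_chart (c.codim_eq (c.coord.map_target he)) (c.continuousOn_symm e he) ?_
    hc (c.coord.map_target he) ?_
  · filter_upwards [self_mem_nhdsWithin] with e' he' using c.codim_eq (c.coord.map_target he')
  · exact contDiffWithinAt_id.congr (fun e' he' => c.coord.right_inv he') (c.coord.right_inv he)

/-- Restricted to a stratum, an lc-smooth map is smooth, so that it may be composed with smooth maps
into the stratum. -/
theorem IsLCSmooth.contMDiffWithinAt_comp {E : Type*} [NormedAddCommGroup E]
    [InnerProductSpace ℝ E] {B : Type*} [TopologicalSpace B] [ChartedSpace E B]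
    {S : LCManifold.{u, w} P} {σ : P → B} (hσ : IsLCSmooth E S σ)
    (hh : StratSmoothAt S.toStratifiedSpace h s t) :
    ContMDiffWithinAt 𝓘(ℝ, T) 𝓘(ℝ, E) ∞ (fun x => σ (h x)) s t := by
  obtain ⟨c, hc, hct⟩ := S.exists_chart (h t)
  have h1 := (hσ.smooth_stratum _ c hc (c.coord (h t)) (c.coord.map_source hct)).contMDiffAt
    (c.isOpen_target.mem_nhds (c.coord.map_source hct))
  have h2 : ContMDiffWithinAt 𝓘(ℝ, T) 𝓘(ℝ, c.E) ∞ (fun x => c.coord (h x)) s t :=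
    (hh.contDiff c hc hct).contMDiffWithinAt
  refine (h1.comp_contMDiffWithinAt t h2).congr_of_eventuallyEq ?_ ?_
  · filter_upwards [hh.eventually_mem_source hct] with x hx
    simp [c.coord.left_inv hx]
  · simp [c.coord.left_inv hct]

/-- An lc-chart is smooth along a map on which the number `m` of vanishing corner coordinates is
constant. -/
theorem LCChart.stratSmoothAt_map {i m : ℕ} (φ : LCChart S i) {r : T → Fin i → ℝ}
    (hh : StratSmoothAt S h s t) (hr : ContDiffWithinAt ℝ ∞ r s t) (ht : t ∈ s)
    (hsrc : ∀ x ∈ s, (h x, r x) ∈ φ.map.source) (hm : ∀ x ∈ s, Set.ncard {j | r x j = 0} = m) :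
    StratSmoothAt S (fun x => φ.map (h x, r x)) s t := by
  have hcod : ∀ x ∈ s, S.codim (φ.map (h x, r x)) = m := fun x hx => by
    have := hsrc x hx
    rw [φ.source_eq] at this
    rw [φ.codim_map _ this.1 _ this.2, hm x hx]
  have hcont : ContinuousWithinAt (fun x => φ.map (h x, r x)) s t :=
    (φ.continuousOn _ (hsrc t ht)).comp (f := fun x => (h x, r x))
      (hh.continuousWithinAt.prodMk hr.continuousWithinAt) hsrc
  have hi : S.codim (h t) = i := by
    have := hsrc t ht
    rw [φ.source_eq] at this
    obtain ⟨U, -, hU⟩ := φ.isOpen_V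
    rw [hU] at this
    exact this.1.2
  obtain ⟨d, hd, hdt⟩ := S.exists_chart_of_codim_eq (hcod t ht)
  subst hi
  obtain ⟨c, hc, hct⟩ := S.exists_chart (h t)
  refine stratSmoothAt_of_chart (hcod t ht) hcont
    (by filter_upwards [self_mem_nhdsWithin] with x hx using hcod x hx) hd hdt ?_
  have hev1 := hh.eventually_mem_source hct
  have hev2 : ∀ᶠ x in 𝓝[s] t, φ.map (h x, r x) ∈ d.coord.source := by
    have h1 : Tendsto (fun x => φ.map (h x, r x)) (𝓝[s] t)
        (𝓝[{p | S.codim p = m}] (φ.map (h t, r t))) :=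
      tendsto_nhdsWithin_iff.2 ⟨hcont, by
        filter_upwards [self_mem_nhdsWithin] with x hx using hcod x hx⟩
    exact h1.eventually (d.eventually_mem_source hdt)
  have h1 := φ.smooth c hc m d hd (c.coord (h t), r t)
    ⟨c.coord.map_source hct, by simpa [c.coord.left_inv hct] using hsrc t ht,
      by simpa [c.coord.left_inv hct] using hdt⟩
  have h2 := h1.comp_of_preimage_mem_nhdsWithin (f := fun x => (c.coord (h x), r x)) t
    ((hh.contDiff c hc hct).prodMk hr) (by
      filter_upwards [hev1, hev2, self_mem_nhdsWithin] with x hx1 hx2 hx3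
      exact ⟨c.coord.map_source hx1, by simpa [c.coord.left_inv hx1] using hsrc x hx3,
        by simpa [c.coord.left_inv hx1] using hx2⟩)
  refine h2.congr_of_eventuallyEq ?_ ?_
  · filter_upwards [hev1] with x hx
    simp [c.coord.left_inv hx]
  · simp [c.coord.left_inv hct]

/-- The inverse of an lc-chart is smooth on the open strata. -/
theorem LCChart.stratSmoothAt_symm {i : ℕ} (φ : LCChart S i)
    (hh : StratSmoothAt S h s t) (ht : t ∈ s) (htgt : ∀ x ∈ s, h x ∈ φ.map.target) :
    StratSmoothAt S (fun x => (φ.map.symm (h x)).1) s t ∧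
      ContDiffWithinAt ℝ ∞ (fun x => (φ.map.symm (h x)).2) s t := by
  have hsrc : ∀ x ∈ s, (φ.map.symm (h x)) ∈ φ.V ×ˢ cube i φ.ε := fun x hx => by
    rw [← φ.source_eq]; exact φ.map.map_target (htgt x hx)
  have hcod : ∀ x ∈ s, S.codim (φ.map.symm (h x)).1 = i := fun x hx => by
    have := (hsrc x hx).1
    obtain ⟨U, -, hU⟩ := φ.isOpen_V
    rw [hU] at this
    exact this.2
  have hcont : ContinuousWithinAt (fun x => φ.map.symm (h x)) s t :=
    (φ.continuousOn_symm _ (htgt t ht)).comp hh.continuousWithinAt htgt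
  obtain ⟨d, hd, hdt⟩ := S.exists_chart (h t)
  obtain ⟨c, hc, hct⟩ := S.exists_chart_of_codim_eq (hcod t ht)
  have hev1 := hh.eventually_mem_source hdt
  have hev2 : ∀ᶠ x in 𝓝[s] t, (φ.map.symm (h x)).1 ∈ c.coord.source := by
    have h1 : Tendsto (fun x => (φ.map.symm (h x)).1) (𝓝[s] t)
        (𝓝[{p | S.codim p = i}] (φ.map.symm (h t)).1) :=
      tendsto_nhdsWithin_iff.2 ⟨hcont.fst, by
        filter_upwards [self_mem_nhdsWithin] with x hx using hcod x hx⟩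
    exact h1.eventually (c.eventually_mem_source hct)
  have h1 := φ.smooth_symm c hc _ d hd (d.coord (h t))
    ⟨d.coord.map_source hdt, by simpa [d.coord.left_inv hdt] using htgt t ht,
      by simpa [d.coord.left_inv hdt] using hct⟩
  have h2 := h1.comp_of_preimage_mem_nhdsWithin t (hh.contDiff d hd hdt) (by
      filter_upwards [hev1, hev2, self_mem_nhdsWithin] with x hx1 hx2 hx3
      exact ⟨d.coord.map_source hx1, by simpa [d.coord.left_inv hx1] using htgt x hx3,
        by simpa [d.coord.left_inv hx1] using hx2⟩)
  have h3 : ContDiffWithinAt ℝ ∞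
      (fun x => (c.coord (φ.map.symm (h x)).1, (φ.map.symm (h x)).2)) s t := by
    refine h2.congr_of_eventuallyEq ?_ ?_
    · filter_upwards [hev1] with x hx
      simp [d.coord.left_inv hx]
    · simp [d.coord.left_inv hdt]
  exact ⟨stratSmoothAt_of_chart (hcod t ht) hcont.fst
    (by filter_upwards [self_mem_nhdsWithin] with x hx using hcod x hx) hc hct h3.fst, h3.snd⟩

end StratSmooth

/-! ### The boundary of the correspondence -/

section Boundary

variable {EZ : Type w} [NormedAddCommGroup EZ] [InnerProductSpace ℝ EZ]
  {HZ : Type*} [TopologicalSpace HZ] {I : ModelWithCorners ℝ EZ HZ} {ℓ : EZ →L[ℝ] ℝ}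
  {Z : Type v} [TopologicalSpace Z] [ChartedSpace HZ Z]

/-- For `ℓ = 0` the model is the whole space, and there is no boundary. -/
theorem mem_frontier_range_iff [CompleteSpace EZ] (hI : range I = {v | 0 ≤ ℓ v}) (y : EZ) :
    y ∈ frontier (range I) ↔ ℓ ≠ 0 ∧ ℓ y = 0 := by
  have h1 : range I = ℓ ⁻¹' Ici 0 := hI
  rw [h1]
  by_cases hℓ : ℓ = 0
  · subst hℓ
    have : ((0 : EZ →L[ℝ] ℝ) ⁻¹' Ici 0) = univ := by ext; simp
    rw [this]
    simp
  · have hs : Function.Surjective ℓ := by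
      refine LinearMap.surjective (f := (ℓ : EZ →ₗ[ℝ] ℝ)) fun h => hℓ ?_
      ext v
      exact LinearMap.congr_fun h v
    rw [ℓ.frontier_preimage hs, frontier_Ici]
    simp [hℓ]

/-- Membership in the boundary may be checked in any preferred chart. -/
theorem isBoundaryPoint_iff_of_mem_source [IsManifold I ∞ Z] {z z' : Z}
    (hz : z' ∈ (extChartAt I z).source) :
    I.IsBoundaryPoint z' ↔ extChartAt I z z' ∈ frontier (range I) := by
  have hz' : z' ∈ (chartAt HZ z).source := by rwa [extChartAt_source] at hz
  have h1 := I.isInteriorPoint_iff_of_mem_atlas (n := ∞) (by simp) (chart_mem_atlas HZ z) hz'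
  have h2 : extChartAt I z z' ∈ interior (range I) ↔
      (chartAt HZ z).extend I z' ∈ interior ((chartAt HZ z).extend I).target :=
    ⟨fun h => (chartAt HZ z).mem_interior_extend_target ((chartAt HZ z).map_source hz') h,
      fun h => OpenPartialHomeomorph.interior_extend_target_subset_interior_range _ h⟩
  rw [I.isBoundaryPoint_iff_not_isInteriorPoint, h1, ← h2, mem_interior_iff_notMem_frontier,
    not_not]
  exact mem_range_self _

/-- The points of the boundary form a closed set, so that `boundaryCodim` is upper
semicontinuous. -/
theorem eventually_boundaryCodim_le [IsManifold I ∞ Z] (z : Z) :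
    ∀ᶠ z' in 𝓝 z, boundaryCodim I z' ≤ boundaryCodim I z := by
  by_cases h : I.IsBoundaryPoint z
  · refine Eventually.of_forall fun z' => ?_
    unfold boundaryCodim
    rw [if_pos h]
    split_ifs <;> simp
  · have ho := I.isOpen_interior (M := Z) (n := ∞) (by simp)
    filter_upwards [ho.mem_nhds (show z ∈ I.interior Z from
      (I.isInteriorPoint_iff_not_isBoundaryPoint z).2 h)] with z' hz'
    have := (I.isInteriorPoint_iff_not_isBoundaryPoint z').1 hz'
    simp [boundaryCodim, this]

variable (I ℓ) in
/-- A splitting `Λ` of the model space of `Z` that presents the preferred chart at `z` as a locally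
cubical one with `n` corner coordinates, on the open set `W`. With `n = boundaryCodim I z` this
treats boundary and interior points alike. -/
structure BoundaryChart (z : Z) (n : ℕ) where
  F : Type w
  [normed : NormedAddCommGroup F]
  [inner : InnerProductSpace ℝ F]
  [complete : CompleteSpace F]
  Λ : EZ ≃L[ℝ] F × (Fin n → ℝ)
  W : Set EZ
  isOpen_W : IsOpen W
  base_mem : extChartAt I z z ∈ W
  base_eq : (Λ (extChartAt I z z)).2 = 0
  mem_target : ∀ y ∈ W, y ∈ (extChartAt I z).target ↔ ∀ j, 0 ≤ (Λ y).2 j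
  codim_eq : ∀ y ∈ W, y ∈ (extChartAt I z).target →
    boundaryCodim I ((extChartAt I z).symm y) = Set.ncard {j | (Λ y).2 j = 0}

attribute [instance] BoundaryChart.normed BoundaryChart.inner BoundaryChart.complete

/-- At a boundary point, `ℓ` is the corner coordinate, and `F = ker ℓ`, with complement spanned by a
vector `e` such that `ℓ e = 1`; at an interior point there is no corner coordinate, and `F = EZ`. -/
theorem exists_boundaryChart [CompleteSpace EZ] [IsManifold I ∞ Z]
    (hI : range I = {v | 0 ≤ ℓ v}) (z : Z) {W₀ : Set EZ} (hW₀ : IsOpen W₀)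
    (hz : extChartAt I z z ∈ W₀) :
    ∃ B : BoundaryChart I z (boundaryCodim I z), B.W ⊆ W₀ := by
  have htgt : (extChartAt I z).target = I.symm ⁻¹' (chartAt HZ z).target ∩ range I :=
    extChartAt_target I z
  have hopen : IsOpen (I.symm ⁻¹' (chartAt HZ z).target) :=
    (chartAt HZ z).open_target.preimage I.continuous_symm
  have hzt := mem_extChartAt_target (I := I) z
  have hbd : ∀ y ∈ (extChartAt I z).target,
      (I.IsBoundaryPoint ((extChartAt I z).symm y) ↔ y ∈ frontier (range I)) := fun y hy => by
    rw [isBoundaryPoint_iff_of_mem_source ((extChartAt I z).map_target hy),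
      (extChartAt I z).right_inv hy]
  by_cases h : I.IsBoundaryPoint z
  · have hn : boundaryCodim I z = 1 := by simp [boundaryCodim, h]
    rw [hn]
    obtain ⟨hℓ, hz0⟩ := (mem_frontier_range_iff hI _).1 h
    have hs : Function.Surjective ℓ := by
      refine LinearMap.surjective (f := (ℓ : EZ →ₗ[ℝ] ℝ)) fun h => hℓ ?_
      ext v
      exact LinearMap.congr_fun h v
    obtain ⟨e, he⟩ := hs 1
    have : CompleteSpace ℓ.ker := ℓ.isClosed_ker.completeSpace_coe
    let Λ₁ : EZ →L[ℝ] ℓ.ker × (Fin 1 → ℝ) :=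
      ((ContinuousLinearMap.id ℝ EZ - ℓ.smulRight e).codRestrict ℓ.ker
        (fun v => by simp [he])).prod (ContinuousLinearMap.pi fun _ => ℓ)
    let Λ₂ : ℓ.ker × (Fin 1 → ℝ) →L[ℝ] EZ :=
      ℓ.ker.subtypeL ∘L ContinuousLinearMap.fst ℝ _ _ +
        (ContinuousLinearMap.proj (R := ℝ) (φ := fun _ : Fin 1 => ℝ) 0 ∘L
          ContinuousLinearMap.snd ℝ _ _).smulRight e
    have h21 : Function.LeftInverse Λ₂ Λ₁ := fun v => by simp [Λ₁, Λ₂]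
    have h12 : Function.RightInverse Λ₂ Λ₁ := by
      rintro ⟨⟨v, hv⟩, t⟩
      have hv' : ℓ v = 0 := hv
      refine Prod.ext (Subtype.ext ?_) (funext fun j => ?_)
      · simp [Λ₁, Λ₂, hv', he]
      · fin_cases j
        simp [Λ₁, Λ₂, hv', he]
    let Λ : EZ ≃L[ℝ] ℓ.ker × (Fin 1 → ℝ) := ContinuousLinearEquiv.equivOfInverse Λ₁ Λ₂ h21 h12
    have hΛ : ∀ y j, (Λ y).2 j = ℓ y := fun y j => rfl
    refine ⟨⟨ℓ.ker, Λ, I.symm ⁻¹' (chartAt HZ z).target ∩ W₀, hopen.inter hW₀,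
      ⟨(htgt ▸ hzt).1, hz⟩, ?_, ?_, ?_⟩, inter_subset_right⟩
    · ext j; rw [hΛ, hz0]; rfl
    · intro y hy
      rw [htgt, mem_inter_iff, hI]
      simp only [hΛ]
      exact ⟨fun h _ => h.2, fun h => ⟨hy.1, h 0⟩⟩
    · intro y hy hyt
      have h1 := hbd y hyt
      rw [mem_frontier_range_iff hI] at h1
      simp only [hΛ]
      by_cases h0 : ℓ y = 0
      · rw [boundaryCodim, if_pos (h1.2 ⟨hℓ, h0⟩)]; simp [h0]
      · have : ¬ I.IsBoundaryPoint ((extChartAt I z).symm y) := fun h => h0 (h1.1 h).2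
        rw [boundaryCodim, if_neg this]; simp [h0]
  · have hn : boundaryCodim I z = 0 := by simp [boundaryCodim, h]
    rw [hn]
    have hint : extChartAt I z z ∈ interior (range I) :=
      (I.isInteriorPoint_iff_not_isBoundaryPoint z).2 h
    let Λ : EZ ≃L[ℝ] EZ × (Fin 0 → ℝ) := ContinuousLinearEquiv.equivOfInverse
      ((ContinuousLinearMap.id ℝ EZ).prod 0) (ContinuousLinearMap.fst ℝ _ _)
      (fun _ => rfl) (fun y => Prod.ext rfl (Subsingleton.elim _ _))
    refine ⟨⟨EZ, Λ, I.symm ⁻¹' (chartAt HZ z).target ∩ interior (range I) ∩ W₀,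
      (hopen.inter isOpen_interior).inter hW₀, ⟨⟨(htgt ▸ hzt).1, hint⟩, hz⟩,
      Subsingleton.elim _ _, ?_, ?_⟩, inter_subset_right⟩
    · intro y hy
      rw [htgt]
      exact ⟨fun _ j => j.elim0, fun _ => ⟨hy.1.1, interior_subset hy.1.2⟩⟩
    · intro y hy hyt
      have h1 := hbd y hyt
      have : ¬ I.IsBoundaryPoint ((extChartAt I z).symm y) := fun h =>
        disjoint_interior_frontier.le_bot ⟨hy.1.2, h1.1 h⟩
      rw [boundaryCodim, if_neg this, eq_comm, Set.ncard_eq_zero]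
      exact Subsingleton.elim _ _

end Boundary

/-! ### Local coordinates on `P × Z` -/

section LocalChart

variable {E₀ : Type*} [NormedAddCommGroup E₀] [InnerProductSpace ℝ E₀]
  {B₀ : Type*} [TopologicalSpace B₀] [ChartedSpace E₀ B₀]
  {E₁ : Type*} [NormedAddCommGroup E₁]
  {B₁ : Type*} [TopologicalSpace B₁] [ChartedSpace E₁ B₁]
  {P : Type u} [TopologicalSpace P] [T2Space P] [SecondCountableTopology P]
  {EZ : Type w} [NormedAddCommGroup EZ] [InnerProductSpace ℝ EZ]
  {HZ : Type*} [TopologicalSpace HZ] {I : ModelWithCorners ℝ EZ HZ}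
  {Z : Type v} [TopologicalSpace Z] [ChartedSpace HZ Z]

variable (E₀ E₁ I) in
/-- Local data about a point `(x₀, z₀)` of `P × Z`: an lc-chart of `P` in which `σ` is lc-smooth,
read in a chart `c` of the stratum of `x₀`, and a splitting of the preferred chart of `Z` at `z₀`.
They are small enough for the values of `σ` and `f` to stay in the preferred charts of `B₀` and
`B₁`. -/
structure LocalChart (SP : LCManifold.{u, w} P) (σ : P → B₀) (f : Z → B₀ × B₁) (x₀ : P) (z₀ : Z)
    where
  φ : LCChart SP.toStratifiedSpace (SP.codim x₀)
  c : HilbertChart.{u, w} {p | SP.codim p = SP.codim x₀}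
  c_mem : c ∈ SP.atlas (SP.codim x₀)
  base_mem : x₀ ∈ φ.V
  V_subset : φ.V ⊆ c.coord.source
  σ_source : ∀ x ∈ φ.map.target, σ x ∈ (chartAt E₀ (σ x₀)).source
  smooth : ∀ s ∈ cube (SP.codim x₀) φ.ε, ContDiffOn ℝ ∞
    (fun e => extChartAt 𝓘(ℝ, E₀) (σ x₀) (σ (φ.map (c.coord.symm e, s)))) (c.coord '' φ.V)
  continuousOn_fderiv : ContinuousOn
    (fun q : c.E × (Fin (SP.codim x₀) → ℝ) =>
      fderiv ℝ (fun e => extChartAt 𝓘(ℝ, E₀) (σ x₀) (σ (φ.map (c.coord.symm e, q.2)))) q.1)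
    ((c.coord '' φ.V) ×ˢ cube (SP.codim x₀) φ.ε)
  B : BoundaryChart I z₀ (boundaryCodim I z₀)
  f_source : ∀ y ∈ B.W, y ∈ (extChartAt I z₀).target →
    (f ((extChartAt I z₀).symm y)).1 ∈ (chartAt E₀ (f z₀).1).source ∧
    (f ((extChartAt I z₀).symm y)).2 ∈ (chartAt E₁ (f z₀).2).source

/-- The boundary chart is shrunk until `f` maps it into the preferred charts at `f z₀`. -/
theorem exists_localChart [CompleteSpace EZ] [IsManifold I ∞ Z] {ℓ : EZ →L[ℝ] ℝ}
    (hI : range I = {v | 0 ≤ ℓ v}) {SP : LCManifold.{u, w} P} {σ : P → B₀}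
    (hσ : IsLCSmooth E₀ SP σ) {f : Z → B₀ × B₁} (hf : Continuous f) (x₀ : P) (z₀ : Z) :
    Nonempty (LocalChart E₀ E₁ I SP σ f x₀ z₀) := by
  obtain ⟨φ, c, hc, hx, hV, hs, hsm, hcont⟩ := hσ.smooth_lcChart x₀
  have hO : IsOpen {p : B₀ × B₁ | p.1 ∈ (chartAt E₀ (f z₀).1).source ∧
      p.2 ∈ (chartAt E₁ (f z₀).2).source} :=
    ((chartAt E₀ (f z₀).1).open_source.preimage continuous_fst).inter
      ((chartAt E₁ (f z₀).2).open_source.preimage continuous_snd)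
  have hcont' : ContinuousOn (fun y => f ((extChartAt I z₀).symm y)) (extChartAt I z₀).target :=
    hf.comp_continuousOn (continuousOn_extChartAt_symm z₀)
  obtain ⟨W₀, hW₀, hW⟩ := continuousOn_iff'.1 hcont' _ hO
  have hz : extChartAt I z₀ z₀ ∈ W₀ := by
    have : extChartAt I z₀ z₀ ∈ W₀ ∩ (extChartAt I z₀).target := by
      rw [← hW]
      refine ⟨?_, mem_extChartAt_target z₀⟩
      simp only [mem_preimage, extChartAt_to_inv]
      exact ⟨mem_chart_source _ _, mem_chart_source _ _⟩
    exact this.1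
  obtain ⟨B, hB⟩ := exists_boundaryChart hI z₀ hW₀ hz
  refine ⟨⟨φ, c, hc, hx, hV, hs, hsm, hcont, B, fun y hy hyt => ?_⟩⟩
  have : y ∈ W₀ ∩ (extChartAt I z₀).target := ⟨hB hy, hyt⟩
  rw [← hW] at this
  exact this.1

namespace LocalChart

variable {SP : LCManifold.{u, w} P} {σ : P → B₀} {f : Z → B₀ × B₁} {x₀ : P} {z₀ : Z}
  (L : LocalChart E₀ E₁ I SP σ f x₀ z₀)

/-- The model Hilbert space of the stratum of `(x₀, z₀)`; the `L²` product makes it a Hilbert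
space. -/
abbrev A : Type w := WithLp 2 (L.c.E × L.B.F)

/-- The coordinates of the corner directions of `P`. -/
noncomputable def left {i j : ℕ} : (Fin (i + j) → ℝ) →L[ℝ] (Fin i → ℝ) :=
  ContinuousLinearMap.pi fun k =>
    ContinuousLinearMap.proj (R := ℝ) (φ := fun _ => ℝ) (Fin.castAdd j k)

/-- The coordinates of the corner directions of `Z`. -/
noncomputable def right {i j : ℕ} : (Fin (i + j) → ℝ) →L[ℝ] (Fin j → ℝ) :=
  ContinuousLinearMap.pi fun k =>
    ContinuousLinearMap.proj (R := ℝ) (φ := fun _ => ℝ) (Fin.natAdd i k)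

theorem left_apply {i j : ℕ} (s : Fin (i + j) → ℝ) (k : Fin i) : left s k = s (Fin.castAdd j k) :=
  rfl

theorem right_apply {i j : ℕ} (s : Fin (i + j) → ℝ) (k : Fin j) : right s k = s (Fin.natAdd i k) :=
  rfl

theorem left_append {i j : ℕ} (s : Fin i → ℝ) (t : Fin j → ℝ) : left (Fin.append s t) = s := by
  ext k; simp [left_apply]

theorem right_append {i j : ℕ} (s : Fin i → ℝ) (t : Fin j → ℝ) : right (Fin.append s t) = t := by
  ext k; simp [right_apply]

theorem append_left_right {i j : ℕ} (s : Fin (i + j) → ℝ) : Fin.append (left s) (right s) = s :=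
  Fin.append_castAdd_natAdd

theorem ncard_zero_append {i j : ℕ} (s : Fin (i + j) → ℝ) :
    Set.ncard {k | s k = 0} =
      Set.ncard {k | left (i := i) (j := j) s k = 0} +
        Set.ncard {k | right (i := i) (j := j) s k = 0} := by
  have h1 : {k | s k = 0} = Fin.castAdd j '' {k | left (i := i) (j := j) s k = 0} ∪
      Fin.natAdd i '' {k | right (i := i) (j := j) s k = 0} := by
    ext k
    refine Fin.addCases (fun k => ?_) (fun k => ?_) k
    · simp only [mem_ofPred_eq, mem_union, mem_image, left_apply]
      constructor
      · exact fun h => Or.inl ⟨k, h, rfl⟩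
      · rintro (⟨k', h, hk⟩ | ⟨k', h, hk⟩)
        · rwa [← hk]
        · rwa [← hk]
    · simp only [mem_ofPred_eq, mem_union, mem_image, right_apply]
      constructor
      · exact fun h => Or.inr ⟨k, h, rfl⟩
      · rintro (⟨k', h, hk⟩ | ⟨k', h, hk⟩)
        · rwa [← hk]
        · rwa [← hk]
  rw [h1, Set.ncard_union_eq ?_ (Set.toFinite _) (Set.toFinite _),
    Set.ncard_image_of_injective _ (Fin.castAdd_injective i j),
    Set.ncard_image_of_injective _ (Fin.natAdd_injective j i)]
  rw [Set.disjoint_left]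
  rintro _ ⟨a, -, rfl⟩ ⟨b, -, h⟩
  simp [Fin.ext_iff] at h
  omega

/-- The `EZ`-coordinate of a point, a linear function of the local coordinates. -/
noncomputable def zLin : L.A × (Fin (SP.codim x₀ + boundaryCodim I z₀) → ℝ) →L[ℝ] EZ :=
  (L.B.Λ.symm : L.B.F × (Fin (boundaryCodim I z₀) → ℝ) →L[ℝ] EZ) ∘L
    ((ContinuousLinearMap.snd ℝ L.c.E L.B.F ∘L
      ((WithLp.prodContinuousLinearEquiv 2 ℝ L.c.E L.B.F :
        L.A →L[ℝ] L.c.E × L.B.F)) ∘L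
      ContinuousLinearMap.fst ℝ L.A (Fin (SP.codim x₀ + boundaryCodim I z₀) → ℝ)).prod
      (right ∘L ContinuousLinearMap.snd ℝ L.A (Fin (SP.codim x₀ + boundaryCodim I z₀) → ℝ)))

theorem zLin_apply (q : L.A × (Fin (SP.codim x₀ + boundaryCodim I z₀) → ℝ)) :
    L.zLin q = L.B.Λ.symm (q.1.snd, right q.2) := rfl

/-- The local parametrization of `P × Z`, meaningful on the points of `dom` with nonnegative corner
coordinates. -/
noncomputable def param (q : L.A × (Fin (SP.codim x₀ + boundaryCodim I z₀) → ℝ)) : P × Z :=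
  (L.φ.map (L.c.coord.symm q.1.fst, left q.2), (extChartAt I z₀).symm (L.zLin q))

/-- The coordinates in the model of the stratum. -/
noncomputable def coordA (p : P × Z) : L.A :=
  WithLp.toLp 2 (L.c.coord (L.φ.map.symm p.1).1, (L.B.Λ (extChartAt I z₀ p.2)).1)

/-- The corner coordinates. -/
noncomputable def coordS (p : P × Z) : Fin (SP.codim x₀ + boundaryCodim I z₀) → ℝ :=
  Fin.append (L.φ.map.symm p.1).2 (L.B.Λ (extChartAt I z₀ p.2)).2

/-- An open set, whose points with nonnegative corner coordinates are the domain of `param`. -/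
def dom : Set (L.A × (Fin (SP.codim x₀ + boundaryCodim I z₀) → ℝ)) :=
  {q | q.1.fst ∈ L.c.coord '' L.φ.V ∧ (∀ j, left q.2 j < L.φ.ε) ∧ L.zLin q ∈ L.B.W}

/-- The image of `param`, on which `(coordA, coordS)` is inverse to it. -/
def tgt : Set (P × Z) :=
  {p | p.1 ∈ L.φ.map.target ∧ p.2 ∈ (extChartAt I z₀).source ∧ extChartAt I z₀ p.2 ∈ L.B.W}

theorem isOpen_image_V : IsOpen (L.c.coord '' L.φ.V) := by
  obtain ⟨U, hU, hV⟩ := L.φ.isOpen_V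
  have : L.c.coord '' L.φ.V = L.c.coord.target ∩ L.c.coord.symm ⁻¹' U := by
    ext e
    constructor
    · rintro ⟨x, hx, rfl⟩
      have hx' := L.V_subset hx
      refine ⟨L.c.coord.map_source hx', ?_⟩
      rw [mem_preimage, L.c.coord.left_inv hx']
      rw [hV] at hx
      exact hx.1
    · rintro ⟨h1, h2⟩
      refine ⟨L.c.coord.symm e, ?_, L.c.coord.right_inv h1⟩
      rw [hV]
      exact ⟨h2, L.c.codim_eq (L.c.coord.map_target h1)⟩
  rw [this]
  exact L.c.continuousOn_symm.isOpen_inter_preimage L.c.isOpen_target hU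

theorem symm_mem_V {e : L.c.E} (he : e ∈ L.c.coord '' L.φ.V) : L.c.coord.symm e ∈ L.φ.V := by
  obtain ⟨x, hx, rfl⟩ := he
  rwa [L.c.coord.left_inv (L.V_subset hx)]

theorem image_V_subset : L.c.coord '' L.φ.V ⊆ L.c.coord.target := by
  rintro _ ⟨x, hx, rfl⟩
  exact L.c.coord.map_source (L.V_subset hx)

theorem continuous_fst : Continuous fun q : L.A × (Fin (SP.codim x₀ + boundaryCodim I z₀) → ℝ) =>
    q.1.fst := by fun_prop

theorem isOpen_dom : IsOpen L.dom := by
  have h1 : IsOpen {q : L.A × (Fin (SP.codim x₀ + boundaryCodim I z₀) → ℝ) |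
      q.1.fst ∈ L.c.coord '' L.φ.V} := L.isOpen_image_V.preimage L.continuous_fst
  have h2 : IsOpen {q : L.A × (Fin (SP.codim x₀ + boundaryCodim I z₀) → ℝ) |
      ∀ j, left q.2 j < L.φ.ε} := by
    simp only [ofPred_forall]
    exact isOpen_iInter_of_finite fun j => isOpen_lt (by fun_prop) continuous_const
  have h3 : IsOpen {q | L.zLin q ∈ L.B.W} := L.B.isOpen_W.preimage L.zLin.continuous
  exact h1.inter (h2.inter h3)

theorem isOpen_tgt : IsOpen L.tgt := by
  have h1 : IsOpen ((extChartAt I z₀).source ∩ extChartAt I z₀ ⁻¹' L.B.W) :=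
    isOpen_extChartAt_preimage' z₀ L.B.isOpen_W
  exact L.φ.isOpen_target.prod h1

theorem left_mem_cube {q : L.A × (Fin (SP.codim x₀ + boundaryCodim I z₀) → ℝ)} (hq : q ∈ L.dom)
    (h0 : ∀ j, 0 ≤ q.2 j) : left q.2 ∈ cube (SP.codim x₀) L.φ.ε :=
  fun j => ⟨h0 _, hq.2.1 j⟩

theorem mem_source {q : L.A × (Fin (SP.codim x₀ + boundaryCodim I z₀) → ℝ)} (hq : q ∈ L.dom)
    (h0 : ∀ j, 0 ≤ q.2 j) : (L.c.coord.symm q.1.fst, left q.2) ∈ L.φ.map.source := by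
  rw [L.φ.source_eq]
  exact ⟨L.symm_mem_V hq.1, L.left_mem_cube hq h0⟩

theorem zLin_mem_target {q : L.A × (Fin (SP.codim x₀ + boundaryCodim I z₀) → ℝ)} (hq : q ∈ L.dom)
    (h0 : ∀ j, 0 ≤ q.2 j) : L.zLin q ∈ (extChartAt I z₀).target := by
  rw [L.B.mem_target _ hq.2.2]
  intro j
  rw [zLin_apply, L.B.Λ.apply_symm_apply]
  exact h0 _

theorem param_mem {q : L.A × (Fin (SP.codim x₀ + boundaryCodim I z₀) → ℝ)} (hq : q ∈ L.dom)
    (h0 : ∀ j, 0 ≤ q.2 j) : L.param q ∈ L.tgt := by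
  have h1 := L.zLin_mem_target hq h0
  refine ⟨L.φ.map.map_source (L.mem_source hq h0), (extChartAt I z₀).map_target h1, ?_⟩
  simp only [param, (extChartAt I z₀).right_inv h1]
  exact hq.2.2

theorem symm_param {q : L.A × (Fin (SP.codim x₀ + boundaryCodim I z₀) → ℝ)} (hq : q ∈ L.dom)
    (h0 : ∀ j, 0 ≤ q.2 j) :
    L.φ.map.symm (L.param q).1 = (L.c.coord.symm q.1.fst, left q.2) ∧
      L.B.Λ (extChartAt I z₀ (L.param q).2) = (q.1.snd, right q.2) := by
  refine ⟨L.φ.map.left_inv (L.mem_source hq h0), ?_⟩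
  have : extChartAt I z₀ (L.param q).2 = L.zLin q :=
    (extChartAt I z₀).right_inv (L.zLin_mem_target hq h0)
  rw [this, zLin_apply, L.B.Λ.apply_symm_apply]

theorem coordA_param {q : L.A × (Fin (SP.codim x₀ + boundaryCodim I z₀) → ℝ)} (hq : q ∈ L.dom)
    (h0 : ∀ j, 0 ≤ q.2 j) : L.coordA (L.param q) = q.1 := by
  obtain ⟨h1, h2⟩ := L.symm_param hq h0
  rw [coordA, h1, h2, L.c.coord.right_inv (L.image_V_subset hq.1)]
  rfl

theorem coordS_param {q : L.A × (Fin (SP.codim x₀ + boundaryCodim I z₀) → ℝ)} (hq : q ∈ L.dom)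
    (h0 : ∀ j, 0 ≤ q.2 j) : L.coordS (L.param q) = q.2 := by
  obtain ⟨h1, h2⟩ := L.symm_param hq h0
  rw [coordS, h1, h2]
  exact append_left_right _

theorem coord_mem {p : P × Z} (hp : p ∈ L.tgt) :
    (L.coordA p, L.coordS p) ∈ L.dom ∧ ∀ j, 0 ≤ L.coordS p j := by
  have h1 := L.φ.map.map_target hp.1
  rw [L.φ.source_eq] at h1
  have h2 := (L.B.mem_target _ hp.2.2).1 ((extChartAt I z₀).map_source hp.2.1)
  have hz : L.zLin (L.coordA p, L.coordS p) = extChartAt I z₀ p.2 := by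
    simp only [zLin_apply, coordA, coordS, right_append]
    exact L.B.Λ.symm_apply_apply _
  refine ⟨⟨⟨_, h1.1, rfl⟩, fun j => ?_, ?_⟩, fun j => ?_⟩
  · simp only [coordS, left_append]
    exact (h1.2 j).2
  · rw [hz]; exact hp.2.2
  · refine Fin.addCases (fun k => ?_) (fun k => ?_) j
    · simp only [coordS, Fin.append_left]
      exact (h1.2 k).1
    · simp only [coordS, Fin.append_right]
      exact h2 k

theorem param_coord {p : P × Z} (hp : p ∈ L.tgt) : L.param (L.coordA p, L.coordS p) = p := by
  have h1 := L.φ.map.map_target hp.1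
  rw [L.φ.source_eq] at h1
  have hz : L.zLin (L.coordA p, L.coordS p) = extChartAt I z₀ p.2 := by
    simp only [zLin_apply, coordA, coordS, right_append]
    exact L.B.Λ.symm_apply_apply _
  have hl : left (L.coordS p) = (L.φ.map.symm p.1).2 := by simp only [coordS, left_append]
  refine Prod.ext ?_ ?_
  · change L.φ.map (L.c.coord.symm (L.c.coord (L.φ.map.symm p.1).1), left (L.coordS p)) = p.1
    rw [L.c.coord.left_inv (L.V_subset h1.1), hl]
    exact L.φ.map.right_inv hp.1
  · change (extChartAt I z₀).symm (L.zLin (L.coordA p, L.coordS p)) = p.2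
    rw [hz]
    exact (extChartAt I z₀).left_inv hp.2.1

theorem base_mem_source : (x₀, (0 : Fin (SP.codim x₀) → ℝ)) ∈ L.φ.map.source := by
  rw [L.φ.source_eq]
  exact ⟨L.base_mem, fun j => ⟨le_rfl, L.φ.ε_pos⟩⟩

theorem base_mem_tgt : (x₀, z₀) ∈ L.tgt := by
  refine ⟨?_, mem_extChartAt_source z₀, L.B.base_mem⟩
  have := L.φ.map.map_source L.base_mem_source
  rwa [L.φ.map_zero _ L.base_mem] at this

theorem coordS_base : L.coordS (x₀, z₀) = 0 := by
  have h1 : L.φ.map.symm x₀ = (x₀, 0) := by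
    have := L.φ.map.left_inv L.base_mem_source
    rwa [L.φ.map_zero _ L.base_mem] at this
  ext j
  refine Fin.addCases (fun k => ?_) (fun k => ?_) j
  · simp [coordS, h1]
  · simp only [coordS, Fin.append_right, L.B.base_eq, Pi.zero_apply]

theorem codim_param {q : L.A × (Fin (SP.codim x₀ + boundaryCodim I z₀) → ℝ)} (hq : q ∈ L.dom)
    (h0 : ∀ j, 0 ≤ q.2 j) :
    SP.codim (L.param q).1 = Set.ncard {k | left q.2 k = 0} ∧
      boundaryCodim I (L.param q).2 = Set.ncard {k | right q.2 k = 0} := by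
  refine ⟨L.φ.codim_map _ (L.symm_mem_V hq.1) _ (L.left_mem_cube hq h0), ?_⟩
  have := L.B.codim_eq _ hq.2.2 (L.zLin_mem_target hq h0)
  simp only [zLin_apply, L.B.Λ.apply_symm_apply] at this
  exact this

theorem continuousOn_param : ContinuousOn L.param (L.dom ∩ {q | ∀ j, 0 ≤ q.2 j}) := by
  have h1 : ContinuousOn (fun q : L.A × (Fin (SP.codim x₀ + boundaryCodim I z₀) → ℝ) =>
      L.c.coord.symm q.1.fst) (L.dom ∩ {q | ∀ j, 0 ≤ q.2 j}) :=
    L.c.continuousOn_symm.comp L.continuous_fst.continuousOn fun q hq => L.image_V_subset hq.1.1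
  have h2 : ContinuousOn (fun q : L.A × (Fin (SP.codim x₀ + boundaryCodim I z₀) → ℝ) =>
      left (i := SP.codim x₀) q.2) (L.dom ∩ {q | ∀ j, 0 ≤ q.2 j}) := by fun_prop
  exact (L.φ.continuousOn.comp (h1.prodMk h2) fun q hq => L.mem_source hq.1 hq.2).prodMk
    ((continuousOn_extChartAt_symm z₀).comp L.zLin.continuous.continuousOn
      fun q hq => L.zLin_mem_target hq.1 hq.2)

theorem continuousOn_coord : ContinuousOn L.coordA L.tgt ∧ ContinuousOn L.coordS L.tgt := by
  have h1 : ContinuousOn (fun p : P × Z => L.φ.map.symm p.1) L.tgt :=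
    L.φ.continuousOn_symm.comp _root_.continuous_fst.continuousOn fun p hp => hp.1
  have h2 : ContinuousOn (fun p : P × Z => L.B.Λ (extChartAt I z₀ p.2)) L.tgt :=
    L.B.Λ.continuous.comp_continuousOn ((continuousOn_extChartAt z₀).comp
      continuous_snd.continuousOn fun p hp => hp.2.1)
  constructor
  · refine (WithLp.prod_continuous_toLp 2 _ _).comp_continuousOn (ContinuousOn.prodMk ?_ h2.fst)
    refine L.c.continuousOn.comp h1.fst fun p hp => L.V_subset ?_
    have := L.φ.map.map_target hp.1
    rw [L.φ.source_eq] at this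
    exact this.1
  · refine continuousOn_pi.2 fun j => ?_
    refine Fin.addCases (fun k => ?_) (fun k => ?_) j
    · simp only [coordS, Fin.append_left]
      exact (continuous_apply k).comp_continuousOn h1.snd
    · simp only [coordS, Fin.append_right]
      exact (continuous_apply k).comp_continuousOn h2.snd

variable {T : Type*} [NormedAddCommGroup T] [NormedSpace ℝ T] {s : Set T} {t : T}

/-- `param` is smooth where the set of vanishing corner coordinates is constant. -/
theorem smooth_param [IsManifold I ∞ Z]
    {k : T → L.A × (Fin (SP.codim x₀ + boundaryCodim I z₀) → ℝ)}
    (hk : ContDiffWithinAt ℝ ∞ k s t) (ht : t ∈ s) (hd : ∀ x ∈ s, k x ∈ L.dom)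
    (h0 : ∀ x ∈ s, ∀ j, 0 ≤ (k x).2 j) (hz : ∀ x ∈ s, ∀ j, (k x).2 j = 0 ↔ (k t).2 j = 0) :
    StratSmoothAt SP.toStratifiedSpace (fun x => (L.param (k x)).1) s t ∧
      ContMDiffWithinAt 𝓘(ℝ, T) I ∞ (fun x => (L.param (k x)).2) s t := by
  constructor
  · have h1 : ContDiffWithinAt ℝ ∞ (fun x => (k x).1.fst) s t :=
      ((WithLp.prodContinuousLinearEquiv 2 ℝ L.c.E L.B.F).contDiff.comp_contDiffWithinAt hk.fst).fst
    have h2 : ContDiffWithinAt ℝ ∞ (fun x => left (i := SP.codim x₀) (k x).2) s t :=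
      left.contDiff.comp_contDiffWithinAt hk.snd
    have h3 := stratSmoothAt_chart_symm L.c_mem (L.image_V_subset (hd t ht).1)
    have h4 : StratSmoothAt SP.toStratifiedSpace (fun x => L.c.coord.symm (k x).1.fst) s t :=
      h3.comp (k := fun x => (k x).1.fst) h1 fun x hx => L.image_V_subset (hd x hx).1
    refine L.φ.stratSmoothAt_map h4 h2 ht (fun x hx => L.mem_source (hd x hx) (h0 x hx))
      (m := Set.ncard {j | left (k t).2 j = 0}) fun x hx => ?_
    congr 1
    ext j
    exact hz x hx _
  · have h1 : ContDiffWithinAt ℝ ∞ (fun x => L.zLin (k x)) s t :=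
      L.zLin.contDiff.comp_contDiffWithinAt hk
    have h2 := contMDiffOn_extChartAt_symm (I := I) (n := ∞) z₀ (L.zLin (k t))
      (L.zLin_mem_target (hd t ht) (h0 t ht))
    exact ContMDiffWithinAt.comp (f := fun x => L.zLin (k x)) t h2 h1.contMDiffWithinAt
      fun x hx => L.zLin_mem_target (hd x hx) (h0 x hx)

/-- The coordinates are smooth functions on the strata of `P × Z`. -/
theorem smooth_coord [IsManifold I ∞ Z] {h : T → P × Z}
    (h1 : StratSmoothAt SP.toStratifiedSpace (fun x => (h x).1) s t)
    (h2 : ContMDiffWithinAt 𝓘(ℝ, T) I ∞ (fun x => (h x).2) s t) (ht : t ∈ s)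
    (htgt : ∀ x ∈ s, h x ∈ L.tgt) :
    ContDiffWithinAt ℝ ∞ (fun x => L.coordA (h x)) s t ∧
      ContDiffWithinAt ℝ ∞ (fun x => L.coordS (h x)) s t := by
  obtain ⟨h3, h4⟩ := L.φ.stratSmoothAt_symm h1 ht fun x hx => (htgt x hx).1
  have hV : ∀ x ∈ s, (L.φ.map.symm (h x).1).1 ∈ L.φ.V := fun x hx => by
    have := L.φ.map.map_target (htgt x hx).1
    rw [L.φ.source_eq] at this
    exact this.1
  have h5 : ContDiffWithinAt ℝ ∞ (fun x => L.c.coord (L.φ.map.symm (h x).1).1) s t := by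
    have hcod := L.c.codim_eq (L.V_subset (hV t ht))
    have : ∀ d ∈ SP.atlas (SP.codim x₀), (L.φ.map.symm (h t).1).1 ∈ d.coord.source →
        ContDiffWithinAt ℝ ∞ (fun x => d.coord (L.φ.map.symm (h x).1).1) s t := by
      have h6 := h3.contDiff
      rw [hcod] at h6
      exact h6
    exact this L.c L.c_mem (L.V_subset (hV t ht))
  have h6 : ContMDiffWithinAt 𝓘(ℝ, T) 𝓘(ℝ, EZ) ∞ (fun x => extChartAt I z₀ (h x).2) s t :=
    (contMDiffAt_extChartAt' (by simpa using (htgt t ht).2.1)).comp_contMDiffWithinAt t h2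
  have h7 : ContDiffWithinAt ℝ ∞ (fun x => L.B.Λ (extChartAt I z₀ (h x).2)) s t :=
    L.B.Λ.contDiff.comp_contDiffWithinAt h6.contDiffWithinAt
  constructor
  · exact ((WithLp.prodContinuousLinearEquiv 2 ℝ L.c.E L.B.F).symm.contDiff).comp_contDiffWithinAt
      (h5.prodMk h7.fst)
  · refine contDiffWithinAt_pi.2 fun j => ?_
    refine Fin.addCases (fun k => ?_) (fun k => ?_) j
    · simp only [coordS, Fin.append_left]
      exact contDiffWithinAt_pi.1 h4 k
    · simp only [coordS, Fin.append_right]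
      exact contDiffWithinAt_pi.1 h7.snd k

end LocalChart

end LocalChart

/-! ### Differentials in local coordinates -/

section Differentials

variable {P : Type u} [TopologicalSpace P] [T2Space P] [SecondCountableTopology P]
  {E : Type*} [NormedAddCommGroup E] [InnerProductSpace ℝ E]
  {B : Type*} [TopologicalSpace B] [ChartedSpace E B]
  {T : Type*} [NormedAddCommGroup T] [NormedSpace ℝ T] {s : Set T} {t : T}

theorem StratSmoothAt.contDiffWithinAt {S : StratifiedSpace.{u, w} P} {h : T → P}
    (hh : StratSmoothAt S h s t) {i : ℕ} {d : HilbertChart.{u, w} {p | S.codim p = i}}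
    (hd : d ∈ S.atlas i) (hdt : h t ∈ d.coord.source) :
    ContDiffWithinAt ℝ ∞ (fun x => d.coord (h x)) s t := by
  obtain rfl : S.codim (h t) = i := d.codim_eq hdt
  exact hh.contDiff d hd hdt

theorem StratSmoothAt.eventually_mem_chart_source {S : StratifiedSpace.{u, w} P} {h : T → P}
    (hh : StratSmoothAt S h s t) {i : ℕ} {d : HilbertChart.{u, w} {p | S.codim p = i}}
    (hdt : h t ∈ d.coord.source) : ∀ᶠ x in 𝓝[s] t, h x ∈ d.coord.source := by
  obtain rfl : S.codim (h t) = i := d.codim_eq hdt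
  exact hh.eventually_mem_source hdt

theorem StratSmoothAt.mono_of_mem_nhdsWithin {S : StratifiedSpace.{u, w} P} {h : T → P}
    {s' : Set T} (hh : StratSmoothAt S h s' t) (hs : s' ∈ 𝓝[s] t) : StratSmoothAt S h s t :=
  ⟨hh.continuousWithinAt.mono_of_mem_nhdsWithin hs,
    hh.codim_eq.filter_mono (nhdsWithin_le_iff.2 hs),
    fun d hd hdt => (hh.contDiff d hd hdt).mono_of_mem_nhdsWithin hs⟩

/-- The chain rule for the composition of an lc-smooth map with a smooth map into a stratum. -/
theorem mfderiv_comp_strat {S : LCManifold.{u, w} P} {σ : P → B} (hσ : IsLCSmooth E S σ)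
    {h : T → P} (hh : StratSmoothAt S.toStratifiedSpace h univ t) {i : ℕ}
    {d : HilbertChart.{u, w} {p | S.codim p = i}} (hd : d ∈ S.atlas i)
    (hdt : h t ∈ d.coord.source) :
    MDifferentiableAt 𝓘(ℝ, T) 𝓘(ℝ, E) (fun x => σ (h x)) t ∧
    (mfderiv 𝓘(ℝ, T) 𝓘(ℝ, E) (fun x => σ (h x)) t : T →L[ℝ] E) =
      diff E d σ (h t) ∘L fderiv ℝ (fun x => d.coord (h x)) t := by
  have h1 : MDifferentiableAt 𝓘(ℝ, d.E) 𝓘(ℝ, E) (fun e => σ (d.coord.symm e)) (d.coord (h t)) :=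
    ((hσ.smooth_stratum _ d hd (d.coord (h t)) (d.coord.map_source hdt)).contMDiffAt
      (d.isOpen_target.mem_nhds (d.coord.map_source hdt))).mdifferentiableAt (by simp)
  have h2 : DifferentiableAt ℝ (fun x => d.coord (h x)) t :=
    ((hh.contDiffWithinAt hd hdt).contDiffAt univ_mem).differentiableAt (by simp)
  have hev : (fun x => σ (h x)) =ᶠ[𝓝 t]
      (fun e => σ (d.coord.symm e)) ∘ fun x => d.coord (h x) := by
    have := hh.eventually_mem_chart_source hdt
    rw [nhdsWithin_univ] at this
    filter_upwards [this] with x hx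
    simp [d.coord.left_inv hx]
  refine ⟨(h1.comp t h2.mdifferentiableAt).congr_of_eventuallyEq hev, ?_⟩
  rw [hev.mfderiv_eq]
  rw [mfderiv_comp t h1 h2.mdifferentiableAt, mfderiv_eq_fderiv]
  rfl

end Differentials

section BoundaryChartTangent

variable {EZ : Type w} [NormedAddCommGroup EZ] [InnerProductSpace ℝ EZ] [CompleteSpace EZ]
  {HZ : Type*} [TopologicalSpace HZ] {I : ModelWithCorners ℝ EZ HZ} {ℓ : EZ →L[ℝ] ℝ}
  {Z : Type v} [TopologicalSpace Z] [ChartedSpace HZ Z] [IsManifold I ∞ Z]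

/-- The tangent space of the stratum of `z'`, read in the preferred chart at another point `z` of
that stratum. Only one inclusion needs a computation (coordinate changes preserve the boundary):
both sides being hyperplanes, it is an equality. -/
theorem BoundaryChart.snd_mfderiv_eq_zero_iff (hI : range I = {v | 0 ≤ ℓ v}) {z z' : Z}
    (B : BoundaryChart I z (boundaryCodim I z)) (hz : z' ∈ (extChartAt I z).source)
    (hW : extChartAt I z z' ∈ B.W) (hc : boundaryCodim I z' = boundaryCodim I z) (v : EZ) :
    (B.Λ ((mfderiv I 𝓘(ℝ, EZ) (extChartAt I z) z' : EZ →L[ℝ] EZ) v)).2 = 0 ↔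
      (I.IsBoundaryPoint z' → ℓ v = 0) := by
  by_cases hb : I.IsBoundaryPoint z'
  swap
  · have h0 : boundaryCodim I z = 0 := by
      rw [← hc]; simp [boundaryCodim, hb]
    have : IsEmpty (Fin (boundaryCodim I z)) := by rw [h0]; infer_instance
    simp only [hb, false_imp_iff, iff_true]
    exact Subsingleton.elim _ _
  have h1 : boundaryCodim I z = 1 := by
    rw [← hc]; simp [boundaryCodim, hb]
  have huniq : ∀ j j' : Fin (boundaryCodim I z), j = j' := fun j j' => by
    ext; have := j.2; have := j'.2; omega
  have hzc : z' ∈ (chartAt HZ z).source := by rwa [extChartAt_source] at hz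
  have : IsManifold I 1 Z := IsManifold.of_le (n := ∞) (by simp)
  obtain ⟨M, hM⟩ : ∃ M : EZ ≃L[ℝ] EZ, (M : EZ →L[ℝ] EZ) = mfderiv I 𝓘(ℝ, EZ) (extChartAt I z) z' :=
    isInvertible_mfderiv_extChartAt (I := I) hz
  have hM' : (mfderiv I 𝓘(ℝ, EZ) (extChartAt I z) z' : EZ →L[ℝ] EZ) = (M : EZ →L[ℝ] EZ) := hM.symm
  rw [hM']
  set y' := extChartAt I z' z' with hy'
  have hfr : ℓ ≠ 0 ∧ ℓ y' = 0 := (mem_frontier_range_iff hI _).1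
    ((isBoundaryPoint_iff_of_mem_source (mem_extChartAt_source z')).1 hb)
  have hder : HasFDerivWithinAt (fun y => extChartAt I z ((extChartAt I z').symm y))
      (M : EZ →L[ℝ] EZ) (range I) y' := by
    have h2 : MDifferentiableAt I 𝓘(ℝ, EZ) (extChartAt I z) z' :=
      (contMDiffAt_extChartAt' (n := 1) hzc).mdifferentiableAt (by simp)
    have h3 := h2.hasMFDerivAt.2
    rw [hM'] at h3
    exact h3
  -- differentiate along a straight line in the boundary
  have key : ∀ v, ℓ v = 0 → (B.Λ (M v)).2 = 0 := by
    intro v hv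
    have hline : ∀ τ : ℝ, y' + τ • v ∈ range I := fun τ => by
      rw [hI]; simp [hfr.2, hv]
    have hl : HasDerivAt (fun τ : ℝ => y' + τ • v) v 0 := by
      simpa using ((hasDerivAt_id (0 : ℝ)).smul_const v).const_add y'
    have h2 : HasDerivAt (fun τ : ℝ => (B.Λ (extChartAt I z ((extChartAt I z').symm
        (y' + τ • v)))).2) ((B.Λ (M v)).2) 0 := by
      have h3 : HasFDerivWithinAt (fun y => extChartAt I z ((extChartAt I z').symm y))
        (M : EZ →L[ℝ] EZ) (range I) (y' + (0 : ℝ) • v) := by simpa using hder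
      have h4 := (HasFDerivWithinAt.comp_hasDerivWithinAt (0 : ℝ) (s := univ) h3 hl.hasDerivWithinAt
        (fun τ _ => hline τ)).hasDerivAt univ_mem
      exact ((ContinuousLinearMap.snd ℝ B.F (Fin (boundaryCodim I z) → ℝ) ∘L
        (B.Λ : EZ →L[ℝ] B.F × (Fin (boundaryCodim I z) → ℝ))).hasFDerivAt.comp_hasDerivAt
        (0 : ℝ) h4)
    have hev : (fun τ : ℝ => (B.Λ (extChartAt I z ((extChartAt I z').symm (y' + τ • v)))).2)
        =ᶠ[𝓝 0] fun _ => 0 := by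
      have hcl : ContinuousAt (fun τ : ℝ => y' + τ • v) 0 := hl.continuousAt
      have htend : Tendsto (fun τ : ℝ => y' + τ • v) (𝓝 0) (𝓝[range I] y') := by
        refine tendsto_nhdsWithin_iff.2 ⟨?_, Eventually.of_forall hline⟩
        simpa using hcl.tendsto
      have e1 := htend.eventually (extChartAt_target_mem_nhdsWithin (I := I) z')
      have hsrc : ∀ᶠ z'' in 𝓝 z', z'' ∈ (extChartAt I z).source ∧ extChartAt I z z'' ∈ B.W :=
        (isOpen_extChartAt_preimage' z B.isOpen_W).mem_nhds ⟨hz, hW⟩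
      have hsymm : Tendsto (extChartAt I z').symm (𝓝[range I] y') (𝓝 z') := by
        have := continuousAt_extChartAt_symm (I := I) z'
        have h5 := this.tendsto
        rw [extChartAt_to_inv] at h5
        exact h5.mono_left nhdsWithin_le_nhds
      filter_upwards [e1, (hsymm.comp htend).eventually hsrc] with τ hτ1 hτ2
      set z'' := (extChartAt I z').symm (y' + τ • v) with hz''
      have hbz : I.IsBoundaryPoint z'' := by
        rw [isBoundaryPoint_iff_of_mem_source ((extChartAt I z').map_target hτ1),
          (extChartAt I z').right_inv hτ1, mem_frontier_range_iff hI]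
        exact ⟨hfr.1, by simp [hfr.2, hv]⟩
      have h6 := B.codim_eq (extChartAt I z z'') hτ2.2 ((extChartAt I z).map_source hτ2.1)
      rw [show (extChartAt I z).symm (extChartAt I z z'') = z'' from
        (extChartAt I z).left_inv hτ2.1, show boundaryCodim I z'' = 1 by
        simp [boundaryCodim, hbz]] at h6
      obtain ⟨j, hj⟩ := Set.ncard_eq_one.1 h6.symm
      ext j'
      have : j' ∈ {j | (B.Λ (extChartAt I z z'')).2 j = 0} := by
        rw [hj, huniq j' j]; rfl
      exact this
    exact h2.unique ((hasDerivAt_const (0 : ℝ) _).congr_of_eventuallyEq hev)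
  change (B.Λ (M v)).2 = 0 ↔ _
  refine ⟨fun hv _ => ?_, fun h => key v (h hb)⟩
  obtain ⟨u₀, hu₀⟩ : ∃ u, ℓ u ≠ 0 := by
    by_contra! h
    exact hfr.1 (by ext v; simpa using h v)
  -- by `key`, the corner coordinate of `M x` is a multiple of `ℓ x`; the factor is nonzero because
  -- `M` is onto
  have hsplit : ∀ x, (B.Λ (M x)).2 = (ℓ x / ℓ u₀) • (B.Λ (M u₀)).2 := fun x => by
    have h2 := key (x - (ℓ x / ℓ u₀) • u₀) (by simp [div_mul_cancel₀ _ hu₀])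
    simp only [map_sub, map_smul, Prod.snd_sub, Prod.smul_snd] at h2
    exact sub_eq_zero.1 h2
  by_contra hne
  have hu : (B.Λ (M u₀)).2 = 0 := by
    have := hsplit v
    rw [hv] at this
    exact (smul_eq_zero.1 this.symm).resolve_left (div_ne_zero hne hu₀)
  have h7 := hsplit (M.symm (B.Λ.symm (0, fun _ => 1)))
  rw [hu, smul_zero, M.apply_symm_apply, B.Λ.apply_symm_apply] at h7
  have h8 := congrFun h7 ⟨0, by omega⟩
  simp at h8

end BoundaryChartTangent

namespace LocalChart

variable {E₀ : Type*} [NormedAddCommGroup E₀] [InnerProductSpace ℝ E₀]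
  {B₀ : Type*} [TopologicalSpace B₀] [ChartedSpace E₀ B₀]
  {E₁ : Type*} [NormedAddCommGroup E₁]
  {B₁ : Type*} [TopologicalSpace B₁] [ChartedSpace E₁ B₁]
  {P : Type u} [TopologicalSpace P] [T2Space P] [SecondCountableTopology P]
  {EZ : Type w} [NormedAddCommGroup EZ] [InnerProductSpace ℝ EZ]
  {HZ : Type*} [TopologicalSpace HZ] {I : ModelWithCorners ℝ EZ HZ}
  {Z : Type v} [TopologicalSpace Z] [ChartedSpace HZ Z]
  {SP : LCManifold.{u, w} P} {σ : P → B₀} {f : Z → B₀ × B₁} {x₀ : P} {z₀ : Z}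
  (L : LocalChart E₀ E₁ I SP σ f x₀ z₀)

/-- The space of corner coordinates, those of `P` before those of `Z`. -/
abbrev C (_ : LocalChart E₀ E₁ I SP σ f x₀ z₀) : Type :=
  Fin (SP.codim x₀ + boundaryCodim I z₀) → ℝ

/-- The domain of `param`. -/
abbrev quadrant : Set (L.A × L.C) := L.dom ∩ {q | ∀ j, 0 ≤ q.2 j}

/-- The range of the preferred chart of `Z` at `z₀`, as far as it is used. -/
abbrev zDom : Set EZ := (extChartAt I z₀).target ∩ L.B.W

/-- A function on `Z` read in the local coordinates is continuously differentiable in the interior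
directions, since it is so in the chart of `Z`. -/
theorem hasFDerivAt_comp_zLin {X : Type*} [NormedAddCommGroup X] [NormedSpace ℝ X] {H : EZ → X}
    (hH : ContDiffOn ℝ ∞ H L.zDom) {q : L.A × L.C} (hq : q ∈ L.quadrant) :
    HasFDerivAt (fun a => H (L.zLin (a, q.2)))
      (fderivWithin ℝ H L.zDom (L.zLin q) ∘L L.zLin ∘L .inl ℝ L.A L.C) q.1 := by
  have hopen : IsOpen {a : L.A | (a, q.2) ∈ L.dom} :=
    L.isOpen_dom.preimage (Continuous.prodMk_left q.2)
  have h1 : HasFDerivWithinAt H (fderivWithin ℝ H L.zDom (L.zLin q)) L.zDom (L.zLin (q.1, q.2)) :=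
    (hH.differentiableOn (by simp) _ ⟨L.zLin_mem_target hq.1 hq.2, hq.1.2.2⟩).hasFDerivWithinAt
  have h2 : HasFDerivAt (fun a : L.A => L.zLin (a, q.2)) (L.zLin ∘L .inl ℝ L.A L.C) q.1 :=
    L.zLin.hasFDerivAt.comp q.1 (hasFDerivAt_prodMk_left q.1 q.2)
  exact (HasFDerivWithinAt.comp (s := {a : L.A | (a, q.2) ∈ L.dom}) q.1 h1 h2.hasFDerivWithinAt
    (fun a ha => And.intro (L.zLin_mem_target (q := (a, q.2)) ha hq.2) ha.2.2)).hasFDerivAt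
    (hopen.mem_nhds hq.1)

theorem uniqueDiffOn_zDom : UniqueDiffOn ℝ L.zDom :=
  (uniqueDiffOn_extChartAt_target z₀).inter L.B.isOpen_W

theorem continuousOn_fderivWithin_zLin {X : Type*} [NormedAddCommGroup X] [NormedSpace ℝ X]
    {H : EZ → X} (hH : ContDiffOn ℝ ∞ H L.zDom) :
    ContinuousOn (fun q : L.A × L.C =>
      fderivWithin ℝ H L.zDom (L.zLin q) ∘L L.zLin ∘L .inl ℝ L.A L.C) L.quadrant := by
  have h1 : ContinuousOn (fun q : L.A × L.C => fderivWithin ℝ H L.zDom (L.zLin q)) L.quadrant :=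
    (hH.continuousOn_fderivWithin L.uniqueDiffOn_zDom (by simp)).comp
      L.zLin.continuous.continuousOn fun q hq => ⟨L.zLin_mem_target hq.1 hq.2, hq.1.2.2⟩
  exact h1.clm_comp continuousOn_const

/-- `f₀` in the charts. -/
noncomputable def f₀ (_ : LocalChart E₀ E₁ I SP σ f x₀ z₀) (y : EZ) : E₀ :=
  extChartAt 𝓘(ℝ, E₀) (f z₀).1 (f ((extChartAt I z₀).symm y)).1

/-- `f₁` in the charts. -/
noncomputable def f₁ [InnerProductSpace ℝ E₁] (_ : LocalChart E₀ E₁ I SP σ f x₀ z₀) (y : EZ) : E₁ :=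
  extChartAt 𝓘(ℝ, E₁) (f z₀).2 (f ((extChartAt I z₀).symm y)).2

theorem contDiffOn_extChartAt_comp [IsManifold I ∞ Z] {E : Type*} [NormedAddCommGroup E]
    [NormedSpace ℝ E] {B : Type*} [TopologicalSpace B] [ChartedSpace E B]
    [IsManifold 𝓘(ℝ, E) ∞ B] {g : Z → B} (hg : ContMDiff I 𝓘(ℝ, E) ∞ g) {b : B}
    (hb : ∀ y ∈ L.zDom, g ((extChartAt I z₀).symm y) ∈ (chartAt E b).source) :
    ContDiffOn ℝ ∞ (fun y => extChartAt 𝓘(ℝ, E) b (g ((extChartAt I z₀).symm y))) L.zDom := by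
  rw [← contMDiffOn_iff_contDiffOn]
  have h1 : ContMDiffOn 𝓘(ℝ, EZ) 𝓘(ℝ, E) ∞ (fun y => g ((extChartAt I z₀).symm y)) L.zDom :=
    (hg.comp_contMDiffOn (contMDiffOn_extChartAt_symm z₀)).mono inter_subset_left
  exact (contMDiffOn_extChartAt (x := b)).comp h1 hb

theorem contDiffOn_f₀ [IsManifold I ∞ Z] [IsManifold 𝓘(ℝ, E₀) ∞ B₀]
    (hf : ContMDiff I 𝓘(ℝ, E₀) ∞ fun z => (f z).1) : ContDiffOn ℝ ∞ L.f₀ L.zDom :=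
  L.contDiffOn_extChartAt_comp hf fun y hy => (L.f_source y hy.2 hy.1).1

theorem contDiffOn_f₁ [InnerProductSpace ℝ E₁] [IsManifold I ∞ Z]
    [IsManifold 𝓘(ℝ, E₁) ∞ B₁]
    (hf : ContMDiff I 𝓘(ℝ, E₁) ∞ fun z => (f z).2) : ContDiffOn ℝ ∞ L.f₁ L.zDom :=
  L.contDiffOn_extChartAt_comp hf fun y hy => (L.f_source y hy.2 hy.1).2

/-- `σ` in the charts, as a function of the coordinates of `P`. -/
noncomputable def σ₀ (q : L.c.E × (Fin (SP.codim x₀) → ℝ)) : E₀ :=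
  extChartAt 𝓘(ℝ, E₀) (σ x₀) (σ (L.φ.map (L.c.coord.symm q.1, q.2)))

/-- The equation `σ = f₀` in the charts: the fibre product is the set of zeros of this function. -/
noncomputable def G (q : L.A × L.C) : E₀ :=
  L.σ₀ (q.1.fst, left q.2) - L.f₀ (L.zLin q)

/-- The projection to the coordinates of `P`. -/
noncomputable def fstA : L.A →L[ℝ] L.c.E :=
  ContinuousLinearMap.fst ℝ L.c.E L.B.F ∘L
    (WithLp.prodContinuousLinearEquiv 2 ℝ L.c.E L.B.F : L.A →L[ℝ] L.c.E × L.B.F)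

/-- The derivative of `G` in the interior directions. In the summand from `Z` it is a derivative
within the range of the chart, which is defined, and continuous, up to the boundary. -/
noncomputable def DG (q : L.A × L.C) : L.A →L[ℝ] E₀ :=
  fderiv ℝ (fun e => L.σ₀ (e, left q.2)) q.1.fst ∘L L.fstA -
    fderivWithin ℝ L.f₀ L.zDom (L.zLin q) ∘L L.zLin ∘L .inl ℝ L.A L.C

theorem hasFDerivAt_G [IsManifold I ∞ Z] [IsManifold 𝓘(ℝ, E₀) ∞ B₀]
    (hf : ContMDiff I 𝓘(ℝ, E₀) ∞ fun z => (f z).1) {q : L.A × L.C} (hq : q ∈ L.quadrant) :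
    HasFDerivAt (fun a => L.G (a, q.2)) (L.DG q) q.1 := by
  refine HasFDerivAt.sub ?_ (L.hasFDerivAt_comp_zLin (L.contDiffOn_f₀ hf) hq)
  have h1 : DifferentiableAt ℝ (fun e => L.σ₀ (e, left q.2)) (L.fstA q.1) :=
    ((L.smooth _ (L.left_mem_cube hq.1 hq.2)).contDiffAt
      (L.isOpen_image_V.mem_nhds hq.1.1)).differentiableAt (by simp)
  exact h1.hasFDerivAt.comp q.1 L.fstA.hasFDerivAt

theorem continuousOn_DG [IsManifold I ∞ Z] [IsManifold 𝓘(ℝ, E₀) ∞ B₀]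
    (hf : ContMDiff I 𝓘(ℝ, E₀) ∞ fun z => (f z).1) : ContinuousOn L.DG L.quadrant := by
  refine ContinuousOn.sub (ContinuousOn.clm_comp ?_ continuousOn_const)
    (L.continuousOn_fderivWithin_zLin (L.contDiffOn_f₀ hf))
  have h1 : ContinuousOn (fun q : L.A × L.C => (q.1.fst, left (i := SP.codim x₀) q.2))
      L.quadrant := by fun_prop
  exact L.continuousOn_fderiv.comp h1 fun q hq => ⟨hq.1.1, L.left_mem_cube hq.1 hq.2⟩

theorem continuousOn_G [IsManifold I ∞ Z] [IsManifold 𝓘(ℝ, E₀) ∞ B₀] (hσ : Continuous σ)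
    (hf : ContMDiff I 𝓘(ℝ, E₀) ∞ fun z => (f z).1) : ContinuousOn L.G L.quadrant := by
  refine ContinuousOn.sub ?_ ((L.contDiffOn_f₀ hf).continuousOn.comp
    L.zLin.continuous.continuousOn fun q hq => ⟨L.zLin_mem_target hq.1 hq.2, hq.1.2.2⟩)
  refine (continuousOn_extChartAt (σ x₀)).comp
    (hσ.comp_continuousOn (_root_.continuous_fst.comp_continuousOn L.continuousOn_param))
    fun q hq => ?_
  rw [extChartAt_source]
  exact L.σ_source _ (L.param_mem hq.1 hq.2).1

/-- `G` vanishes exactly on the fibre product. -/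
theorem G_eq_zero_iff (h₀ : σ x₀ = (f z₀).1) {q : L.A × L.C} (hq : q ∈ L.quadrant) :
    L.G q = 0 ↔ σ (L.param q).1 = (f (L.param q).2).1 := by
  have h1 : L.G q = extChartAt 𝓘(ℝ, E₀) (σ x₀) (σ (L.param q).1) -
      extChartAt 𝓘(ℝ, E₀) (f z₀).1 (f (L.param q).2).1 := rfl
  rw [h1, sub_eq_zero, h₀]
  refine ⟨fun h => (extChartAt 𝓘(ℝ, E₀) (f z₀).1).injOn ?_ ?_ h, fun h => by rw [h]⟩
  · rw [extChartAt_source, ← h₀]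
    exact L.σ_source _ (L.param_mem hq.1 hq.2).1
  · rw [extChartAt_source]
    exact (L.f_source _ hq.1.2.2 (L.zLin_mem_target hq.1 hq.2)).1

variable {T : Type*} [NormedAddCommGroup T] [NormedSpace ℝ T] {s : Set T} {t : T}

/-- `G` is smooth where the set of vanishing corner coordinates is constant. -/
theorem smooth_G [IsManifold I ∞ Z] [IsManifold 𝓘(ℝ, E₀) ∞ B₀] (hσ : IsLCSmooth E₀ SP σ)
    (hf : ContMDiff I 𝓘(ℝ, E₀) ∞ fun z => (f z).1) {k : T → L.A × L.C}
    (hk : ContDiffWithinAt ℝ ∞ k s t) (ht : t ∈ s) (hd : ∀ x ∈ s, k x ∈ L.quadrant)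
    (hz : ∀ x ∈ s, ∀ j, (k x).2 j = 0 ↔ (k t).2 j = 0) :
    ContDiffWithinAt ℝ ∞ (fun x => L.G (k x)) s t := by
  obtain ⟨h1, -⟩ := L.smooth_param hk ht (fun x hx => (hd x hx).1) (fun x hx => (hd x hx).2) hz
  have h3 : ContDiffWithinAt ℝ ∞ (fun x => L.f₀ (L.zLin (k x))) s t :=
    ContDiffWithinAt.comp (g := L.f₀) (f := fun x => L.zLin (k x)) (t := L.zDom) t
      (L.contDiffOn_f₀ hf _ ⟨L.zLin_mem_target (hd t ht).1 (hd t ht).2, (hd t ht).1.2.2⟩)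
      (L.zLin.contDiff.comp_contDiffWithinAt hk)
      fun x hx => ⟨L.zLin_mem_target (hd x hx).1 (hd x hx).2, (hd x hx).1.2.2⟩
  refine ContDiffWithinAt.sub ?_ h3
  have h2 : ContMDiffAt 𝓘(ℝ, E₀) 𝓘(ℝ, E₀) ∞ (extChartAt 𝓘(ℝ, E₀) (σ x₀)) (σ (L.param (k t)).1) :=
    contMDiffAt_extChartAt' (L.σ_source _ (L.param_mem (hd t ht).1 (hd t ht).2).1)
  exact (h2.comp_contMDiffWithinAt t (hσ.contMDiffWithinAt_comp h1)).contDiffWithinAt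

end LocalChart

/-! ### Transversality -/

section Tangent

variable {P : Type u} [TopologicalSpace P] [T2Space P] [SecondCountableTopology P]

/-- The differential of a coordinate change is invertible, the inverse being the differential of the
inverse coordinate change. -/
theorem StratifiedSpace.bijective_fderiv_coordChange (S : StratifiedSpace.{u, w} P) {i : ℕ}
    {c d : HilbertChart.{u, w} {p | S.codim p = i}} (hc : c ∈ S.atlas i) (hd : d ∈ S.atlas i)
    {e : c.E} (he : e ∈ c.coord.target) (hed : c.coord.symm e ∈ d.coord.source) :
    DifferentiableAt ℝ (fun e => d.coord (c.coord.symm e)) e ∧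
      Function.Bijective (fderiv ℝ (fun e => d.coord (c.coord.symm e)) e) := by
  have aux : ∀ {c d : HilbertChart.{u, w} {p | S.codim p = i}}, c ∈ S.atlas i → d ∈ S.atlas i →
      ∀ {e : c.E}, e ∈ c.coord.target → c.coord.symm e ∈ d.coord.source →
      DifferentiableAt ℝ (fun e => d.coord (c.coord.symm e)) e ∧
        ∀ᶠ e' in 𝓝 e, e' ∈ c.coord.target ∧ c.coord.symm e' ∈ d.coord.source := by
    intro c d hc hd e he hed
    have h1 := stratSmoothAt_chart_symm hc he
    have h2 := h1.eventually_mem_chart_source hed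
    have hn : c.coord.target ∈ 𝓝 e := c.isOpen_target.mem_nhds he
    rw [nhdsWithin_eq_nhds.2 hn] at h2
    exact ⟨((h1.contDiffWithinAt hd hed).contDiffAt hn).differentiableAt (by simp),
      (eventually_mem_set.2 hn).and h2⟩
  obtain ⟨h1, h1'⟩ := aux hc hd he hed
  have he' : d.coord (c.coord.symm e) ∈ d.coord.target := d.coord.map_source hed
  have hinv : d.coord.symm (d.coord (c.coord.symm e)) = c.coord.symm e := d.coord.left_inv hed
  obtain ⟨h2, h2'⟩ := aux hd hc he' (by rw [hinv]; exact c.coord.map_target he)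
  have hce : c.coord (d.coord.symm (d.coord (c.coord.symm e))) = e := by
    rw [hinv, c.coord.right_inv he]
  refine ⟨h1, ?_⟩
  have k1 : HasFDerivAt (fun e => c.coord (d.coord.symm (d.coord (c.coord.symm e))))
      (ContinuousLinearMap.id ℝ c.E) e := by
    refine (hasFDerivAt_id e).congr_of_eventuallyEq ?_
    filter_upwards [h1'] with e' h
    rw [d.coord.left_inv h.2, c.coord.right_inv h.1]; rfl
  have k2 : HasFDerivAt (fun e' => d.coord (c.coord.symm (c.coord (d.coord.symm e'))))
      (ContinuousLinearMap.id ℝ d.E) (d.coord (c.coord.symm e)) := by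
    refine (hasFDerivAt_id _).congr_of_eventuallyEq ?_
    filter_upwards [h2'] with e' h
    rw [c.coord.left_inv h.2, d.coord.right_inv h.1]; rfl
  have k1' := k1.unique (HasFDerivAt.comp e (g := fun e => c.coord (d.coord.symm e))
    (f := fun e => d.coord (c.coord.symm e)) h2.hasFDerivAt h1.hasFDerivAt)
  have h1e : HasFDerivAt (fun e => d.coord (c.coord.symm e))
      (fderiv ℝ (fun e => d.coord (c.coord.symm e)) e)
      (c.coord (d.coord.symm (d.coord (c.coord.symm e)))) := by
    rw [hce]; exact h1.hasFDerivAt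
  have k2' := k2.unique (HasFDerivAt.comp (d.coord (c.coord.symm e))
    (g := fun e => d.coord (c.coord.symm e)) (f := fun e => c.coord (d.coord.symm e))
    h1e h2.hasFDerivAt)
  exact Function.bijective_iff_has_inverse.2
    ⟨_, fun v => (DFunLike.congr_fun k1' v).symm, fun v => (DFunLike.congr_fun k2' v).symm⟩

variable {E₀ : Type*} [NormedAddCommGroup E₀] [InnerProductSpace ℝ E₀]
  {B₀ : Type*} [TopologicalSpace B₀] [ChartedSpace E₀ B₀]
  {E₁ : Type*} [NormedAddCommGroup E₁]
  {B₁ : Type*} [TopologicalSpace B₁] [ChartedSpace E₁ B₁]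
  {EZ : Type w} [NormedAddCommGroup EZ] [InnerProductSpace ℝ EZ]
  {HZ : Type*} [TopologicalSpace HZ] {I : ModelWithCorners ℝ EZ HZ} {ℓ : EZ →L[ℝ] ℝ}
  {Z : Type v} [TopologicalSpace Z] [ChartedSpace HZ Z]
  {SP : LCManifold.{u, w} P} {σ : P → B₀} {f : Z → B₀ × B₁} {x₀ : P} {z₀ : Z}

namespace LocalChart

variable (L : LocalChart E₀ E₁ I SP σ f x₀ z₀)

theorem mem_quadrant_zero {a : L.A} (ha : (a, 0) ∈ L.dom) : (a, (0 : L.C)) ∈ L.quadrant :=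
  ⟨ha, fun _ => le_rfl⟩

theorem codim_param_zero {a : L.A} (ha : (a, 0) ∈ L.dom) :
    SP.codim (L.param (a, 0)).1 = SP.codim x₀ ∧
      boundaryCodim I (L.param (a, 0)).2 = boundaryCodim I z₀ := by
  obtain ⟨h1, h2⟩ := L.codim_param ha fun _ => le_rfl
  rw [h1, h2]
  simp [Set.ncard_univ]

theorem eventually_zero_mem_dom {a : L.A} (ha : (a, 0) ∈ L.dom) :
    ∀ᶠ a' in 𝓝 a, (a', (0 : L.C)) ∈ L.dom :=
  (L.isOpen_dom.preimage (Continuous.prodMk_left (0 : L.C))).mem_nhds ha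

theorem smooth_param_zero [IsManifold I ∞ Z] {a : L.A} (ha : (a, 0) ∈ L.dom) :
    StratSmoothAt SP.toStratifiedSpace (fun a => (L.param (a, 0)).1) univ a ∧
      ContMDiffAt 𝓘(ℝ, L.A) I ∞ (fun a => (L.param (a, 0)).2) a := by
  have hk : ContDiffWithinAt ℝ ∞ (fun a : L.A => (a, (0 : L.C))) {a | (a, 0) ∈ L.dom} a := by
    fun_prop
  obtain ⟨h1, h2⟩ := L.smooth_param hk ha (fun _ h => h) (fun _ _ _ => le_rfl)
    (fun _ _ _ => Iff.rfl)
  have hn := L.eventually_zero_mem_dom ha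
  exact ⟨h1.mono_of_mem_nhdsWithin (mem_nhdsWithin_of_mem_nhds hn), h2.contMDiffAt hn⟩

/-- The local parametrization `a ↦ param (a, 0)` of the stratum of `(x₀, z₀)` is an immersion, whose
differential `Θ` maps onto the tangent space of the stratum. -/
theorem tangent_param [CompleteSpace EZ] [IsManifold I ∞ Z] (hI : range I = {v | 0 ≤ ℓ v})
    {a : L.A} (ha : (a, 0) ∈ L.dom) {i : ℕ}
    {d : HilbertChart.{u, w} {p | SP.codim p = i}} (hd : d ∈ SP.atlas i)
    (hds : (L.param (a, 0)).1 ∈ d.coord.source) {Θ : L.A →L[ℝ] d.E × EZ}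
    (hΘ : Θ = (fderiv ℝ (fun a => d.coord (L.param (a, 0)).1) a).prod
      (mfderiv 𝓘(ℝ, L.A) I (fun a => (L.param (a, 0)).2) a)) :
    Function.Injective Θ ∧
      range Θ = {t | I.IsBoundaryPoint (L.param (a, 0)).2 → ℓ t.2 = 0} := by
  obtain ⟨hcod, hcodZ⟩ := L.codim_param_zero ha
  obtain rfl : SP.codim x₀ = i := by rw [← hcod]; exact d.codim_eq hds
  have : IsManifold I 1 Z := IsManifold.of_le (n := ∞) (by simp)
  -- the part in `P` is a coordinate change
  have hfst : ∀ a, (a, (0 : L.C)) ∈ L.dom → (L.param (a, 0)).1 = L.c.coord.symm a.fst :=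
    fun a ha => by
      have := L.φ.map_zero _ (L.symm_mem_V ha.1)
      rw [← this]
      simp only [param, map_zero]
  rw [hfst a ha] at hds
  obtain ⟨hA, hAb⟩ := SP.bijective_fderiv_coordChange L.c_mem hd (L.image_V_subset ha.1) hds
  have hΘ1 : ∀ v, (Θ v).1 = fderiv ℝ (fun e => d.coord (L.c.coord.symm e)) a.fst v.fst := by
    have h1 : (fun a => d.coord (L.param (a, 0)).1) =ᶠ[𝓝 a]
        fun a => d.coord (L.c.coord.symm (L.fstA a)) := by
      filter_upwards [L.eventually_zero_mem_dom ha] with a' ha'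
      rw [hfst a' ha']; rfl
    have h2 : HasFDerivAt (fun a => d.coord (L.c.coord.symm (L.fstA a)))
        (fderiv ℝ (fun e => d.coord (L.c.coord.symm e)) a.fst ∘L L.fstA) a :=
      HasFDerivAt.comp a (g := fun e => d.coord (L.c.coord.symm e)) (f := L.fstA)
        (hA.hasFDerivAt (x := a.fst)) L.fstA.hasFDerivAt
    intro v
    rw [hΘ]
    change fderiv ℝ (fun a => d.coord (L.param (a, 0)).1) a v = _
    rw [h1.fderiv_eq, h2.fderiv]
    rfl
  -- the part in `Z` is inverse to the differential of the chart
  have hz : (L.param (a, 0)).2 ∈ (extChartAt I z₀).source := (L.param_mem ha fun _ => le_rfl).2.1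
  have hzW := (L.param_mem ha fun _ => le_rfl).2.2
  obtain ⟨M, hM⟩ : ∃ M : EZ ≃L[ℝ] EZ,
      (M : EZ →L[ℝ] EZ) = mfderiv I 𝓘(ℝ, EZ) (extChartAt I z₀) (L.param (a, 0)).2 :=
    isInvertible_mfderiv_extChartAt (I := I) hz
  have hΘ2 : ∀ v : L.A, M (Θ v).2 = L.B.Λ.symm (v.snd, 0) := by
    have h1 : (fun a => extChartAt I z₀ (L.param (a, 0)).2) =ᶠ[𝓝 a]
        fun a => L.zLin (a, 0) := by
      filter_upwards [L.eventually_zero_mem_dom ha] with a' ha'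
      exact (extChartAt I z₀).right_inv (L.zLin_mem_target ha' fun _ => le_rfl)
    have h2 : MDifferentiableAt I 𝓘(ℝ, EZ) (extChartAt I z₀) (L.param (a, 0)).2 :=
      (contMDiffAt_extChartAt' (n := 1) (by rwa [extChartAt_source] at hz)).mdifferentiableAt
        (by simp)
    have h3 := mfderiv_comp a h2 ((L.smooth_param_zero ha).2.mdifferentiableAt (by simp))
    have h4 : (mfderiv 𝓘(ℝ, L.A) 𝓘(ℝ, EZ) ((extChartAt I z₀) ∘ fun a => (L.param (a, 0)).2) a :
        L.A →L[ℝ] EZ) = L.zLin ∘L .inl ℝ L.A L.C := by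
      rw [mfderiv_eq_fderiv]
      exact (h1.fderiv_eq).trans
        (L.zLin.hasFDerivAt.comp a (hasFDerivAt_prodMk_left a (0 : L.C))).fderiv
    intro v
    have h5 := DFunLike.congr_fun (h3.symm.trans h4) v
    rw [hΘ]
    have h6 : L.zLin (v, 0) = L.B.Λ.symm (v.snd, 0) := by rw [zLin_apply]; simp
    rw [← h6]
    refine Eq.trans ?_ h5
    exact DFunLike.congr_fun hM _
  have hker : ∀ v : EZ, (L.B.Λ (M v)).2 = 0 ↔
      (I.IsBoundaryPoint (L.param (a, 0)).2 → ℓ v = 0) := fun v => by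
    rw [← L.B.snd_mfderiv_eq_zero_iff hI hz hzW hcodZ v, ← hM]
    rfl
  constructor
  · rw [injective_iff_map_eq_zero]
    intro v hv
    have h1 := hΘ1 v
    have h2 := hΘ2 v
    rw [hv] at h1 h2
    have h3 : v.fst = 0 := hAb.1 (by rw [← h1]; simp)
    have h4 : (v.snd, (0 : Fin (boundaryCodim I z₀) → ℝ)) = 0 :=
      L.B.Λ.symm.injective (by rw [← h2]; simp)
    exact (WithLp.ext_iff 2).2 (Prod.ext h3 (congrArg Prod.fst h4))
  · ext t
    rw [mem_ofPred_eq, ← hker]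
    constructor
    · rintro ⟨v, rfl⟩
      rw [hΘ2, L.B.Λ.apply_symm_apply]
    · intro ht
      obtain ⟨e, he⟩ := hAb.2 t.1
      refine ⟨WithLp.toLp 2 (e, (L.B.Λ (M t.2)).1), Prod.ext ?_ ?_⟩
      · rw [hΘ1]; exact he
      · apply M.injective
        rw [hΘ2, L.B.Λ.symm_apply_eq]
        exact Prod.ext rfl ht.symm

/-- At points of the fibre product, the derivative of `G` is the difference of the differentials
of `σ` and `f₀`, up to the isomorphism `M` given by the chart of `B₀`. -/
theorem exists_DG_eq [IsManifold I ∞ Z] [IsManifold 𝓘(ℝ, E₀) ∞ B₀] (hσ : IsLCSmooth E₀ SP σ)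
    (hf : ContMDiff I 𝓘(ℝ, E₀) ∞ fun z => (f z).1) (h₀ : σ x₀ = (f z₀).1) {a : L.A}
    (ha : (a, 0) ∈ L.dom) (hG : L.G (a, 0) = 0) {i : ℕ}
    {d : HilbertChart.{u, w} {p | SP.codim p = i}} (hd : d ∈ SP.atlas i)
    (hds : (L.param (a, 0)).1 ∈ d.coord.source) {Θ : L.A →L[ℝ] d.E × EZ}
    (hΘ : Θ = (fderiv ℝ (fun a => d.coord (L.param (a, 0)).1) a).prod
      (mfderiv 𝓘(ℝ, L.A) I (fun a => (L.param (a, 0)).2) a)) :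
    ∃ M : E₀ ≃L[ℝ] E₀, ∀ v, L.DG (a, 0) v =
      M (diff E₀ d σ (L.param (a, 0)).1 (Θ v).1 - diff₀ I E₀ f (L.param (a, 0)).2 (Θ v).2) := by
  have : IsManifold I 1 Z := IsManifold.of_le (n := ∞) (by simp)
  have : IsManifold 𝓘(ℝ, E₀) 1 B₀ := IsManifold.of_le (n := ∞) (by simp)
  have hq := L.mem_quadrant_zero ha
  have hfib := (L.G_eq_zero_iff h₀ hq).1 hG
  have hsrc : (f (L.param (a, 0)).2).1 ∈ (extChartAt 𝓘(ℝ, E₀) (f z₀).1).source := by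
    rw [extChartAt_source]
    exact (L.f_source _ hq.1.2.2 (L.zLin_mem_target hq.1 hq.2)).1
  obtain ⟨M, hM⟩ : ∃ M : E₀ ≃L[ℝ] E₀, (M : E₀ →L[ℝ] E₀) =
      mfderiv 𝓘(ℝ, E₀) 𝓘(ℝ, E₀) (extChartAt 𝓘(ℝ, E₀) (f z₀).1) (f (L.param (a, 0)).2).1 :=
    isInvertible_mfderiv_extChartAt hsrc
  refine ⟨M, fun v => ?_⟩
  obtain ⟨h1, h2⟩ := L.smooth_param_zero ha
  obtain ⟨h3, h4⟩ := mfderiv_comp_strat hσ h1 hd hds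
  have hext : MDifferentiableAt 𝓘(ℝ, E₀) 𝓘(ℝ, E₀) (extChartAt 𝓘(ℝ, E₀) (f z₀).1)
      (f (L.param (a, 0)).2).1 :=
    (contMDiffAt_extChartAt' (n := 1) (by rwa [extChartAt_source] at hsrc)).mdifferentiableAt
      (by simp)
  have hext' : HasMFDerivAt 𝓘(ℝ, E₀) 𝓘(ℝ, E₀) (extChartAt 𝓘(ℝ, E₀) (f z₀).1)
      (f (L.param (a, 0)).2).1 (M : E₀ →L[ℝ] E₀) := by
    rw [hM]; exact hext.hasMFDerivAt
  have hext'' : HasMFDerivAt 𝓘(ℝ, E₀) 𝓘(ℝ, E₀) (extChartAt 𝓘(ℝ, E₀) (f z₀).1)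
      (σ (L.param (a, 0)).1) (M : E₀ →L[ℝ] E₀) := by
    rw [hfib]; exact hext'
  have hfm : MDifferentiableAt I 𝓘(ℝ, E₀) (fun z => (f z).1) (L.param (a, 0)).2 :=
    (hf _).mdifferentiableAt (by simp)
  have hpm := h2.mdifferentiableAt (by simp)
  have k1 : HasFDerivAt (fun a => extChartAt 𝓘(ℝ, E₀) (f z₀).1 (σ (L.param (a, 0)).1))
      ((M : E₀ →L[ℝ] E₀) ∘L (diff E₀ d σ (L.param (a, 0)).1 ∘L
        fderiv ℝ (fun a => d.coord (L.param (a, 0)).1) a)) a := by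
    rw [← h4]
    exact (HasMFDerivAt.comp a hext'' h3.hasMFDerivAt).hasFDerivAt
  have k2 : HasFDerivAt (fun a => extChartAt 𝓘(ℝ, E₀) (f z₀).1 (f (L.param (a, 0)).2).1)
      ((M : E₀ →L[ℝ] E₀) ∘L (diff₀ I E₀ f (L.param (a, 0)).2 ∘L
        (mfderiv 𝓘(ℝ, L.A) I (fun a => (L.param (a, 0)).2) a : L.A →L[ℝ] EZ))) a :=
    (HasMFDerivAt.comp (g := extChartAt 𝓘(ℝ, E₀) (f z₀).1)
      (f := fun a => (f (L.param (a, 0)).2).1) a hext'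
      (HasMFDerivAt.comp (g := fun z => (f z).1) (f := fun a => (L.param (a, 0)).2) a
        hfm.hasMFDerivAt hpm.hasMFDerivAt)).hasFDerivAt
  have k3 : HasFDerivAt (fun a => L.G (a, 0)) _ a := k1.sub k2 |>.congr_of_eventuallyEq
    (Eventually.of_forall fun a' => by
      change extChartAt 𝓘(ℝ, E₀) (σ x₀) (σ (L.param (a', 0)).1) -
        extChartAt 𝓘(ℝ, E₀) (f z₀).1 (f (L.param (a', 0)).2).1 = _
      rw [h₀]; rfl)
  have k4 := DFunLike.congr_fun ((L.hasFDerivAt_G hf hq).unique k3) v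
  rw [k4, map_sub, hΘ]
  rfl

end LocalChart

end Tangent

section Transversality

section Polarization

variable {E : Type*} [NormedAddCommGroup E] [InnerProductSpace ℝ E]
  {B : Type*} [TopologicalSpace B] [ChartedSpace E B] [IsManifold 𝓘(ℝ, E) ∞ B]

theorem Polarization.completeSpace_Tminus [CompleteSpace E] (F : Polarization E B) (b : B) :
    CompleteSpace (F.Tminus b) := by
  have h : (F.Tminus b : Set E) = {v | F.proj b v = v} := by
    ext v
    exact ⟨fun ⟨w, hw⟩ => by
      rw [← hw]; exact F.proj_idem b w, fun hv => ⟨v, hv⟩⟩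
  have : IsClosed (F.Tminus b : Set E) := by
    rw [h]; exact isClosed_eq (F.proj b).continuous continuous_id
  exact this.completeSpace_coe

theorem Polarization.completeSpace_Tplus [CompleteSpace E] (F : Polarization E B) (b : B) :
    CompleteSpace (F.Tplus b) := by
  have h : (F.Tplus b : Set E) = {v | F.proj b v = 0} := by
    ext v
    exact ⟨fun ⟨w, hw⟩ => by
      rw [← hw]; simp [F.proj_idem b w], fun hv => ⟨v, by
        simp only [mem_ofPred_eq] at hv
        simp [hv]⟩⟩
  have : IsClosed (F.Tplus b : Set E) := by
    rw [h]; exact isClosed_eq (F.proj b).continuous continuous_const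
  exact this.completeSpace_coe

theorem Polarization.bijective_prod (F : Polarization E B) (b : B) :
    Function.Bijective ((F.piMinus b).prod (F.piPlus b)) := by
  constructor
  · rw [injective_iff_map_eq_zero]
    intro v hv
    have h1 : F.proj b v = 0 := congrArg Subtype.val (congrArg Prod.fst hv)
    have h2 : v - F.proj b v = 0 := congrArg Subtype.val (congrArg Prod.snd hv)
    rwa [h1, sub_zero] at h2
  · rintro ⟨⟨_, v, rfl⟩, ⟨_, w, rfl⟩⟩
    refine ⟨F.proj b v + (w - F.proj b w), Prod.ext (Subtype.ext ?_) (Subtype.ext ?_)⟩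
    · change F.proj b (F.proj b v + (w - F.proj b w)) = F.proj b v
      simp [F.proj_idem]
    · change (F.proj b v + (w - F.proj b w)) - F.proj b (F.proj b v + (w - F.proj b w)) =
        w - F.proj b w
      simp [F.proj_idem]

end Polarization

variable {P : Type u} [TopologicalSpace P] [T2Space P] [SecondCountableTopology P]
  {E₀ : Type*} [NormedAddCommGroup E₀] [InnerProductSpace ℝ E₀]
  {B₀ : Type*} [TopologicalSpace B₀] [ChartedSpace E₀ B₀] [IsManifold 𝓘(ℝ, E₀) ∞ B₀]
  {E₁ : Type*} [NormedAddCommGroup E₁] [InnerProductSpace ℝ E₁]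
  {B₁ : Type*} [TopologicalSpace B₁] [ChartedSpace E₁ B₁] [IsManifold 𝓘(ℝ, E₁) ∞ B₁]
  {EZ : Type w} [NormedAddCommGroup EZ] [InnerProductSpace ℝ EZ]
  {HZ : Type*} [TopologicalSpace HZ] {I : ModelWithCorners ℝ EZ HZ} {ℓ : EZ →L[ℝ] ℝ}
  {Z : Type v} [TopologicalSpace Z] [ChartedSpace HZ Z]
  {SP : LCManifold.{u, w} P} {σ : P → B₀} {f : Z → B₀ × B₁}
  {F₀ : FloerSpace E₀ B₀} {F₁ : FloerSpace E₁ B₁}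

variable (I ℓ) in
/-- The tangent space at `z` of the stratum of `z`. -/
def stratumTangent (z : Z) : Submodule ℝ EZ where
  carrier := {v | I.IsBoundaryPoint z → ℓ v = 0}
  add_mem' h h' hz := by rw [map_add, h hz, h' hz, add_zero]
  zero_mem' _ := map_zero ℓ
  smul_mem' c _ h hz := by rw [map_smul, h hz, smul_zero]

theorem isClosed_stratumTangent (z : Z) : IsClosed (stratumTangent I ℓ z : Set EZ) := by
  by_cases hz : I.IsBoundaryPoint z
  · have : (stratumTangent I ℓ z : Set EZ) = {v | ℓ v = 0} := by
      ext v; exact ⟨fun h => h hz, fun h _ => h⟩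
    rw [this]; exact isClosed_eq ℓ.continuous continuous_const
  · have : (stratumTangent I ℓ z : Set EZ) = univ := by
      ext v; exact ⟨fun h => trivial, fun _ h => absurd h hz⟩
    rw [this]; exact isClosed_univ

theorem finiteDimensional_quotient_stratumTangent (z : Z) :
    FiniteDimensional ℝ (EZ ⧸ stratumTangent I ℓ z) := by
  have hle : (ℓ : EZ →ₗ[ℝ] ℝ).ker ≤ stratumTangent I ℓ z := fun v hv _ => hv
  have : FiniteDimensional ℝ (EZ ⧸ (ℓ : EZ →ₗ[ℝ] ℝ).ker) :=
    Module.Finite.equiv (ℓ : EZ →ₗ[ℝ] ℝ).quotKerEquivRange.symm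
  exact Module.Finite.of_surjective _ (Submodule.factor_surjective hle)

/-- At interior points this is the density of the image of `Df₀`, at boundary points that of the
image of its restriction to the boundary. -/
theorem dense_range_stratumTangent (hf : IsCorrespondence I ℓ F₀ F₁ f) (z : Z) :
    Dense (range (diff₀ I E₀ f z ∘L (stratumTangent I ℓ z).subtypeL)) := by
  by_cases hz : I.IsBoundaryPoint z
  · refine (hf.dense_boundary z hz).mono ?_
    rintro _ ⟨v, hv, rfl⟩
    exact ⟨⟨v, fun _ => hv⟩, rfl⟩
  · refine (hf.dense z).mono ?_
    rintro _ ⟨v, rfl⟩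
    exact ⟨⟨v, fun h => absurd h hz⟩, rfl⟩

/-- The Fredholm property is inherited by the restriction to the stratum, whose tangent space has
finite codimension. -/
theorem algFredholm_mixedDiff_comp (hf : IsCorrespondence I ℓ F₀ F₁ f) (z : Z) :
    AlgFredholm ((mixedDiff I F₀ F₁ f z ∘L (stratumTangent I ℓ z).subtypeL :
      stratumTangent I ℓ z →L[ℝ] F₀.Tplus (f z).1 × F₁.Tminus (f z).2) :
        stratumTangent I ℓ z →ₗ[ℝ] F₀.Tplus (f z).1 × F₁.Tminus (f z).2) := by
  have := finiteDimensional_quotient_stratumTangent (I := I) (ℓ := ℓ) z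
  exact (algFredholm_of_isFredholm (hf.fredholm z)).comp
    (algFredholm_subtype (stratumTangent I ℓ z))

/-- The two operator axioms of a chain, with the target space named by a point `b` equal to `σ x`,
so that they can be combined with operators at `b = f₀ z`. -/
theorem IsChain.algFredholm (hσ : IsChain SP F₀ σ) {x : P} {i : ℕ}
    {d : HilbertChart.{u, w} {p | SP.codim p = i}} (hd : d ∈ SP.atlas i) (hx : x ∈ d.coord.source)
    {b : B₀} (hb : σ x = b) :
    AlgFredholm ((F₀.piMinus b ∘L diff E₀ d σ x : d.E →L[ℝ] F₀.Tminus b) :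
      d.E →ₗ[ℝ] F₀.Tminus b) ∧ IsCompactOperator (F₀.piPlus b ∘L diff E₀ d σ x) := by
  subst hb
  obtain rfl : SP.codim x = i := d.codim_eq hx
  exact ⟨algFredholm_of_isFredholm (hσ.fredholm x d hd hx), hσ.compact x d hd hx⟩

/-- On each stratum of `P × Z`, the maps `σ` and `f₀` are transverse. -/
theorem exists_diff_sub_eq [CompleteSpace E₀] [CompleteSpace E₁]
    [CompleteSpace EZ] (hσ : IsChain SP F₀ σ) (hf : IsCorrespondence I ℓ F₀ F₁ f) {x : P}
    {z : Z} (hxz : σ x = (f z).1) {i : ℕ}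
    {d : HilbertChart.{u, w} {p | SP.codim p = i}} (hd : d ∈ SP.atlas i)
    (hx : x ∈ d.coord.source) (e : E₀) :
    ∃ p v, (I.IsBoundaryPoint z → ℓ v = 0) ∧ diff₀ I E₀ f z v - diff E₀ d σ x p = e := by
  have := F₀.completeSpace_Tminus (f z).1
  have := F₀.completeSpace_Tplus (f z).1
  have := F₁.completeSpace_Tminus (f z).2
  have := (isClosed_stratumTangent (I := I) (ℓ := ℓ) z).completeSpace_coe
  obtain ⟨h1, h2⟩ := hσ.algFredholm hd hx hxz
  obtain ⟨p, v, h⟩ := surjective_sub (F₀.bijective_prod (f z).1) h1 h2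
    (b := diff₀ I E₀ f z ∘L (stratumTangent I ℓ z).subtypeL)
    (m := (F₁.piMinus (f z).2 ∘L diff₁ I E₁ f z) ∘L (stratumTangent I ℓ z).subtypeL)
    (algFredholm_mixedDiff_comp hf z) (dense_range_stratumTangent hf z) e
  exact ⟨p, v, v.2, h⟩

/-- The operator `Π₁⁻ ∘ Df₁` on the fibre product of the tangent spaces, the image of `D`, is
Fredholm. Where `z` is an interior point, its index is the sum of the two given indices. -/
theorem algFredholm_fibre_tangent [CompleteSpace E₀] [CompleteSpace E₁]
    [CompleteSpace EZ] (hσ : IsChain SP F₀ σ) (hf : IsCorrespondence I ℓ F₀ F₁ f)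
    {x : P} {z : Z} (hxz : σ x = (f z).1) {i : ℕ}
    {d : HilbertChart.{u, w} {p | SP.codim p = i}} (hd : d ∈ SP.atlas i)
    (hx : x ∈ d.coord.source) {T : Type*} [NormedAddCommGroup T] [NormedSpace ℝ T]
    (D : T →L[ℝ] d.E × EZ) (hD : Function.Injective D)
    (hr : range D = {t | (I.IsBoundaryPoint z → ℓ t.2 = 0) ∧
      diff E₀ d σ x t.1 = diff₀ I E₀ f z t.2}) :
    AlgFredholm ((F₁.piMinus (f z).2 ∘L diff₁ I E₁ f z ∘L .snd ℝ d.E EZ ∘L D : T →L[ℝ] _) :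
      T →ₗ[ℝ] F₁.Tminus (f z).2) ∧
    (¬ I.IsBoundaryPoint z →
      ((F₁.piMinus (f z).2 ∘L diff₁ I E₁ f z ∘L .snd ℝ d.E EZ ∘L D : T →L[ℝ] _) :
        T →ₗ[ℝ] F₁.Tminus (f z).2).index = corrIndex I F₀ F₁ f z +
          ((F₀.piMinus (σ x) ∘L diff E₀ d σ x : d.E →L[ℝ] F₀.Tminus (σ x)) :
            d.E →ₗ[ℝ] F₀.Tminus (σ x)).index) := by
  have := F₀.completeSpace_Tminus (f z).1
  have := F₀.completeSpace_Tplus (f z).1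
  have := F₁.completeSpace_Tminus (f z).2
  have := (isClosed_stratumTangent (I := I) (ℓ := ℓ) z).completeSpace_coe
  obtain ⟨h1, h2⟩ := hσ.algFredholm hd hx hxz
  have hmem : ∀ t, (I.IsBoundaryPoint z → ℓ (D t).2 = 0) ∧
      diff E₀ d σ x (D t).1 = diff₀ I E₀ f z (D t).2 := fun t => by
    have : D t ∈ range D := mem_range_self t
    rwa [hr] at this
  let D' : T →ₗ[ℝ] d.E × stratumTangent I ℓ z :=
    (LinearMap.fst ℝ d.E EZ ∘ₗ (D : T →ₗ[ℝ] d.E × EZ)).prod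
      ((LinearMap.snd ℝ d.E EZ ∘ₗ (D : T →ₗ[ℝ] d.E × EZ)).codRestrict (stratumTangent I ℓ z)
        fun t => (hmem t).1)
  have hD' : Function.Injective D' := fun t t' h => hD (Prod.ext
    (congrArg (fun q : d.E × stratumTangent I ℓ z => q.1) h)
    (congrArg (fun q : d.E × stratumTangent I ℓ z => (q.2 : EZ)) h))
  obtain ⟨k1, k2⟩ := algFredholm_fibre (F₀.bijective_prod (f z).1) h1 h2
    (b := diff₀ I E₀ f z ∘L (stratumTangent I ℓ z).subtypeL)
    (m := (F₁.piMinus (f z).2 ∘L diff₁ I E₁ f z) ∘L (stratumTangent I ℓ z).subtypeL)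
    (algFredholm_mixedDiff_comp hf z) (dense_range_stratumTangent hf z) D' hD' (by
      ext ⟨p, v⟩
      constructor
      · rintro ⟨t, ht⟩
        rw [← ht]
        exact (hmem t).2
      · intro h
        have : (p, (v : EZ)) ∈ range D := by
          rw [hr]; exact ⟨v.2, h⟩
        obtain ⟨t, ht⟩ := this
        exact ⟨t, Prod.ext (congrArg (fun q : d.E × EZ => q.1) ht)
          (Subtype.ext (congrArg (fun q : d.E × EZ => q.2) ht))⟩)
  refine ⟨k1, fun hz => ?_⟩
  have hN : Function.Bijective (stratumTangent I ℓ z).subtype :=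
    ⟨Subtype.val_injective, fun v => ⟨⟨v, fun h => absurd h hz⟩, rfl⟩⟩
  have k3 := (algFredholm_of_isFredholm (hf.fredholm z)).index_comp (algFredholm_of_bijective hN)
  rw [index_of_bijective hN, add_zero] at k3
  refine k2.trans ?_
  congr 1
  rw [hxz]

end Transversality

/-! ### Local coordinates on the fibre product -/

section FibreChart

variable {P : Type u} [TopologicalSpace P] [T2Space P] [SecondCountableTopology P]
  {E₀ : Type*} [NormedAddCommGroup E₀] [InnerProductSpace ℝ E₀]
  {B₀ : Type*} [TopologicalSpace B₀] [ChartedSpace E₀ B₀]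
  {E₁ : Type*} [NormedAddCommGroup E₁]
  {B₁ : Type*} [TopologicalSpace B₁] [ChartedSpace E₁ B₁]
  {EZ : Type w} [NormedAddCommGroup EZ] [InnerProductSpace ℝ EZ]
  {HZ : Type*} [TopologicalSpace HZ] {I : ModelWithCorners ℝ EZ HZ} {ℓ : EZ →L[ℝ] ℝ}
  {Z : Type v} [TopologicalSpace Z] [ChartedSpace HZ Z]
  {SP : LCManifold.{u, w} P} {σ : P → B₀} {f : Z → B₀ × B₁} {x₀ : P} {z₀ : Z}

namespace LocalChart

/-- The coordinates of the base point. -/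
noncomputable def base (L : LocalChart E₀ E₁ I SP σ f x₀ z₀) : L.A := L.coordA (x₀, z₀)

theorem base_mem_dom (L : LocalChart E₀ E₁ I SP σ f x₀ z₀) : (L.base, 0) ∈ L.dom := by
  have := (L.coord_mem L.base_mem_tgt).1
  rwa [L.coordS_base] at this

theorem param_base (L : LocalChart E₀ E₁ I SP σ f x₀ z₀) : L.param (L.base, 0) = (x₀, z₀) := by
  have := L.param_coord L.base_mem_tgt
  rwa [L.coordS_base] at this

end LocalChart

theorem exists_cube_subset {n : ℕ} {N : Set (Fin n → ℝ)} (hN : N ∈ 𝓝 0) :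
    ∃ δ > 0, cube n δ ⊆ N := by
  obtain ⟨δ, hδ, h⟩ := Metric.mem_nhds_iff.1 hN
  refine ⟨δ, hδ, fun s hs => h ?_⟩
  rw [mem_ball_zero_iff, pi_norm_lt_iff hδ]
  exact fun j => by rw [Real.norm_of_nonneg (hs j).1]; exact (hs j).2

theorem zero_mem_cube {n : ℕ} {δ : ℝ} (hδ : 0 < δ) : (0 : Fin n → ℝ) ∈ cube n δ :=
  fun _ => ⟨le_rfl, hδ⟩

theorem continuousOn_const_clm_prod {S X Y W : Type*} [TopologicalSpace S] [NormedAddCommGroup X]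
    [NormedSpace ℝ X] [NormedAddCommGroup Y] [NormedSpace ℝ Y] [NormedAddCommGroup W]
    [NormedSpace ℝ W] (A : X →L[ℝ] Y) {D : S → X →L[ℝ] W} {s : Set S} (hD : ContinuousOn D s) :
    ContinuousOn (fun q => A.prod (D q)) s := by
  have h : ContinuousOn (fun q => .inl ℝ Y W ∘L A + .inr ℝ Y W ∘L D q) s :=
    continuousOn_const.add (continuousOn_const.clm_comp hD)
  refine h.congr fun q _ => ?_
  ext v <;> simp

/-- A projection `κ` of the coordinates such that `(κ, G(·, s))` is invertible near the base point,
with inverse `g(·, s)`, for all small `s ≥ 0`. The zeros of `G(·, s)` near the base point are the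
points `g((k, 0), s)`, so that `(k, s)` are coordinates on the fibre product. -/
structure FibreChart (L : LocalChart E₀ E₁ I SP σ f x₀ z₀) where
  K : Type w
  [normed : NormedAddCommGroup K]
  [inner : InnerProductSpace ℝ K]
  [complete : CompleteSpace K]
  κ : L.A →L[ℝ] K
  ρ : ℝ
  r : ℝ
  δ : ℝ
  ρ_pos : 0 < ρ
  r_pos : 0 < r
  δ_pos : 0 < δ
  g : (K × E₀) × L.C → L.A
  subset_dom : Metric.ball L.base ρ ×ˢ cube (SP.codim x₀ + boundaryCodim I z₀) δ ⊆ L.dom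
  mem_ball : ∀ y ∈ Metric.ball 0 r, ∀ s ∈ cube (SP.codim x₀ + boundaryCodim I z₀) δ,
    g (y, s) ∈ Metric.ball L.base ρ
  right_inv : ∀ y ∈ Metric.ball 0 r, ∀ s ∈ cube (SP.codim x₀ + boundaryCodim I z₀) δ,
    (κ (g (y, s) - L.base), L.G (g (y, s), s)) = y
  left_inv : ∀ a ∈ Metric.ball L.base ρ, ∀ s ∈ cube (SP.codim x₀ + boundaryCodim I z₀) δ,
    (κ (a - L.base), L.G (a, s)) ∈ Metric.ball 0 r → g ((κ (a - L.base), L.G (a, s)), s) = a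
  continuousOn : ContinuousOn g (Metric.ball 0 r ×ˢ cube (SP.codim x₀ + boundaryCodim I z₀) δ)
  invertible : ∀ a ∈ Metric.ball L.base ρ, ∀ s ∈ cube (SP.codim x₀ + boundaryCodim I z₀) δ,
    (κ.prod (L.DG (a, s))).IsInvertible

attribute [instance] FibreChart.normed FibreChart.inner FibreChart.complete

/-- By transversality the derivative of `G` at the base point is onto. Together with the orthogonal
projection `κ` onto its kernel it is bijective, and the parametric inverse function theorem applies.
-/
theorem exists_fibreChart [CompleteSpace E₀] [IsManifold 𝓘(ℝ, E₀) ∞ B₀] [InnerProductSpace ℝ E₁]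
    [CompleteSpace E₁] [IsManifold 𝓘(ℝ, E₁) ∞ B₁] [CompleteSpace EZ] [IsManifold I ∞ Z]
    (hI : range I = {v | 0 ≤ ℓ v}) {F₀ : FloerSpace E₀ B₀} {F₁ : FloerSpace E₁ B₁}
    (hσ : IsChain SP F₀ σ) (hf : IsCorrespondence I ℓ F₀ F₁ f) (h₀ : σ x₀ = (f z₀).1)
    (L : LocalChart E₀ E₁ I SP σ f x₀ z₀) : Nonempty (FibreChart L) := by
  have hf₀ : ContMDiff I 𝓘(ℝ, E₀) ∞ fun z => (f z).1 := hf.smooth.fst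
  set n := SP.codim x₀ + boundaryCodim I z₀ with hn
  have hG0 : L.G (L.base, 0) = 0 := by
    rw [L.G_eq_zero_iff h₀ (L.mem_quadrant_zero L.base_mem_dom), L.param_base]
    exact h₀
  -- transversality makes the derivative of `G` surjective
  have hsurj : Function.Surjective (L.DG (L.base, 0)) := by
    have hx : (L.param (L.base, 0)).1 ∈ L.c.coord.source := by
      rw [L.param_base]; exact L.V_subset L.base_mem
    obtain ⟨-, hr⟩ := L.tangent_param hI L.base_mem_dom L.c_mem hx rfl
    obtain ⟨M, hM⟩ := L.exists_DG_eq hσ.smooth hf₀ h₀ L.base_mem_dom hG0 L.c_mem hx rfl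
    have hfib : σ (L.param (L.base, 0)).1 = (f (L.param (L.base, 0)).2).1 := by
      rw [L.param_base]; exact h₀
    intro e
    obtain ⟨p, v, hv, he⟩ := exists_diff_sub_eq hσ hf hfib L.c_mem hx (-(M.symm e))
    have : (p, v) ∈ {t : L.c.E × EZ | I.IsBoundaryPoint (L.param (L.base, 0)).2 → ℓ t.2 = 0} := hv
    rw [← hr] at this
    obtain ⟨α, hα⟩ := this
    refine ⟨α, ?_⟩
    rw [hM, hα, ← neg_sub, he, neg_neg, M.apply_symm_apply]
  let N : Submodule ℝ L.A := (L.DG (L.base, 0)).ker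
  have hNc : IsClosed (N : Set L.A) := (L.DG (L.base, 0)).isClosed_ker
  have : CompleteSpace N := hNc.completeSpace_coe
  let κ : L.A →L[ℝ] N := N.orthogonalProjectionOnto
  have hbij : Function.Bijective (κ.prod (L.DG (L.base, 0))) := by
    have hκ : ∀ v : N, κ v = v := fun v => N.orthogonalProjectionOnto_mem_subspace_eq_self v
    constructor
    · rw [injective_iff_map_eq_zero]
      intro v hv
      have h1 : κ v = 0 := congrArg Prod.fst hv
      have h2 : v ∈ N := congrArg Prod.snd hv
      have h3 := hκ ⟨v, h2⟩
      rw [h1] at h3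
      exact (congrArg Subtype.val h3).symm
    · rintro ⟨k, e⟩
      obtain ⟨v, rfl⟩ := hsurj e
      refine ⟨v + ((k - κ v : N) : L.A), Prod.ext ?_ ?_⟩
      · change κ (v + ((k - κ v : N) : L.A)) = k
        rw [map_add, hκ]; abel
      · change L.DG (L.base, 0) (v + ((k - κ v : N) : L.A)) = L.DG (L.base, 0) v
        have : L.DG (L.base, 0) ((k - κ v : N) : L.A) = 0 := (k - κ v).2
        rw [map_add, this, add_zero]
  obtain ⟨U, hU, V, hV, hUV⟩ := mem_nhds_prod_iff.1 (L.isOpen_dom.mem_nhds L.base_mem_dom)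
  obtain ⟨U', hU', hU'o, hbU⟩ := mem_nhds_iff.1 hU
  obtain ⟨δ₀, hδ₀, hδV⟩ := exists_cube_subset hV
  have hsub : U' ×ˢ cube n δ₀ ⊆ L.quadrant := fun q hq =>
    ⟨hUV ⟨hU' hq.1, hδV hq.2⟩, fun j => (hq.2 j).1⟩
  let Ψ : L.A × L.C → N × E₀ := fun q => (κ (q.1 - L.base), L.G q)
  have hΨd : ∀ q ∈ L.quadrant, HasFDerivAt (fun a => Ψ (a, q.2)) (κ.prod (L.DG q)) q.1 :=
    fun q hq => (κ.hasFDerivAt.comp q.1 ((hasFDerivAt_id q.1).sub_const L.base)).prodMk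
      (L.hasFDerivAt_G hf₀ hq)
  obtain ⟨ρ, hρ, r, hr, W, hW, g, h1, h2, h3, h4, h5⟩ :=
    exists_parametric_inverse (C := cube n δ₀) hU'o hbU (zero_mem_cube hδ₀) (Ψ := Ψ)
      (((κ.continuous.comp (continuous_fst.sub continuous_const)).continuousOn).prodMk
        ((L.continuousOn_G hσ.smooth.continuous hf₀).mono hsub))
      (fun s hs a ha => (hΨd (a, s) (hsub ⟨ha, hs⟩)).differentiableAt.differentiableWithinAt)
      (((continuousOn_const_clm_prod κ (L.continuousOn_DG hf₀)).mono hsub).congr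
        fun q hq => (hΨd q (hsub hq)).fderiv)
      (by simp [Ψ, hG0])
      (by
        rw [(hΨd (L.base, 0) (L.mem_quadrant_zero L.base_mem_dom)).fderiv]
        exact ⟨ContinuousLinearEquiv.ofBijective _ (LinearMap.ker_eq_bot.2 hbij.1)
          (LinearMap.range_eq_top.2 hbij.2), by ext <;> rfl⟩)
  obtain ⟨δ₁, hδ₁, hδW⟩ := exists_cube_subset hW
  have hcube : cube n (min δ₀ δ₁) ⊆ W ∩ cube n δ₀ := fun s hs =>
    ⟨hδW fun j => ⟨(hs j).1, (hs j).2.trans_le (min_le_right _ _)⟩,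
      fun j => ⟨(hs j).1, (hs j).2.trans_le (min_le_left _ _)⟩⟩
  refine ⟨{ K := N, κ := κ, ρ := ρ, r := r, δ := min δ₀ δ₁, ρ_pos := hρ, r_pos := hr,
            δ_pos := lt_min hδ₀ hδ₁, g := g, subset_dom := ?_, mem_ball := ?_, right_inv := ?_,
            left_inv := ?_, continuousOn := ?_, invertible := ?_ }⟩
  · exact fun q hq => (hsub ⟨h1 hq.1, (hcube hq.2).2⟩).1
  · exact fun y hy s hs => (h2 y hy s (hcube hs)).1
  · exact fun y hy s hs => (h2 y hy s (hcube hs)).2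
  · exact fun a ha s hs => h3 a ha s (hcube hs)
  · exact h4.mono (prod_mono le_rfl hcube)
  · intro a ha s hs
    have := h5 a ha s (hcube hs)
    rwa [(hΨd (a, s) (hsub ⟨h1 ha, (hcube hs).2⟩)).fderiv] at this

namespace FibreChart

variable {L : LocalChart E₀ E₁ I SP σ f x₀ z₀} (Q : FibreChart L)

/-- The solution `a` of `κ (a - base) = k` and `G (a, s) = 0`: the interior coordinates in `P × Z`
of the point of the fibre product with coordinates `(k, s)`. -/
noncomputable def sol (q : Q.K × L.C) : L.A := Q.g ((q.1, 0), q.2)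

/-- The domain of `sol`. -/
abbrev box : Set (Q.K × L.C) :=
  Metric.ball 0 Q.r ×ˢ cube (SP.codim x₀ + boundaryCodim I z₀) Q.δ

theorem mk_zero_mem_ball {k : Q.K} : (k, (0 : E₀)) ∈ Metric.ball 0 Q.r ↔ k ∈ Metric.ball 0 Q.r := by
  simp [Prod.norm_def]

variable {Q} {q : Q.K × L.C}

theorem sol_mem_ball (hq : q ∈ Q.box) : Q.sol q ∈ Metric.ball L.base Q.ρ :=
  Q.mem_ball _ (Q.mk_zero_mem_ball.2 hq.1) _ hq.2

theorem mem_quadrant {a : L.A} {s : L.C} (ha : a ∈ Metric.ball L.base Q.ρ)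
    (hs : s ∈ cube (SP.codim x₀ + boundaryCodim I z₀) Q.δ) : (a, s) ∈ L.quadrant :=
  ⟨Q.subset_dom ⟨ha, hs⟩, fun j => (hs j).1⟩

theorem sol_mem_quadrant (hq : q ∈ Q.box) : (Q.sol q, q.2) ∈ L.quadrant :=
  mem_quadrant (sol_mem_ball hq) hq.2

theorem κ_sol (hq : q ∈ Q.box) : Q.κ (Q.sol q - L.base) = q.1 :=
  congrArg Prod.fst (Q.right_inv _ (Q.mk_zero_mem_ball.2 hq.1) _ hq.2)

theorem G_sol (hq : q ∈ Q.box) : L.G (Q.sol q, q.2) = 0 :=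
  congrArg Prod.snd (Q.right_inv _ (Q.mk_zero_mem_ball.2 hq.1) _ hq.2)

theorem sol_κ {a : L.A} {s : L.C} (ha : a ∈ Metric.ball L.base Q.ρ)
    (hs : s ∈ cube (SP.codim x₀ + boundaryCodim I z₀) Q.δ) (hG : L.G (a, s) = 0)
    (hκ : Q.κ (a - L.base) ∈ Metric.ball 0 Q.r) : Q.sol (Q.κ (a - L.base), s) = a := by
  have := Q.left_inv a ha s hs
  rw [hG] at this
  exact this (Q.mk_zero_mem_ball.2 hκ)

theorem continuousOn_sol : ContinuousOn Q.sol Q.box :=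
  Q.continuousOn.comp (f := fun q : Q.K × L.C => ((q.1, (0 : E₀)), q.2))
    (by fun_prop) fun _ hq => ⟨Q.mk_zero_mem_ball.2 hq.1, hq.2⟩

variable [IsManifold I ∞ Z] [IsManifold 𝓘(ℝ, E₀) ∞ B₀]

/-- `sol` is smooth where the set of vanishing corner coordinates is constant. -/
theorem contDiffWithinAt_sol [CompleteSpace E₀] (hσ : IsLCSmooth E₀ SP σ)
    (hf : ContMDiff I 𝓘(ℝ, E₀) ∞ fun z => (f z).1) (hq : q ∈ Q.box) :
    ContDiffWithinAt ℝ ∞ Q.sol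
      (Q.box ∩ {q' | ∀ j, q'.2 j = 0 ↔ q.2 j = 0}) q := by
  set n := SP.codim x₀ + boundaryCodim I z₀ with hn
  -- `T` is the set of points of the cube with the same vanishing coordinates as `q.2`, and `π` a
  -- projection onto it; `G` is known to be smooth only along `T`
  let T : Set L.C := {s | s ∈ cube n Q.δ ∧ ∀ j, s j = 0 ↔ q.2 j = 0}
  let π : L.C → L.C := fun s j => if q.2 j = 0 then 0 else s j
  have hT : ∀ s ∈ T, π s = s := fun s hs => by
    ext j
    by_cases h : q.2 j = 0
    · simp [π, h, (hs.2 j).2 h]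
    · simp [π, h]
  have hqT : q.2 ∈ T := ⟨hq.2, fun _ => Iff.rfl⟩
  have hπs : ∀ᶠ s in 𝓝 q.2, π s ∈ T := by
    have h1 : ∀ j, ∀ᶠ s : L.C in 𝓝 q.2, q.2 j ≠ 0 → 0 < s j ∧ s j < Q.δ := fun j => by
      by_cases h : q.2 j = 0
      · exact Eventually.of_forall fun s hs => absurd h hs
      · have h2 : 0 < q.2 j := lt_of_le_of_ne (hq.2 j).1 (Ne.symm h)
        have hc : ContinuousAt (fun s : L.C => s j) q.2 := (continuous_apply j).continuousAt
        filter_upwards [hc.eventually (lt_mem_nhds h2), hc.eventually (gt_mem_nhds (hq.2 j).2)]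
          with s h3 h4 _ using ⟨h3, h4⟩
    filter_upwards [eventually_all.2 h1] with s hs
    refine ⟨fun j => ?_, fun j => ?_⟩
    · by_cases h : q.2 j = 0
      · simp only [π, if_pos h]; exact ⟨le_rfl, Q.δ_pos⟩
      · simp only [π, if_neg h]; exact ⟨(hs j h).1.le, (hs j h).2⟩
    · by_cases h : q.2 j = 0
      · simp [π, h]
      · simp only [π, if_neg h, h, iff_false]; exact (hs j h).1.ne'
  have hπ : ContDiff ℝ ∞ π := contDiff_pi.2 fun j => by
    by_cases h : q.2 j = 0
    · simp only [π, if_pos h]; exact contDiff_const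
    · simp only [π, if_neg h]; exact contDiff_apply ℝ ℝ j
  let Ψ : L.A × L.C → Q.K × E₀ := fun q => (Q.κ (q.1 - L.base), L.G q)
  have hΨ : ContDiffOn ℝ ∞ Ψ (Metric.ball L.base Q.ρ ×ˢ T) := by
    refine ContDiffOn.prodMk ?_ fun x hx => ?_
    · exact (Q.κ.contDiff.comp (contDiff_fst.sub contDiff_const)).contDiffOn
    · refine L.smooth_G (k := fun x => x) hσ hf contDiffWithinAt_id hx
        (fun x hx => mem_quadrant hx.1 hx.2.1) fun y hy j => ?_
      rw [hy.2.2 j, hx.2.2 j]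
  have hmem : (((q.1, 0), q.2) : (Q.K × E₀) × L.C) ∈ Metric.ball 0 Q.r ×ˢ T :=
    ⟨Q.mk_zero_mem_ball.2 hq.1, hqT⟩
  have h1 : ContDiffWithinAt ℝ ∞ Q.g (Metric.ball 0 Q.r ×ˢ T) ((q.1, 0), q.2) := by
    refine contDiffWithinAt_parametric_inverse Metric.isOpen_ball hΨ hqT hπ hπs
      (by filter_upwards [self_mem_nhdsWithin] with s hs using hT s hs) (sol_mem_ball hq)
      ((Q.continuousOn _ ⟨hmem.1, hq.2⟩).mono (prod_mono le_rfl fun s hs => hs.1)) hmem.1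
      (fun y hy => Q.right_inv y.1 hy.1 y.2 hy.2.1) ?_
    have h2 : HasFDerivAt (fun a => Ψ (a, q.2)) (Q.κ.prod (L.DG (Q.sol q, q.2))) (Q.sol q) :=
      (Q.κ.hasFDerivAt.comp (Q.sol q) ((hasFDerivAt_id (Q.sol q)).sub_const L.base)).prodMk
        (L.hasFDerivAt_G hf (sol_mem_quadrant hq))
    change (fderiv ℝ (fun a => Ψ (a, q.2)) (Q.sol q)).IsInvertible
    rw [h2.fderiv]
    exact Q.invertible _ (sol_mem_ball hq) _ hq.2
  refine ContDiffWithinAt.comp (g := Q.g) (f := fun q : Q.K × L.C => ((q.1, (0 : E₀)), q.2)) q h1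
    (by fun_prop) fun q' hq' => ⟨Q.mk_zero_mem_ball.2 hq'.1.1, hq'.1.2, hq'.2⟩

/-- The derivative of `sol` in the interior directions. -/
noncomputable def Dsol (Q : FibreChart L) (q : Q.K × L.C) : Q.K →L[ℝ] L.A :=
  (Q.κ.prod (L.DG (Q.sol q, q.2))).inverse ∘L .inl ℝ Q.K E₀

/-- For fixed corner coordinates `sol` is smooth; its derivative is found by differentiating the two
equations that define it. -/
theorem hasFDerivAt_sol [CompleteSpace E₀] (hσ : IsLCSmooth E₀ SP σ)
    (hf : ContMDiff I 𝓘(ℝ, E₀) ∞ fun z => (f z).1) (hq : q ∈ Q.box) :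
    HasFDerivAt (fun k => Q.sol (k, q.2)) (Q.Dsol q) q.1 := by
  have hn : ∀ᶠ k in 𝓝 q.1, (k, q.2) ∈ Q.box := by
    filter_upwards [Metric.isOpen_ball.mem_nhds hq.1] with k hk using ⟨hk, hq.2⟩
  have h1 : DifferentiableAt ℝ (fun k => Q.sol (k, q.2)) q.1 := by
    have hk : ContDiffWithinAt ℝ ∞ (fun k : Q.K => (k, q.2)) (Metric.ball 0 Q.r) q.1 := by
      fun_prop
    have := ContDiffWithinAt.comp (g := Q.sol) (f := fun k : Q.K => (k, q.2)) q.1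
      (contDiffWithinAt_sol hσ hf hq) hk
      fun k hk => ⟨⟨hk, hq.2⟩, fun _ => Iff.rfl⟩
    exact (this.contDiffAt (Metric.isOpen_ball.mem_nhds hq.1)).differentiableAt (by simp)
  have h2 : HasFDerivAt (fun a => (Q.κ (a - L.base), L.G (a, q.2)))
      (Q.κ.prod (L.DG (Q.sol q, q.2))) (Q.sol q) :=
    (Q.κ.hasFDerivAt.comp (Q.sol q) ((hasFDerivAt_id (Q.sol q)).sub_const L.base)).prodMk
      (L.hasFDerivAt_G hf (sol_mem_quadrant hq))
  have h3 := HasFDerivAt.comp q.1 (g := fun a => (Q.κ (a - L.base), L.G (a, q.2)))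
    (f := fun k => Q.sol (k, q.2)) h2 h1.hasFDerivAt
  have h4 : HasFDerivAt (fun k : Q.K => (k, (0 : E₀))) (.inl ℝ Q.K E₀) q.1 :=
    hasFDerivAt_prodMk_left q.1 0
  have h5 := h3.unique (h4.congr_of_eventuallyEq (by
    filter_upwards [hn] with k hk
    exact Prod.ext (κ_sol hk) (G_sol hk)))
  obtain ⟨M, hM⟩ := Q.invertible _ (sol_mem_ball hq) _ hq.2
  have h6 : Q.Dsol q = fderiv ℝ (fun k => Q.sol (k, q.2)) q.1 := by
    rw [Dsol, ← h5, ← hM, ContinuousLinearMap.inverse_equiv]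
    ext v
    simp
  rw [h6]
  exact h1.hasFDerivAt

/-- Unlike the higher derivatives of `sol`, the first one extends continuously across the corners,
because `DG` does. -/
theorem continuousOn_Dsol [CompleteSpace E₀]
    (hf : ContMDiff I 𝓘(ℝ, E₀) ∞ fun z => (f z).1) : ContinuousOn Q.Dsol Q.box := by
  refine ContinuousOn.clm_comp (fun q hq => ?_) continuousOn_const
  obtain ⟨M, hM⟩ := Q.invertible _ (sol_mem_ball hq) _ hq.2
  have h1 : ContinuousAt ContinuousLinearMap.inverse (Q.κ.prod (L.DG (Q.sol q, q.2))) := by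
    rw [← hM]
    exact (contDiffAt_map_inverse (n := 0) M).continuousAt
  have h2 : ContinuousOn (fun q : Q.K × L.C => Q.κ.prod (L.DG (Q.sol q, q.2))) Q.box :=
    continuousOn_const_clm_prod Q.κ
      ((L.continuousOn_DG hf).comp (continuousOn_sol.prodMk continuousOn_snd)
        fun q hq => sol_mem_quadrant hq)
  exact ContinuousAt.comp_continuousWithinAt (g := ContinuousLinearMap.inverse) h1 (h2 q hq)

end FibreChart

end FibreChart

/-! ### Charts of the strata of the fibre product -/

section FibreAtlas

variable {P : Type u} [TopologicalSpace P] [T2Space P] [SecondCountableTopology P]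
  {E₀ : Type*} [NormedAddCommGroup E₀] [InnerProductSpace ℝ E₀]
  {B₀ : Type*}
  {B₁ : Type*}
  {EZ : Type w} [NormedAddCommGroup EZ] [InnerProductSpace ℝ EZ]
  {HZ : Type*} [TopologicalSpace HZ] {I : ModelWithCorners ℝ EZ HZ} {ℓ : EZ →L[ℝ] ℝ}
  {Z : Type v} [TopologicalSpace Z] [ChartedSpace HZ Z]
  {SP : LCManifold.{u, w} P} {σ : P → B₀} {f : Z → B₀ × B₁}

variable (I SP) in
/-- The codimension in the fibre product. -/
noncomputable abbrev fibreCodim (q : FibreProduct σ f) : ℕ :=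
  SP.codim q.1.1 + boundaryCodim I q.1.2

theorem eventually_fibreCodim_le [IsManifold I ∞ Z] (q : FibreProduct σ f) :
    ∀ᶠ q' : FibreProduct σ f in 𝓝 q, SP.codim q'.1.1 ≤ SP.codim q.1.1 ∧
      boundaryCodim I q'.1.2 ≤ boundaryCodim I q.1.2 := by
  have h1 : Continuous fun q : FibreProduct σ f => q.1.1 := by fun_prop
  have h2 : Continuous fun q : FibreProduct σ f => q.1.2 := by fun_prop
  exact (h1.continuousAt.eventually (SP.eventually_codim_le q.1.1)).and
    (h2.continuousAt.eventually (eventually_boundaryCodim_le q.1.2))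

/-- Both codimensions being upper semicontinuous, they are locally constant where their sum is. -/
theorem eventually_codim_eq_of_fibreCodim [IsManifold I ∞ Z] {T : Type*} {F : Filter T}
    {h : T → FibreProduct σ f} {q : FibreProduct σ f} (hh : Tendsto h F (𝓝 q))
    (hc : ∀ᶠ t in F, fibreCodim I SP (h t) = fibreCodim I SP q) :
    ∀ᶠ t in F, SP.codim (h t).1.1 = SP.codim q.1.1 ∧
      boundaryCodim I (h t).1.2 = boundaryCodim I q.1.2 := by
  filter_upwards [hc, hh.eventually (eventually_fibreCodim_le (I := I) (SP := SP) q)] with t h1 h2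
  unfold fibreCodim at h1
  omega

variable [TopologicalSpace B₀] [ChartedSpace E₀ B₀]

variable (E₀ I ℓ SP) in
/-- The charts in which the stratum is an embedded submanifold of the product stratum of `P × Z`,
with the fibre product of the tangent spaces as tangent space. All charts with this property are
taken; they are compatible by `contDiffWithinAt_of_mem_fibreAtlas`. -/
def fibreAtlas (m : ℕ) :
    Set (HilbertChart.{max u v, w} {q : FibreProduct σ f | fibreCodim I SP q = m}) :=
  {c | (∀ i, ∀ d ∈ SP.atlas i, ContDiffOn ℝ ∞ (fun e => d.coord (c.coord.symm e).1.1)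
      {e | e ∈ c.coord.target ∧ (c.coord.symm e).1.1 ∈ d.coord.source}) ∧
    ContMDiffOn 𝓘(ℝ, c.E) I ∞ (fun e => (c.coord.symm e).1.2) c.coord.target ∧
    ∀ q ∈ c.coord.source, ∀ d ∈ SP.atlas (SP.codim q.1.1), q.1.1 ∈ d.coord.source →
      let D : c.E →L[ℝ] d.E × EZ :=
        (fderiv ℝ (fun e => d.coord (c.coord.symm e).1.1) (c.coord q)).prod
          (mfderiv 𝓘(ℝ, c.E) I (fun e => (c.coord.symm e).1.2) (c.coord q))
      Function.Injective D ∧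
        range D = {t | (I.IsBoundaryPoint q.1.2 → ℓ t.2 = 0) ∧
          diff E₀ d σ q.1.1 t.1 = diff₀ I E₀ f q.1.2 t.2}}

variable {T : Type*} [NormedAddCommGroup T] [NormedSpace ℝ T] {s : Set T} {t : T}

/-- The inclusion of a stratum of the fibre product into `P × Z` is smooth as a map into the product
of a stratum of `P` and `Z`. -/
theorem smooth_symm_of_mem_fibreAtlas [IsManifold I ∞ Z] {m : ℕ}
    {c : HilbertChart.{max u v, w} {q : FibreProduct σ f | fibreCodim I SP q = m}}
    (hc : c ∈ fibreAtlas E₀ I ℓ SP m) {e : c.E} (he : e ∈ c.coord.target) :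
    StratSmoothAt SP.toStratifiedSpace (fun e => (c.coord.symm e).1.1) c.coord.target e ∧
      ContMDiffWithinAt 𝓘(ℝ, c.E) I ∞ (fun e => (c.coord.symm e).1.2) c.coord.target e := by
  have hcod : ∀ e ∈ c.coord.target, fibreCodim I SP (c.coord.symm e) = m := fun e he => by
    obtain ⟨U, -, hU⟩ := c.source_eq
    have := c.coord.map_target he
    rw [hU] at this
    exact this.2
  have hcont := c.continuousOn_symm e he
  have hev := eventually_codim_eq_of_fibreCodim (I := I) (SP := SP) hcont.tendsto (by
    filter_upwards [self_mem_nhdsWithin] with e' he'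
    rw [hcod e' he', hcod e he])
  have hfst : ContinuousWithinAt (fun e => (c.coord.symm e).1.1) c.coord.target e :=
    (_root_.continuous_fst.comp continuous_subtype_val).continuousAt.comp_continuousWithinAt hcont
  refine ⟨⟨hfst, hev.mono fun _ h => h.1, fun d hd hdt => ?_⟩, hc.2.1 e he⟩
  refine (hc.1 _ d hd e ⟨he, hdt⟩).mono_of_mem_nhdsWithin ?_
  have h1 : Tendsto (fun e => (c.coord.symm e).1.1) (𝓝[c.coord.target] e)
      (𝓝[{p | SP.codim p = SP.codim (c.coord.symm e).1.1}] (c.coord.symm e).1.1) :=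
    tendsto_nhdsWithin_iff.2 ⟨hfst, hev.mono fun _ h => h.1⟩
  filter_upwards [self_mem_nhdsWithin, h1.eventually (d.eventually_mem_source hdt)] with e' h h'
  exact ⟨h, h'⟩

/-- A map into a stratum of the fibre product is smooth if its components are, because the inclusion
into `P × Z` is an immersion. -/
theorem contDiffWithinAt_of_mem_fibreAtlas [CompleteSpace EZ] [IsManifold I ∞ Z] {m : ℕ}
    {c : HilbertChart.{max u v, w} {q : FibreProduct σ f | fibreCodim I SP q = m}}
    (hc : c ∈ fibreAtlas E₀ I ℓ SP m) {h : T → FibreProduct σ f}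
    (h1 : StratSmoothAt SP.toStratifiedSpace (fun x => (h x).1.1) s t)
    (h2 : ContMDiffWithinAt 𝓘(ℝ, T) I ∞ (fun x => (h x).1.2) s t)
    (hcod : ∀ᶠ x in 𝓝[s] t, fibreCodim I SP (h x) = m) (ht : h t ∈ c.coord.source) :
    ContDiffWithinAt ℝ ∞ (fun x => c.coord (h x)) s t := by
  have hcont : ContinuousWithinAt h s t :=
    Topology.IsInducing.subtypeVal.continuousWithinAt_iff.2
      (h1.continuousWithinAt.prodMk h2.continuousWithinAt)
  have htend : Tendsto h (𝓝[s] t) (𝓝[{q | fibreCodim I SP q = m}] (h t)) :=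
    tendsto_nhdsWithin_iff.2 ⟨hcont, hcod⟩
  have hsrc := htend.eventually (c.eventually_mem_source ht)
  have hctgt : c.coord (h t) ∈ c.coord.target := c.coord.map_source ht
  have hinv : c.coord.symm (c.coord (h t)) = h t := c.coord.left_inv ht
  obtain ⟨k1, k2⟩ := smooth_symm_of_mem_fibreAtlas hc hctgt
  have hn : c.coord.target ∈ 𝓝 (c.coord (h t)) := c.isOpen_target.mem_nhds hctgt
  obtain ⟨d, hd, hdt⟩ := SP.exists_chart (h t).1.1
  obtain ⟨hinj, hrange⟩ := hc.2.2 _ ht d hd hdt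
  set D : c.E →L[ℝ] d.E × EZ :=
    (fderiv ℝ (fun e => d.coord (c.coord.symm e).1.1) (c.coord (h t))).prod
      (mfderiv 𝓘(ℝ, c.E) I (fun e => (c.coord.symm e).1.2) (c.coord (h t))) with hD
  -- a left inverse of the differential of the inclusion
  have hcl : IsClosed (D.range : Set (d.E × EZ)) := by
    have : (D.range : Set (d.E × EZ)) = {t' | (I.IsBoundaryPoint (h t).1.2 → ℓ t'.2 = 0) ∧
        diff E₀ d σ (h t).1.1 t'.1 = diff₀ I E₀ f (h t).1.2 t'.2} := hrange
    rw [this]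
    refine IsClosed.inter ?_ (isClosed_eq (by fun_prop) (by fun_prop))
    by_cases hb : I.IsBoundaryPoint (h t).1.2
    · simp only [hb, forall_const]
      exact isClosed_eq (by fun_prop) continuous_const
    · simp only [hb, false_imp_iff]
      exact isClosed_univ
  have hcomp : CompleteSpace D.range := hcl.completeSpace_coe
  obtain ⟨p, hp⟩ := closedComplemented_prod D.range hcl
  let De : c.E ≃L[ℝ] D.range := ContinuousLinearEquiv.ofBijective D.rangeRestrict
    (LinearMap.ker_eq_bot.2 fun x y hxy => hinj (congrArg Subtype.val hxy))
    (LinearMap.range_eq_top.2 fun ⟨_, x, hx⟩ => ⟨x, Subtype.ext hx⟩)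
  let R : d.E × EZ →L[ℝ] c.E := (De.symm : D.range →L[ℝ] c.E) ∘L p
  have hR : R ∘L D = ContinuousLinearMap.id ℝ c.E := by
    ext v
    change De.symm (p (De v : d.E × EZ)) = v
    rw [hp, De.symm_apply_apply]
  -- the inclusion in charts
  let Ψ : c.E → d.E × EZ := fun e =>
    (d.coord (c.coord.symm e).1.1, extChartAt I (h t).1.2 (c.coord.symm e).1.2)
  have hd' : (c.coord.symm (c.coord (h t))).1.1 ∈ d.coord.source := by rw [hinv]; exact hdt
  have hfst : ContDiffAt ℝ ∞ (fun e => d.coord (c.coord.symm e).1.1) (c.coord (h t)) :=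
    (k1.contDiffWithinAt hd hd').contDiffAt hn
  have hsndM : ContMDiffAt 𝓘(ℝ, c.E) I ∞ (fun e => (c.coord.symm e).1.2) (c.coord (h t)) :=
    k2.contMDiffAt hn
  have hext : ContMDiffAt I 𝓘(ℝ, EZ) ∞ (extChartAt I (h t).1.2)
      (c.coord.symm (c.coord (h t))).1.2 := by
    rw [hinv]; exact contMDiffAt_extChartAt
  have hsnd : ContDiffAt ℝ ∞ (fun e => extChartAt I (h t).1.2 (c.coord.symm e).1.2)
      (c.coord (h t)) := (hext.comp (c.coord (h t)) hsndM).contDiffAt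
  have hder : fderiv ℝ Ψ (c.coord (h t)) = D := by
    rw [hD, (hfst.differentiableAt (by simp)).fderiv_prodMk (hsnd.differentiableAt (by simp))]
    congr 1
    rw [(hsndM.mdifferentiableAt (by simp)).mfderiv]
    simp only [writtenInExtChartAt, mfld_simps, fderivWithin_univ, hinv]
    rfl
  refine contDiffWithinAt_of_comp_immersion (Ψ := Ψ) (R := R) (hfst.prodMk hsnd)
    (by rw [hder]; exact hR) ?_ ?_
  · have h4 : ContinuousWithinAt c.coord c.coord.source (h t) := c.continuousOn _ ht
    exact (h4.tendsto.comp (tendsto_nhdsWithin_iff.2 ⟨hcont, hsrc⟩))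
  · have h5 : ContDiffWithinAt ℝ ∞ (fun x => (d.coord (h x).1.1, extChartAt I (h t).1.2 (h x).1.2))
        s t := by
      refine (h1.contDiffWithinAt hd hdt).prodMk ?_
      exact ((contMDiffAt_extChartAt (I := I) (x := (h t).1.2)).comp_contMDiffWithinAt t
        h2).contDiffWithinAt
    refine h5.congr_of_eventuallyEq ?_ ?_
    · filter_upwards [hsrc] with x hx
      simp only [Ψ, Function.comp, c.coord.left_inv hx]
    · simp only [Ψ, Function.comp, hinv]

end FibreAtlas

section FibreLift

variable {P : Type u} [TopologicalSpace P] [T2Space P] [SecondCountableTopology P]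
  {E₀ : Type*} [NormedAddCommGroup E₀] [InnerProductSpace ℝ E₀]
  {B₀ : Type*} [TopologicalSpace B₀] [ChartedSpace E₀ B₀]
  {E₁ : Type*} [NormedAddCommGroup E₁]
  {B₁ : Type*} [TopologicalSpace B₁] [ChartedSpace E₁ B₁]
  {EZ : Type w} [NormedAddCommGroup EZ] [InnerProductSpace ℝ EZ]
  {HZ : Type*} [TopologicalSpace HZ] {I : ModelWithCorners ℝ EZ HZ} {ℓ : EZ →L[ℝ] ℝ}
  {Z : Type v} [TopologicalSpace Z] [ChartedSpace HZ Z]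
  {SP : LCManifold.{u, w} P} {σ : P → B₀} {f : Z → B₀ × B₁} {q₀ : FibreProduct σ f}
  {L : LocalChart E₀ E₁ I SP σ f q₀.1.1 q₀.1.2} (Q : FibreChart L)

namespace FibreChart

open Classical in
/-- The local parametrization of the fibre product (with a junk value outside `box`). -/
noncomputable def lift (q : Q.K × L.C) : FibreProduct σ f :=
  if h : q ∈ Q.box then
    ⟨L.param (Q.sol q, q.2), (L.G_eq_zero_iff q₀.2 (sol_mem_quadrant h)).1 (G_sol h)⟩
  else q₀

/-- The local coordinates on the fibre product, inverse to `lift`. -/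
noncomputable def toBox (q : FibreProduct σ f) : Q.K × L.C :=
  (Q.κ (L.coordA q.1 - L.base), L.coordS q.1)

/-- The image of `lift`. -/
def tgt : Set (FibreProduct σ f) :=
  {q | q.1 ∈ L.tgt ∧ L.coordA q.1 ∈ Metric.ball L.base Q.ρ ∧
    Q.κ (L.coordA q.1 - L.base) ∈ Metric.ball 0 Q.r ∧ ∀ j, L.coordS q.1 j < Q.δ}

variable {Q}

theorem lift_val {q : Q.K × L.C} (hq : q ∈ Q.box) : (Q.lift q).1 = L.param (Q.sol q, q.2) := by
  rw [lift, dif_pos hq]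

theorem isOpen_tgt : IsOpen Q.tgt := by
  obtain ⟨h1, h2⟩ := L.continuousOn_coord
  have ho := L.isOpen_tgt
  have k1 : IsOpen (L.tgt ∩ L.coordA ⁻¹' (Metric.ball L.base Q.ρ ∩
      (fun a => Q.κ (a - L.base)) ⁻¹' Metric.ball 0 Q.r)) :=
    h1.isOpen_inter_preimage ho (Metric.isOpen_ball.inter
      (Metric.isOpen_ball.preimage (by fun_prop)))
  have k2 : IsOpen (L.tgt ∩ L.coordS ⁻¹' {s | ∀ j, s j < Q.δ}) := by
    refine h2.isOpen_inter_preimage ho ?_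
    simp only [ofPred_forall]
    exact isOpen_iInter_of_finite fun j => isOpen_lt (by fun_prop) continuous_const
  have : Q.tgt = Subtype.val ⁻¹' ((L.tgt ∩ L.coordA ⁻¹' (Metric.ball L.base Q.ρ ∩
      (fun a => Q.κ (a - L.base)) ⁻¹' Metric.ball 0 Q.r)) ∩
      (L.tgt ∩ L.coordS ⁻¹' {s | ∀ j, s j < Q.δ})) := by
    ext q
    exact ⟨fun h => ⟨⟨h.1, h.2.1, h.2.2.1⟩, h.1, h.2.2.2⟩,
      fun h => ⟨h.1.1, h.1.2.1, h.1.2.2, h.2.2⟩⟩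
  rw [this]
  exact (k1.inter k2).preimage continuous_subtype_val

theorem base_mem_tgt : q₀ ∈ Q.tgt := by
  have h1 : L.coordA q₀.1 = L.base := rfl
  refine ⟨L.base_mem_tgt, ?_, ?_, fun j => ?_⟩
  · rw [h1]; exact Metric.mem_ball_self Q.ρ_pos
  · rw [h1, sub_self, map_zero]; exact Metric.mem_ball_self Q.r_pos
  · rw [show L.coordS q₀.1 = 0 from L.coordS_base]; exact Q.δ_pos

theorem toBox_mem {q : FibreProduct σ f} (hq : q ∈ Q.tgt) : Q.toBox q ∈ Q.box :=
  ⟨hq.2.2.1, fun j => ⟨(L.coord_mem hq.1).2 j, hq.2.2.2 j⟩⟩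

theorem sol_toBox {q : FibreProduct σ f} (hq : q ∈ Q.tgt) : Q.sol (Q.toBox q) = L.coordA q.1 := by
  refine sol_κ hq.2.1 (toBox_mem hq).2 ?_ hq.2.2.1
  rw [L.G_eq_zero_iff q₀.2 (L.coord_mem hq.1), L.param_coord hq.1]
  exact q.2

theorem lift_toBox {q : FibreProduct σ f} (hq : q ∈ Q.tgt) : Q.lift (Q.toBox q) = q := by
  refine Subtype.ext ?_
  rw [lift_val (toBox_mem hq), sol_toBox hq]
  exact L.param_coord hq.1

theorem coord_lift {q : Q.K × L.C} (hq : q ∈ Q.box) :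
    L.coordA (Q.lift q).1 = Q.sol q ∧ L.coordS (Q.lift q).1 = q.2 := by
  have h := sol_mem_quadrant hq
  rw [lift_val hq]
  exact ⟨L.coordA_param h.1 h.2, L.coordS_param h.1 h.2⟩

theorem toBox_lift {q : Q.K × L.C} (hq : q ∈ Q.box) : Q.toBox (Q.lift q) = q := by
  obtain ⟨h1, h2⟩ := coord_lift hq
  rw [toBox, h1, h2, κ_sol hq]

theorem lift_mem {q : Q.K × L.C} (hq : q ∈ Q.box) : Q.lift q ∈ Q.tgt := by
  obtain ⟨h1, h2⟩ := coord_lift hq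
  have h := sol_mem_quadrant hq
  refine ⟨?_, ?_, ?_, fun j => ?_⟩
  · rw [lift_val hq]; exact L.param_mem h.1 h.2
  · rw [h1]; exact sol_mem_ball hq
  · rw [h1, κ_sol hq]; exact hq.1
  · rw [h2]; exact (hq.2 j).2

theorem continuousOn_lift : ContinuousOn Q.lift Q.box := by
  refine Topology.IsInducing.subtypeVal.continuousOn_iff.2 ?_
  refine ContinuousOn.congr (f := fun q => L.param (Q.sol q, q.2)) ?_ fun q hq => lift_val hq
  exact L.continuousOn_param.comp (continuousOn_sol.prodMk continuousOn_snd)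
    fun q hq => sol_mem_quadrant hq

theorem continuousOn_toBox : ContinuousOn Q.toBox Q.tgt := by
  obtain ⟨h1, h2⟩ := L.continuousOn_coord
  have k1 : ContinuousOn (fun q : FibreProduct σ f => L.coordA q.1) Q.tgt :=
    h1.comp continuous_subtype_val.continuousOn fun q hq => hq.1
  have k2 : ContinuousOn (fun q : FibreProduct σ f => L.coordS q.1) Q.tgt :=
    h2.comp continuous_subtype_val.continuousOn fun q hq => hq.1
  exact (Q.κ.continuous.comp_continuousOn (k1.sub continuousOn_const)).prodMk k2

/-- The codimension is the number of vanishing corner coordinates. -/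
theorem fibreCodim_lift {q : Q.K × L.C} (hq : q ∈ Q.box) :
    fibreCodim I SP (Q.lift q) = Set.ncard {j | q.2 j = 0} := by
  have h := sol_mem_quadrant hq
  obtain ⟨h1, h2⟩ := L.codim_param h.1 h.2
  rw [fibreCodim, lift_val hq, h1, h2, ← LocalChart.ncard_zero_append]

/-- The stratum of `q₀` is where all corner coordinates vanish: their number is the codimension of
`q₀`. -/
theorem snd_toBox_eq_zero_iff {q : FibreProduct σ f} (hq : q ∈ Q.tgt) :
    (Q.toBox q).2 = 0 ↔ fibreCodim I SP q = fibreCodim I SP q₀ := by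
  have h := fibreCodim_lift (toBox_mem hq)
  rw [lift_toBox hq] at h
  rw [h]
  have hn : fibreCodim I SP q₀ =
      (univ : Set (Fin (SP.codim q₀.1.1 + boundaryCodim I q₀.1.2))).ncard := by
    simp [fibreCodim, Set.ncard_univ]
  rw [hn]
  constructor
  · intro h0
    rw [h0]
    congr 1
    ext j; simp
  · intro h0
    have := Set.eq_of_subset_of_ncard_le (subset_univ {j | (Q.toBox q).2 j = 0}) h0.ge
    ext j
    have hj : j ∈ {j | (Q.toBox q).2 j = 0} := by rw [this]; trivial
    exact hj

variable {T : Type*} [NormedAddCommGroup T] [NormedSpace ℝ T] {s : Set T} {t : T}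

/-- The coordinates are smooth functions on the strata. -/
theorem smooth_toBox [IsManifold I ∞ Z] {h : T → FibreProduct σ f}
    (h1 : StratSmoothAt SP.toStratifiedSpace (fun x => (h x).1.1) s t)
    (h2 : ContMDiffWithinAt 𝓘(ℝ, T) I ∞ (fun x => (h x).1.2) s t) (ht : t ∈ s)
    (htgt : ∀ x ∈ s, h x ∈ Q.tgt) : ContDiffWithinAt ℝ ∞ (fun x => Q.toBox (h x)) s t := by
  obtain ⟨k1, k2⟩ := L.smooth_coord (h := fun x => (h x).1) h1 h2 ht fun x hx => (htgt x hx).1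
  exact (Q.κ.contDiff.comp_contDiffWithinAt (k1.sub contDiffWithinAt_const)).prodMk k2

/-- `lift` is smooth where the set of vanishing corner coordinates is constant. -/
theorem smooth_lift [CompleteSpace E₀] [IsManifold I ∞ Z] [IsManifold 𝓘(ℝ, E₀) ∞ B₀]
    (hσ : IsLCSmooth E₀ SP σ)
    (hf : ContMDiff I 𝓘(ℝ, E₀) ∞ fun z => (f z).1) {k : T → Q.K × L.C}
    (hk : ContDiffWithinAt ℝ ∞ k s t) (ht : t ∈ s) (hbox : ∀ x ∈ s, k x ∈ Q.box)
    (hz : ∀ x ∈ s, ∀ j, (k x).2 j = 0 ↔ (k t).2 j = 0) :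
    StratSmoothAt SP.toStratifiedSpace (fun x => (Q.lift (k x)).1.1) s t ∧
      ContMDiffWithinAt 𝓘(ℝ, T) I ∞ (fun x => (Q.lift (k x)).1.2) s t := by
  have h1 : ContDiffWithinAt ℝ ∞ (fun x => (Q.sol (k x), (k x).2)) s t :=
    (ContDiffWithinAt.comp (g := Q.sol) (f := k) t (contDiffWithinAt_sol hσ hf (hbox t ht)) hk
      fun x hx => ⟨hbox x hx, hz x hx⟩).prodMk hk.snd
  obtain ⟨h2, h3⟩ := L.smooth_param h1 ht (fun x hx => (sol_mem_quadrant (hbox x hx)).1)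
    (fun x hx => (sol_mem_quadrant (hbox x hx)).2) hz
  exact ⟨h2.congr (fun x hx => by rw [lift_val (hbox x hx)]) (by rw [lift_val (hbox t ht)]),
    h3.congr (fun x hx => by rw [lift_val (hbox x hx)]) (by rw [lift_val (hbox t ht)])⟩

theorem mk_zero_mem_box {k : Q.K} (hk : k ∈ Metric.ball 0 Q.r) : (k, 0) ∈ Q.box :=
  ⟨hk, zero_mem_cube Q.δ_pos⟩

/-- The tangent space of the stratum of the fibre product is the fibre product of the tangent
spaces: in the coordinates of `P × Z` it is the kernel of `DG`, which `Dsol` parametrizes. -/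
theorem tangent_lift [CompleteSpace E₀] [CompleteSpace EZ] [IsManifold I ∞ Z]
    [IsManifold 𝓘(ℝ, E₀) ∞ B₀] (hI : range I = {v | 0 ≤ ℓ v}) (hσ : IsLCSmooth E₀ SP σ)
    (hf : ContMDiff I 𝓘(ℝ, E₀) ∞ fun z => (f z).1) {k : Q.K} (hk : k ∈ Metric.ball 0 Q.r) {i : ℕ}
    {d : HilbertChart.{u, w} {p | SP.codim p = i}} (hd : d ∈ SP.atlas i)
    (hds : (Q.lift (k, 0)).1.1 ∈ d.coord.source) {D : Q.K →L[ℝ] d.E × EZ}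
    (hD : D = (fderiv ℝ (fun k => d.coord (Q.lift (k, 0)).1.1) k).prod
      (mfderiv 𝓘(ℝ, Q.K) I (fun k => (Q.lift (k, 0)).1.2) k)) :
    Function.Injective D ∧
      range D = {t | (I.IsBoundaryPoint (Q.lift (k, 0)).1.2 → ℓ t.2 = 0) ∧
        diff E₀ d σ (Q.lift (k, 0)).1.1 t.1 = diff₀ I E₀ f (Q.lift (k, 0)).1.2 t.2} := by
  have hbox := mk_zero_mem_box hk
  have hev : ∀ᶠ k' in 𝓝 k, (Q.lift (k', 0)).1 = L.param (Q.sol (k', 0), 0) := by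
    filter_upwards [Metric.isOpen_ball.mem_nhds hk] with k' hk'
    exact lift_val (mk_zero_mem_box hk')
  have hdom := (sol_mem_quadrant hbox).1
  have hsol := hasFDerivAt_sol hσ hf hbox
  obtain ⟨hs1, hs2⟩ := L.smooth_param_zero hdom
  have hlift := lift_val hbox
  rw [hlift] at hds ⊢
  let Θ : L.A →L[ℝ] d.E × EZ :=
    (fderiv ℝ (fun a => d.coord (L.param (a, 0)).1) (Q.sol (k, 0))).prod
      (mfderiv 𝓘(ℝ, L.A) I (fun a => (L.param (a, 0)).2) (Q.sol (k, 0)))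
  obtain ⟨hΘi, hΘr⟩ := L.tangent_param hI hdom hd hds (Θ := Θ) rfl
  obtain ⟨M, hM⟩ := L.exists_DG_eq hσ hf q₀.2 hdom (G_sol hbox) hd hds (Θ := Θ) rfl
  have hDΘ : D = Θ ∘L Q.Dsol (k, 0) := by
    rw [hD]
    have e1 : fderiv ℝ (fun k => d.coord (Q.lift (k, 0)).1.1) k =
        fderiv ℝ (fun a => d.coord (L.param (a, 0)).1) (Q.sol (k, 0)) ∘L Q.Dsol (k, 0) := by
      have h1 : HasFDerivAt (fun a => d.coord (L.param (a, 0)).1) _ (Q.sol (k, 0)) :=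
        (((hs1.contDiffWithinAt hd hds).contDiffAt univ_mem).differentiableAt
          (by simp)).hasFDerivAt
      have h2 := HasFDerivAt.comp k (f := fun k => Q.sol (k, 0)) h1 hsol
      refine (Filter.EventuallyEq.fderiv_eq ?_).trans h2.fderiv
      filter_upwards [hev] with k' hk'
      simp only [hk', Function.comp]
    have e2 : (mfderiv 𝓘(ℝ, Q.K) I (fun k => (Q.lift (k, 0)).1.2) k : Q.K →L[ℝ] EZ) =
        (mfderiv 𝓘(ℝ, L.A) I (fun a => (L.param (a, 0)).2) (Q.sol (k, 0)) : L.A →L[ℝ] EZ) ∘L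
          Q.Dsol (k, 0) := by
      have h1 := (hs2.mdifferentiableAt (by simp)).hasMFDerivAt
      have h2 := HasMFDerivAt.comp k (f := fun k => Q.sol (k, 0)) h1 hsol.hasMFDerivAt
      have h3 : HasMFDerivAt 𝓘(ℝ, Q.K) I (fun k => (Q.lift (k, 0)).1.2) k _ :=
        h2.congr_of_eventuallyEq (by
          filter_upwards [hev] with k' hk'
          simp only [hk', Function.comp])
      exact h3.mfderiv
    exact congrArg₂ ContinuousLinearMap.prod e1 e2
  obtain ⟨N, hN⟩ := Q.invertible _ (sol_mem_ball hbox) _ hbox.2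
  have hDs : ∀ v, Q.κ (Q.Dsol (k, 0) v) = v ∧ L.DG (Q.sol (k, 0), 0) (Q.Dsol (k, 0) v) = 0 := by
    intro v
    have h1 : (Q.κ.prod (L.DG (Q.sol (k, 0), 0))) (Q.Dsol (k, 0) v) = (v, 0) := by
      rw [Dsol, ← hN, ContinuousLinearMap.inverse_equiv]
      simp
    exact ⟨congrArg Prod.fst h1, congrArg Prod.snd h1⟩
  constructor
  · rw [hDΘ]
    intro v v' h
    have : Q.Dsol (k, 0) v = Q.Dsol (k, 0) v' := hΘi h
    exact (hDs v).1.symm.trans ((congrArg Q.κ this).trans (hDs v').1)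
  · ext τ
    constructor
    · rintro ⟨v, rfl⟩
      rw [hDΘ]
      have h1 : Θ (Q.Dsol (k, 0) v) ∈ range Θ := mem_range_self _
      rw [hΘr] at h1
      have h2 := hM (Q.Dsol (k, 0) v)
      rw [(hDs v).2] at h2
      exact ⟨h1, sub_eq_zero.1 (M.map_eq_zero_iff.1 h2.symm)⟩
    · rintro ⟨h1, h2⟩
      have h3 : τ ∈ range Θ := by rw [hΘr]; exact h1
      obtain ⟨α, rfl⟩ := h3
      refine ⟨Q.κ α, ?_⟩
      rw [hDΘ]
      change Θ (Q.Dsol (k, 0) (Q.κ α)) = Θ α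
      congr 1
      have h4 := hM α
      rw [sub_eq_zero.2 h2, map_zero] at h4
      apply N.injective
      have hNa : ∀ β, N β = (Q.κ β, L.DG (Q.sol (k, 0), 0) β) := fun β =>
        DFunLike.congr_fun hN β
      rw [hNa, hNa, (hDs _).1, (hDs _).2, h4]

end FibreChart

end FibreLift

/-! ### The lc-structure of the fibre product -/

section FibreLC

variable {P : Type u} [TopologicalSpace P] [T2Space P] [SecondCountableTopology P]
  {E₀ : Type*} [NormedAddCommGroup E₀] [InnerProductSpace ℝ E₀]
  {B₀ : Type*} [TopologicalSpace B₀] [ChartedSpace E₀ B₀]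
  {E₁ : Type*} [NormedAddCommGroup E₁]
  {B₁ : Type*} [TopologicalSpace B₁] [ChartedSpace E₁ B₁]
  {EZ : Type w} [NormedAddCommGroup EZ] [InnerProductSpace ℝ EZ]
  {HZ : Type*} [TopologicalSpace HZ] {I : ModelWithCorners ℝ EZ HZ} {ℓ : EZ →L[ℝ] ℝ}
  {Z : Type v} [TopologicalSpace Z] [ChartedSpace HZ Z]
  {SP : LCManifold.{u, w} P} {σ : P → B₀} {f : Z → B₀ × B₁} {q₀ : FibreProduct σ f}
  {L : LocalChart E₀ E₁ I SP σ f q₀.1.1 q₀.1.2} (Q : FibreChart L)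

namespace FibreChart

/-- The chart of the stratum of `q₀`, with coordinate `k`; its inverse is `k ↦ lift (k, 0)`. -/
noncomputable def stratumChart :
    HilbertChart.{max u v, w} {q : FibreProduct σ f | fibreCodim I SP q = fibreCodim I SP q₀} where
  E := Q.K
  coord :=
    { toFun := fun q => (Q.toBox q).1
      invFun := fun k => Q.lift (k, 0)
      source := Q.tgt ∩ {q | fibreCodim I SP q = fibreCodim I SP q₀}
      target := Metric.ball 0 Q.r
      map_source' := fun _ hq => (toBox_mem hq.1).1
      map_target' := fun k hk => by
        have h := lift_mem (mk_zero_mem_box hk)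
        refine ⟨h, (snd_toBox_eq_zero_iff h).1 ?_⟩
        rw [toBox_lift (mk_zero_mem_box hk)]
      left_inv' := fun q hq => by
        have h := (snd_toBox_eq_zero_iff hq.1).2 hq.2
        have h2 := lift_toBox hq.1
        rw [← h2]
        congr 1
        rw [h2]
        exact Prod.ext rfl h.symm
      right_inv' := fun k hk => by rw [toBox_lift (mk_zero_mem_box hk)] }
  source_eq := ⟨Q.tgt, isOpen_tgt, rfl⟩
  isOpen_target := Metric.isOpen_ball
  continuousOn := (continuousOn_toBox.mono inter_subset_left).fst
  continuousOn_symm := continuousOn_lift.comp (by fun_prop) fun _ hk => mk_zero_mem_box hk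

theorem base_mem_stratumChart : q₀ ∈ Q.stratumChart.coord.source := ⟨base_mem_tgt, rfl⟩

theorem stratumChart_mem_fibreAtlas [CompleteSpace E₀] [IsManifold 𝓘(ℝ, E₀) ∞ B₀]
    [CompleteSpace EZ] [IsManifold I ∞ Z] (hI : range I = {v | 0 ≤ ℓ v}) (hσ : IsLCSmooth E₀ SP σ)
    (hf : ContMDiff I 𝓘(ℝ, E₀) ∞ fun z => (f z).1) :
    Q.stratumChart ∈ fibreAtlas E₀ I ℓ SP (fibreCodim I SP q₀) := by
  have hsm : ∀ k ∈ Metric.ball (0 : Q.K) Q.r,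
      StratSmoothAt SP.toStratifiedSpace (fun k => (Q.lift (k, 0)).1.1) (Metric.ball 0 Q.r) k ∧
      ContMDiffWithinAt 𝓘(ℝ, Q.K) I ∞ (fun k => (Q.lift (k, 0)).1.2) (Metric.ball 0 Q.r) k :=
    fun k hk => smooth_lift (k := fun k : Q.K => (k, (0 : L.C))) hσ hf (by fun_prop) hk
      (fun _ h => mk_zero_mem_box h) fun _ _ _ => Iff.rfl
  refine ⟨fun i d hd e he => ?_, fun e he => (hsm e he).2, fun q hq d hd hqd => ?_⟩
  · exact ((hsm e he.1).1.contDiffWithinAt hd he.2).mono fun _ h => h.1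
  · have hk : (Q.toBox q).1 ∈ Metric.ball (0 : Q.K) Q.r := (toBox_mem hq.1).1
    have hqk : Q.lift ((Q.toBox q).1, 0) = q := Q.stratumChart.coord.left_inv hq
    -- the point `lift (k, 0)` is replaced by a variable, on which the type of `d` depends
    have key : ∀ q' : FibreProduct σ f, Q.lift ((Q.toBox q).1, 0) = q' → ∀ i,
        ∀ d : HilbertChart.{u, w} {p | SP.codim p = i}, d ∈ SP.atlas i →
        q'.1.1 ∈ d.coord.source → ∀ D : Q.K →L[ℝ] d.E × EZ,
        D = (fderiv ℝ (fun k => d.coord (Q.lift (k, 0)).1.1) (Q.toBox q).1).prod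
          (mfderiv 𝓘(ℝ, Q.K) I (fun k => (Q.lift (k, 0)).1.2) (Q.toBox q).1) →
        Function.Injective D ∧ range D = {t | (I.IsBoundaryPoint q'.1.2 → ℓ t.2 = 0) ∧
          diff E₀ d σ q'.1.1 t.1 = diff₀ I E₀ f q'.1.2 t.2} := by
      rintro _ rfl i d hd hds D hD
      exact tangent_lift hI hσ hf hk hd hds hD
    exact key q hqk _ d hd hqd _ rfl

end FibreChart

variable [CompleteSpace E₀] [IsManifold 𝓘(ℝ, E₀) ∞ B₀] [CompleteSpace EZ] [IsManifold I ∞ Z]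
  [T2Space Z] [SecondCountableTopology Z]

variable (I) in
/-- The stratification of the fibre product, provided that each point lies in a chart of
`fibreAtlas`. -/
noncomputable def fibreStratified (ℓ : EZ →L[ℝ] ℝ) (SP : LCManifold.{u, w} P) (σ : P → B₀)
    (f : Z → B₀ × B₁)
    (hQ : ∀ q : FibreProduct σ f, ∃ c ∈ fibreAtlas E₀ I ℓ SP (fibreCodim I SP q),
      q ∈ c.coord.source) :
    StratifiedSpace.{max u v, w} (FibreProduct σ f) where
  codim := fibreCodim I SP
  isClosed_stratum i := by
    rw [← isOpen_compl_iff, isOpen_iff_mem_nhds]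
    intro q hq
    filter_upwards [eventually_fibreCodim_le (I := I) (SP := SP) q] with q' hq'
    simp only [mem_compl_iff, mem_ofPred_eq, fibreCodim] at hq ⊢
    omega
  finite_depth := by
    obtain ⟨k, hk⟩ := SP.finite_depth
    refine ⟨k + 1, fun q => add_le_add (hk _) ?_⟩
    unfold boundaryCodim
    split_ifs <;> simp
  atlas := fibreAtlas E₀ I ℓ SP
  exists_chart := hQ
  compatible i c hc d hd e he := by
    obtain ⟨h1, h2⟩ := smooth_symm_of_mem_fibreAtlas hc he.1
    refine (contDiffWithinAt_of_mem_fibreAtlas hd h1 h2 ?_ he.2).mono inter_subset_left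
    filter_upwards [self_mem_nhdsWithin] with e' he'
    obtain ⟨U, -, hU⟩ := c.source_eq
    have := c.coord.map_target he'
    rw [hU] at this
    exact this.2

namespace FibreChart

variable {hQ : ∀ q : FibreProduct σ f, ∃ c ∈ fibreAtlas E₀ I ℓ SP (fibreCodim I SP q),
  q ∈ c.coord.source}

/-- The lc-chart about `q₀`: a point `v` of the stratum with coordinates `(k, 0)` and corner
coordinates `s` are mapped to the point with coordinates `(k, s)`. -/
noncomputable def lcChart (hσ : IsLCSmooth E₀ SP σ)
    (hf : ContMDiff I 𝓘(ℝ, E₀) ∞ fun z => (f z).1) :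
    LCChart (fibreStratified I ℓ SP σ f hQ) (fibreCodim I SP q₀) where
  V := Q.tgt ∩ {q | fibreCodim I SP q = fibreCodim I SP q₀}
  ε := Q.δ
  map :=
    { toFun := fun q => Q.lift ((Q.toBox q.1).1, q.2)
      invFun := fun q => (Q.lift ((Q.toBox q).1, 0), (Q.toBox q).2)
      source := (Q.tgt ∩ {q | fibreCodim I SP q = fibreCodim I SP q₀}) ×ˢ
        cube (fibreCodim I SP q₀) Q.δ
      target := Q.tgt
      map_source' := fun q hq => lift_mem ⟨(toBox_mem hq.1.1).1, hq.2⟩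
      map_target' := fun q hq =>
        ⟨Q.stratumChart.coord.map_target (toBox_mem hq).1, (toBox_mem hq).2⟩
      left_inv' := fun q hq => by
        have h : ((Q.toBox q.1).1, q.2) ∈ Q.box := ⟨(toBox_mem hq.1.1).1, hq.2⟩
        rw [toBox_lift h]
        exact Prod.ext (Q.stratumChart.coord.left_inv hq.1) rfl
      right_inv' := fun q hq => by
        have h := mk_zero_mem_box (toBox_mem hq).1
        simp only [toBox_lift h]
        exact lift_toBox hq }
  isOpen_V := ⟨Q.tgt, isOpen_tgt, rfl⟩
  ε_pos := Q.δ_pos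
  source_eq := rfl
  isOpen_target := isOpen_tgt
  continuousOn := by
    refine continuousOn_lift.comp (ContinuousOn.prodMk ?_ continuousOn_snd)
      fun q hq => ⟨(toBox_mem hq.1.1).1, hq.2⟩
    exact (continuousOn_toBox.fst).comp continuousOn_fst fun q hq => hq.1.1
  continuousOn_symm := by
    refine ContinuousOn.prodMk ?_ continuousOn_toBox.snd
    exact continuousOn_lift.comp (continuousOn_toBox.fst.prodMk continuousOn_const)
      fun q hq => mk_zero_mem_box (toBox_mem hq).1
  map_zero v hv := Q.stratumChart.coord.left_inv hv
  codim_map v hv s hs := fibreCodim_lift (q := ((Q.toBox v).1, s)) ⟨(toBox_mem hv.1).1, hs⟩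
  smooth c hc m d hd := by
    rintro q ⟨hq1, hq2, hq3⟩
    set X : Set (c.E × (Fin (fibreCodim I SP q₀) → ℝ)) := {q | q.1 ∈ c.coord.target ∧
      (c.coord.symm q.1, q.2) ∈ (Q.tgt ∩ {q | fibreCodim I SP q = fibreCodim I SP q₀}) ×ˢ
        cube (fibreCodim I SP q₀) Q.δ ∧
      Q.lift ((Q.toBox (c.coord.symm q.1)).1, q.2) ∈ d.coord.source} with hX
    have hqX : q ∈ X := ⟨hq1, hq2, hq3⟩
    have hbox : ∀ x ∈ X, ((Q.toBox (c.coord.symm x.1)).1, x.2) ∈ Q.box := fun x hx =>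
      ⟨(toBox_mem hx.2.1.1.1).1, hx.2.1.2⟩
    have hcod : ∀ x ∈ X, Set.ncard {j | x.2 j = 0} = m := fun x hx => by
      have h1 := fibreCodim_lift (hbox x hx)
      have h2 := d.codim_eq hx.2.2
      exact h1.symm.trans h2
    -- near `q` no new corner coordinates vanish, and on `X` their number is `m`, so the set of
    -- vanishing corner coordinates is constant
    have hO : ∀ᶠ x in 𝓝[X] q, x ∈ X ∧ ∀ j, x.2 j = 0 ↔ q.2 j = 0 := by
      have h1 : ∀ j, ∀ᶠ x : c.E × (Fin (fibreCodim I SP q₀) → ℝ) in 𝓝 q, x.2 j = 0 → q.2 j = 0 :=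
        fun j => by
          by_cases h : q.2 j = 0
          · exact Eventually.of_forall fun _ _ => h
          · have hc : ContinuousAt (fun x : c.E × (Fin (fibreCodim I SP q₀) → ℝ) => x.2 j) q := by
              fun_prop
            filter_upwards [hc.eventually_ne h] with x hx hx' using absurd hx' hx
      filter_upwards [self_mem_nhdsWithin, nhdsWithin_le_nhds (eventually_all.2 h1)] with x hx h2
      refine ⟨hx, fun j => ⟨h2 j, fun hj => ?_⟩⟩
      have h3 := Set.eq_of_subset_of_ncard_le (s := {j | x.2 j = 0}) (t := {j | q.2 j = 0})
        (fun j => h2 j) (by rw [hcod x hx, hcod q hqX])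
      have : j ∈ {j | q.2 j = 0} := hj
      rwa [← h3] at this
    set X' : Set (c.E × (Fin (fibreCodim I SP q₀) → ℝ)) :=
      {x | x ∈ X ∧ ∀ j, x.2 j = 0 ↔ q.2 j = 0} with hX'
    have hqX' : q ∈ X' := ⟨hqX, fun _ => Iff.rfl⟩
    obtain ⟨h1, h2⟩ := smooth_symm_of_mem_fibreAtlas (I := I) (SP := SP) hc hq1
    have hfst : ContDiffWithinAt ℝ ∞ (fun x : c.E × (Fin (fibreCodim I SP q₀) → ℝ) => x.1) X' q :=
      contDiffWithinAt_fst
    have h3 := h1.comp (k := fun x : c.E × (Fin (fibreCodim I SP q₀) → ℝ) => x.1) hfst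
      fun x hx => hx.1.1
    have h4 := ContMDiffWithinAt.comp (f := fun x : c.E × (Fin (fibreCodim I SP q₀) → ℝ) => x.1) q
      h2 hfst.contMDiffWithinAt fun x hx => hx.1.1
    have h5 := smooth_toBox (Q := Q) h3 h4 hqX' fun x hx => hx.1.2.1.1.1
    obtain ⟨h6, h7⟩ := smooth_lift (Q := Q) (k := fun x : c.E × (Fin (fibreCodim I SP q₀) → ℝ) =>
      ((Q.toBox (c.coord.symm x.1)).1, x.2)) hσ hf (h5.fst.prodMk contDiffWithinAt_snd) hqX'
      (fun x hx => hbox x hx.1) fun x hx => hx.2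
    have h8 := contDiffWithinAt_of_mem_fibreAtlas (I := I) (SP := SP) hd h6 h7 (by
      filter_upwards [self_mem_nhdsWithin] with x hx
      exact d.codim_eq hx.1.2.2) hq3
    exact h8.mono_of_mem_nhdsWithin hO
  smooth_symm c hc m d hd := by
    rintro e ⟨he1, he2, he3⟩
    set X : Set d.E := {e | e ∈ d.coord.target ∧ d.coord.symm e ∈ Q.tgt ∧
      Q.lift ((Q.toBox (d.coord.symm e)).1, 0) ∈ c.coord.source} with hX
    have heX : e ∈ X := ⟨he1, he2, he3⟩
    obtain ⟨h1, h2⟩ := smooth_symm_of_mem_fibreAtlas (I := I) (SP := SP) hd he1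
    have h3 := smooth_toBox (Q := Q) (h1.mono_of_mem_nhdsWithin (s := X)
      (mem_of_superset self_mem_nhdsWithin fun x hx => hx.1)) (h2.mono fun x hx => hx.1) heX
      fun x hx => hx.2.1
    obtain ⟨h4, h5⟩ := smooth_lift (Q := Q) (k := fun x => ((Q.toBox (d.coord.symm x)).1, 0)) hσ hf
      (h3.fst.prodMk contDiffWithinAt_const) heX
      (fun x hx => mk_zero_mem_box (toBox_mem hx.2.1).1) fun _ _ _ => Iff.rfl
    refine ContDiffWithinAt.prodMk ?_ h3.snd
    refine contDiffWithinAt_of_mem_fibreAtlas (I := I) (SP := SP) hc h4 h5 ?_ he3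
    filter_upwards [self_mem_nhdsWithin] with x hx
    exact c.codim_eq hx.2.2

end FibreChart

end FibreLC

section FibreSmooth

variable {P : Type u} [TopologicalSpace P] [T2Space P] [SecondCountableTopology P]
  {E₀ : Type*} [NormedAddCommGroup E₀] [InnerProductSpace ℝ E₀] [CompleteSpace E₀]
  {B₀ : Type*} [TopologicalSpace B₀] [ChartedSpace E₀ B₀] [IsManifold 𝓘(ℝ, E₀) ∞ B₀]
  {E₁ : Type*} [NormedAddCommGroup E₁]
  {B₁ : Type*} [TopologicalSpace B₁] [ChartedSpace E₁ B₁]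
  {EZ : Type w} [NormedAddCommGroup EZ] [InnerProductSpace ℝ EZ] [CompleteSpace EZ]
  {HZ : Type*} [TopologicalSpace HZ] {I : ModelWithCorners ℝ EZ HZ} {ℓ : EZ →L[ℝ] ℝ}
  {Z : Type v} [TopologicalSpace Z] [ChartedSpace HZ Z] [IsManifold I ∞ Z]
  [T2Space Z] [SecondCountableTopology Z]
  {SP : LCManifold.{u, w} P} {σ : P → B₀} {f : Z → B₀ × B₁}

variable (I) in
/-- The lc-structure of the fibre product, provided that each point lies in a `FibreChart`. -/
noncomputable def fibreLC (hI : range I = {v | 0 ≤ ℓ v}) (hσ : IsLCSmooth E₀ SP σ)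
    (hf : ContMDiff I 𝓘(ℝ, E₀) ∞ fun z => (f z).1)
    (hQ : ∀ q : FibreProduct σ f, ∃ L : LocalChart E₀ E₁ I SP σ f q.1.1 q.1.2,
      Nonempty (FibreChart L)) : LCManifold.{max u v, w} (FibreProduct σ f) where
  toStratifiedSpace := fibreStratified (E₀ := E₀) I ℓ SP σ f fun q => by
    obtain ⟨L, ⟨Q⟩⟩ := hQ q
    exact ⟨Q.stratumChart, Q.stratumChart_mem_fibreAtlas hI hσ hf, Q.base_mem_stratumChart⟩
  exists_lcChart q := by
    obtain ⟨L, ⟨Q⟩⟩ := hQ q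
    exact ⟨Q.lcChart hσ hf, Q.base_mem_stratumChart⟩

variable {hI : range I = {v | 0 ≤ ℓ v}} {hσ : IsLCSmooth E₀ SP σ}
  {hf : ContMDiff I 𝓘(ℝ, E₀) ∞ fun z => (f z).1}
  {hQ : ∀ q : FibreProduct σ f, ∃ L : LocalChart E₀ E₁ I SP σ f q.1.1 q.1.2,
    Nonempty (FibreChart L)}

theorem isInducedStructure_fibreLC :
    IsInducedStructure (E₀ := E₀) I ℓ SP σ f (fibreLC I hI hσ hf hQ) where
  codim_eq _ := rfl
  smooth_fst _ _ hc := hc.1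
  smooth_snd _ _ hc := hc.2.1
  tangent _ _ hc := hc.2.2

/-- In the coordinates `(k, s)` the map is `(k, s) ↦ f₁ (zLin (sol (k, s), s))`. Here `f₁` and
`zLin` are smooth, `sol` is smooth in `k`, and its first derivative in `k` is continuous in `(k,
s)`. -/
theorem isLCSmooth_fibreMap [InnerProductSpace ℝ E₁] [IsManifold 𝓘(ℝ, E₁) ∞ B₁]
    (hf₁ : ContMDiff I 𝓘(ℝ, E₁) ∞ fun z => (f z).2) :
    IsLCSmooth E₁ (fibreLC I hI hσ hf hQ) (fibreMap σ f) where
  continuous := hf₁.continuous.comp (continuous_snd.comp continuous_subtype_val)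
  smooth_stratum i c hc := hf₁.comp_contMDiffOn hc.2.1
  smooth_lcChart q₀ := by
    obtain ⟨L, ⟨Q⟩⟩ := hQ q₀
    have himage : ((fun q => (Q.toBox q).1) ''
        (Q.tgt ∩ {q | fibreCodim I SP q = fibreCodim I SP q₀}) : Set Q.K) = Metric.ball 0 Q.r :=
      Q.stratumChart.coord.image_source_eq_target
    have heq : ∀ s ∈ cube (fibreCodim I SP q₀) Q.δ, ∀ k ∈ Metric.ball (0 : Q.K) Q.r,
        extChartAt 𝓘(ℝ, E₁) (fibreMap σ f q₀)
          (fibreMap σ f (Q.lift ((Q.toBox (Q.lift (k, 0))).1, s))) =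
        L.f₁ (L.zLin (Q.sol (k, s), s)) := fun s hs k hk => by
      have h1 : (k, s) ∈ Q.box := ⟨hk, hs⟩
      rw [FibreChart.toBox_lift (FibreChart.mk_zero_mem_box hk), fibreMap, fibreMap,
        FibreChart.lift_val h1]
      rfl
    have hzDom : ∀ q ∈ Q.box, L.zLin (Q.sol q, q.2) ∈ L.zDom := fun q hq =>
      have h := FibreChart.sol_mem_quadrant hq
      ⟨L.zLin_mem_target h.1 h.2, h.1.2.2⟩
    have hsmooth : ∀ s ∈ cube (fibreCodim I SP q₀) Q.δ,
        ContDiffOn ℝ ∞ (fun k => extChartAt 𝓘(ℝ, E₁) (fibreMap σ f q₀)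
        (fibreMap σ f (Q.lift ((Q.toBox (Q.lift (k, 0))).1, s)))) (Metric.ball 0 Q.r) := by
      intro s hs
      refine ContDiffOn.congr ?_ (heq s hs)
      intro k hk
      have hks : ContDiffWithinAt ℝ ∞ (fun k : Q.K => (k, (s : L.C))) (Metric.ball 0 Q.r) k := by
        fun_prop
      have h1 : ContDiffWithinAt ℝ ∞ (fun k => Q.sol (k, s)) (Metric.ball 0 Q.r) k :=
        ContDiffWithinAt.comp (g := Q.sol) (f := fun k : Q.K => (k, s)) k
          (FibreChart.contDiffWithinAt_sol hσ hf (q := (k, s)) ⟨hk, hs⟩) hks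
          fun k' hk' => ⟨⟨hk', hs⟩, fun _ => Iff.rfl⟩
      exact ContDiffWithinAt.comp (g := L.f₁) (f := fun k => L.zLin (Q.sol (k, s), s)) k
        (L.contDiffOn_f₁ hf₁ _ (hzDom (k, s) ⟨hk, hs⟩))
        (L.zLin.contDiff.comp_contDiffWithinAt (h1.prodMk contDiffWithinAt_const))
        fun k' hk' => hzDom (k', s) ⟨hk', hs⟩
    have hderiv : ContinuousOn (fun q : Q.K × L.C =>
        fderiv ℝ (fun k => extChartAt 𝓘(ℝ, E₁) (fibreMap σ f q₀)
          (fibreMap σ f (Q.lift ((Q.toBox (Q.lift (k, 0))).1, q.2)))) q.1)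
        (Metric.ball 0 Q.r ×ˢ cube (fibreCodim I SP q₀) Q.δ) := by
      have hcont : ContinuousOn (fun q : Q.K × L.C =>
          (fderivWithin ℝ L.f₁ L.zDom (L.zLin (Q.sol q, q.2)) ∘L L.zLin ∘L .inl ℝ L.A L.C) ∘L
            Q.Dsol q) Q.box := by
        refine ContinuousOn.clm_comp ?_ (FibreChart.continuousOn_Dsol hf)
        exact (L.continuousOn_fderivWithin_zLin (L.contDiffOn_f₁ hf₁)).comp
          (f := fun q : Q.K × L.C => (Q.sol q, q.2))
          (FibreChart.continuousOn_sol.prodMk continuousOn_snd)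
          fun q hq => FibreChart.sol_mem_quadrant hq
      refine hcont.congr fun q hq => ?_
      have h1 := L.hasFDerivAt_comp_zLin (L.contDiffOn_f₁ hf₁) (FibreChart.sol_mem_quadrant hq)
      have h2 := HasFDerivAt.comp q.1 (f := fun k => Q.sol (k, q.2)) h1
        (FibreChart.hasFDerivAt_sol hσ hf hq)
      refine (Filter.EventuallyEq.fderiv_eq ?_).trans h2.fderiv
      filter_upwards [Metric.isOpen_ball.mem_nhds hq.1] with k hk
      exact heq q.2 hq.2 k hk
    rw [← himage] at hsmooth hderiv
    refine ⟨Q.lcChart hσ hf, Q.stratumChart, Q.stratumChart_mem_fibreAtlas hI hσ hf,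
      Q.base_mem_stratumChart, le_rfl, fun q hq => ?_, hsmooth, hderiv⟩
    have hq' : q.1 ∈ L.tgt := (show q ∈ Q.tgt from hq).1
    have := (L.f_source _ hq'.2.2 ((extChartAt I q₀.1.2).map_source hq'.2.1)).2
    rwa [(extChartAt I q₀.1.2).left_inv hq'.2.1] at this

end FibreSmooth

/-! ### The chain axioms -/

section ChainAxioms

/-- It suffices to extract subsequences from sequences in `s`, rather than in its closure. -/
theorem isCompact_closure_of_subseq {X : Type*} [PseudoMetricSpace X] {s : Set X}
    (h : ∀ y : ℕ → X, (∀ n, y n ∈ s) → ∃ φ : ℕ → ℕ, StrictMono φ ∧ ∃ a,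
      Tendsto (y ∘ φ) atTop (𝓝 a)) : IsCompact (closure s) := by
  refine IsSeqCompact.isCompact fun x hx => ?_
  have h1 : ∀ n : ℕ, ∃ y ∈ s, dist (x n) y < 1 / ((n : ℝ) + 1) := fun n =>
    Metric.mem_closure_iff.1 (hx n) _ Nat.one_div_pos_of_nat
  choose y hy hxy using h1
  obtain ⟨φ, hφ, a, ha⟩ := h y hy
  refine ⟨a, mem_closure_of_tendsto ha (Eventually.of_forall fun n => hy _), φ, hφ, ?_⟩
  have h2 : Tendsto (fun n => dist ((x ∘ φ) n) ((y ∘ φ) n)) atTop (𝓝 0) :=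
    squeeze_zero (fun _ => dist_nonneg) (fun n => (hxy (φ n)).le)
      (tendsto_one_div_add_atTop_nhds_zero_nat.comp hφ.tendsto_atTop)
  exact (tendsto_iff_of_dist h2).2 ha

theorem FloerSpace.WeakTendsto.comp {E : Type*} [NormedAddCommGroup E] [InnerProductSpace ℝ E]
    {B : Type*} [TopologicalSpace B] [ChartedSpace E B] [IsManifold 𝓘(ℝ, E) ∞ B]
    {F : FloerSpace E B} {u : ℕ → B} {y : B} (hu : F.WeakTendsto u y) {φ : ℕ → ℕ}
    (hφ : StrictMono φ) : F.WeakTendsto (fun n => u (φ n)) y :=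
  Tendsto.comp hu hφ.tendsto_atTop

variable {P : Type u} [TopologicalSpace P] [T2Space P] [SecondCountableTopology P]
  {E₀ : Type*} [NormedAddCommGroup E₀] [InnerProductSpace ℝ E₀]
  {B₀ : Type*} [TopologicalSpace B₀] [ChartedSpace E₀ B₀] [IsManifold 𝓘(ℝ, E₀) ∞ B₀]
  {E₁ : Type*} [NormedAddCommGroup E₁] [InnerProductSpace ℝ E₁]
  {B₁ : Type*} [TopologicalSpace B₁] [ChartedSpace E₁ B₁] [IsManifold 𝓘(ℝ, E₁) ∞ B₁]
  {EZ : Type w} [NormedAddCommGroup EZ] [InnerProductSpace ℝ EZ]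
  {HZ : Type*} [TopologicalSpace HZ] {I : ModelWithCorners ℝ EZ HZ} {ℓ : EZ →L[ℝ] ℝ}
  {Z : Type v} [TopologicalSpace Z] [ChartedSpace HZ Z]
  {SP : LCManifold.{u, w} P} {σ : P → B₀} {f : Z → B₀ × B₁}
  {F₀ : FloerSpace E₀ B₀} {F₁ : FloerSpace E₁ B₁}

theorem csd_fibreMap_bddBelow (hσ : IsChain SP F₀ σ) (hf : IsCorrespondence I ℓ F₀ F₁ f) :
    ∃ C, ∀ q, C ≤ F₁.csd (fibreMap σ f q) := by
  obtain ⟨C, hC⟩ := hσ.bddBelow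
  obtain ⟨C', hC'⟩ := hf.bddBelow
  refine ⟨C' + C, fun q => ?_⟩
  have h1 := hC q.1.1
  have h2 := hC' q.1.2
  rw [q.2] at h1
  change C' + C ≤ F₁.csd (f q.1.2).2
  linarith

/-- Where `CSD₁` is bounded above on the fibre product, `σ` takes values in a weakly precompact
set: `CSD₁ - CSD₀` is bounded below, so that `CSD₀` is bounded above too. -/
theorem weaklyPrecompact_of_csd_le (hσ : IsChain SP F₀ σ) (hf : IsCorrespondence I ℓ F₀ F₁ f)
    {q : ℕ → FibreProduct σ f} {M : ℝ}
    (hM : ∀ n, F₁.csd (fibreMap σ f (q n)) ≤ M) :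
    F₀.WeaklyPrecompact (range fun n => σ (q n).1.1) := by
  obtain ⟨C, hC⟩ := hσ.bddBelow
  obtain ⟨C', hC'⟩ := hf.bddBelow
  refine hσ.precompact _ (range_subset_iff.2 fun n => mem_range_self _) ⟨|C| + |M - C'|, ?_⟩
  rintro _ ⟨n, rfl⟩
  have h1 := hC (q n).1.1
  have h2 := hC' (q n).1.2
  have h3 : F₁.csd (f (q n).1.2).2 ≤ M := hM n
  rw [← (q n).2] at h2
  rw [abs_le]
  constructor
  · have := neg_abs_le C
    have := abs_nonneg (M - C')
    change _ ≤ F₀.csd (σ (q n).1.1)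
    linarith
  · have := le_abs_self (M - C')
    have := abs_nonneg C
    change F₀.csd (σ (q n).1.1) ≤ _
    linarith

theorem exists_weakTendsto_subseq (hσ : IsChain SP F₀ σ) (hf : IsCorrespondence I ℓ F₀ F₁ f)
    {q : ℕ → FibreProduct σ f} {M : ℝ}
    (hM : ∀ n, F₁.csd (fibreMap σ f (q n)) ≤ M) :
    ∃ φ : ℕ → ℕ, StrictMono φ ∧ ∃ y₀, F₀.WeakTendsto (fun n => σ (q (φ n)).1.1) y₀ :=
  weaklyPrecompact_of_csd_le hσ hf hM (fun n => σ (q n).1.1) fun n => mem_range_self n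

/-- Otherwise, a subsequence along which `CSD₁ ≤ a` can be chosen so that its image in `B₀`
converges weakly, and the lower bounds for `CSD₀` and for `CSD₁ - CSD₀` at the limits add up to a
contradiction. -/
theorem fibreMap_lsc (hσ : IsChain SP F₀ σ) (hf : IsCorrespondence I ℓ F₀ F₁ f)
    (q : ℕ → FibreProduct σ f) (y : B₁)
    (hq : F₁.WeakTendsto (fun n => fibreMap σ f (q n)) y) (a : ℝ) (ha : a < F₁.csd y) :
    ∀ᶠ n in atTop, a < F₁.csd (fibreMap σ f (q n)) := by
  by_contra hcon
  rw [not_eventually] at hcon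
  obtain ⟨φ, hφ, hφa⟩ := extraction_of_frequently_atTop hcon
  simp only [not_lt] at hφa
  obtain ⟨ψ, hψ, y₀, hy₀⟩ := exists_weakTendsto_subseq hσ hf (q := fun n => q (φ n)) hφa
  have h1 := hσ.lsc _ _ hy₀ (F₀.csd y₀ - (F₁.csd y - a) / 2) (by linarith)
  have hy₀' : F₀.WeakTendsto (fun n => (f (q (φ (ψ n))).1.2).1) y₀ := by
    have : (fun n => (f (q (φ (ψ n))).1.2).1) = fun n => σ (q (φ (ψ n))).1.1 :=
      funext fun n => (q (φ (ψ n))).2.symm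
    rw [this]; exact hy₀
  have h2 := hf.lsc (fun n => (q (φ (ψ n))).1.2) y₀ y hy₀' ((hq.comp hφ).comp hψ)
    (F₁.csd y - F₀.csd y₀ - (F₁.csd y - a) / 2) (by linarith)
  obtain ⟨n, hn1, hn2⟩ := (h1.and h2).exists
  have h3 : F₁.csd (f (q (φ (ψ n))).1.2).2 ≤ a := hφa (ψ n)
  have h4 := (q (φ (ψ n))).2
  rw [h4] at hn1
  linarith

/-- After passing to a subsequence the images in `B₀` converge weakly, and the values of `CSD₀`
converge to that of the limit. Hence a subsequence converges in `P`, its images in `B₀` converge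
strongly, and the axiom of strong convergence for `f` gives convergence in `Z`. -/
theorem fibreMap_strong_conv (hσ : IsChain SP F₀ σ) (hf : IsCorrespondence I ℓ F₀ F₁ f)
    [T2Space B₀] (q : ℕ → FibreProduct σ f) (y : B₁)
    (hq : F₁.WeakTendsto (fun n => fibreMap σ f (q n)) y)
    (hcsd : Tendsto (fun n => F₁.csd (fibreMap σ f (q n))) atTop (𝓝 (F₁.csd y))) :
    ∃ k : ℕ → ℕ, StrictMono k ∧ ∃ q', Tendsto (q ∘ k) atTop (𝓝 q') := by
  obtain ⟨M, hM⟩ := hcsd.bddAbove_range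
  obtain ⟨φ, hφ, y₀, hy₀⟩ := exists_weakTendsto_subseq hσ hf (q := q)
    fun n => hM (mem_range_self n)
  have hy₀' : F₀.WeakTendsto (fun n => (f (q (φ n)).1.2).1) y₀ := by
    have : (fun n => (f (q (φ n)).1.2).1) = fun n => σ (q (φ n)).1.1 :=
      funext fun n => (q (φ n)).2.symm
    rw [this]; exact hy₀
  have hcsd' := hcsd.comp hφ.tendsto_atTop
  -- the two lower bounds add up to the limit of `CSD₁`, so both are attained
  have hlim : Tendsto (fun n => F₀.csd (σ (q (φ n)).1.1)) atTop (𝓝 (F₀.csd y₀)) := by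
    refine tendsto_order.2 ⟨fun a ha => hσ.lsc _ _ hy₀ a ha, fun a ha => ?_⟩
    have h1 := hf.lsc (fun n => (q (φ n)).1.2) y₀ y hy₀' (hq.comp hφ)
      (F₁.csd y - F₀.csd y₀ - (a - F₀.csd y₀) / 2) (by linarith)
    have h2 := hcsd'.eventually (gt_mem_nhds
      (show F₁.csd y < F₁.csd y + (a - F₀.csd y₀) / 2 by linarith))
    filter_upwards [h1, h2] with n hn1 hn2
    have hn2' : F₁.csd (f (q (φ n)).1.2).2 < F₁.csd y + (a - F₀.csd y₀) / 2 := hn2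
    rw [(q (φ n)).2]
    linarith
  obtain ⟨ψ, hψ, p, hp⟩ := hσ.strong_conv _ _ hy₀ hlim
  have hσp : Tendsto (fun n => σ (q (φ (ψ n))).1.1) atTop (𝓝 (σ p)) :=
    (hσ.smooth.continuous.tendsto p).comp hp
  -- the weak limit `y₀` is replaced by the strong limit `σ p`, which has the same `CSD₀`
  have hp₀ : F₀.csd (σ p) = F₀.csd y₀ :=
    tendsto_nhds_unique ((F₀.continuous_csd.tendsto _).comp hσp) (hlim.comp hψ.tendsto_atTop)
  have hf₀ : Tendsto (fun n => (f (q (φ (ψ n))).1.2).1) atTop (𝓝 (σ p)) := by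
    have : (fun n => (f (q (φ (ψ n))).1.2).1) = fun n => σ (q (φ (ψ n))).1.1 :=
      funext fun n => (q (φ (ψ n))).2.symm
    rw [this]; exact hσp
  have hdiff : Tendsto (fun n => F₁.csd (f (q (φ (ψ n))).1.2).2 - F₀.csd (f (q (φ (ψ n))).1.2).1)
      atTop (𝓝 (F₁.csd y - F₀.csd (σ p))) :=
    (hcsd'.comp hψ.tendsto_atTop).sub ((F₀.continuous_csd.tendsto _).comp hf₀)
  obtain ⟨χ, hχ, z, hz⟩ := hf.strong_conv _ _ _ hf₀ ((hq.comp hφ).comp hψ) hdiff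
  have hfz : Tendsto (fun n => (f (q (φ (ψ (χ n)))).1.2).1) atTop (𝓝 (f z).1) :=
    ((continuous_fst.comp hf.smooth.continuous).tendsto z).comp hz
  refine ⟨fun n => φ (ψ (χ n)), (hφ.comp hψ).comp hχ,
    ⟨(p, z), tendsto_nhds_unique (hf₀.comp hχ.tendsto_atTop) hfz⟩, ?_⟩
  rw [tendsto_subtype_rng]
  exact (hp.comp hχ.tendsto_atTop).prodMk_nhds hz

theorem fibreMap_precompact (hσ : IsChain SP F₀ σ) (hf : IsCorrespondence I ℓ F₀ F₁ f)
    (T : Set B₁) (hT : T ⊆ range (fibreMap σ f))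
    (hb : ∃ C, ∀ b ∈ T, |F₁.csd b| ≤ C) : F₁.WeaklyPrecompact T := by
  obtain ⟨C, hC⟩ := hb
  intro u hu
  choose q hq using fun n => hT (hu n)
  have hM : ∀ n, F₁.csd (fibreMap σ f (q n)) ≤ C := fun n => by
    rw [hq]; exact (le_abs_self _).trans (hC _ (hu n))
  have h1 := weaklyPrecompact_of_csd_le hσ hf hM
  have h2 : (fun n => (f (q n).1.2).1) = fun n => σ (q n).1.1 := funext fun n => (q n).2.symm
  rw [← h2] at h1
  have h3 := hf.precompact (fun n => (q n).1.2) ⟨C, by rintro _ ⟨n, rfl⟩; exact hM n⟩ h1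
  exact h3 u fun n => ⟨n, hq n⟩

/-- The chain rule for the map `f₁` on a stratum of the fibre product. -/
theorem diff_fibreMap (hf : IsCorrespondence I ℓ F₀ F₁ f) {m : ℕ}
    {c : HilbertChart.{max u v, w} {q : FibreProduct σ f | fibreCodim I SP q = m}}
    (hc : c ∈ fibreAtlas E₀ I ℓ SP m) {q : FibreProduct σ f} (hq : q ∈ c.coord.source) :
    diff E₁ c (fibreMap σ f) q = diff₁ I E₁ f q.1.2 ∘L
      (mfderiv 𝓘(ℝ, c.E) I (fun e => (c.coord.symm e).1.2) (c.coord q) : c.E →L[ℝ] EZ) := by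
  have h1 : MDifferentiableAt 𝓘(ℝ, c.E) I (fun e => (c.coord.symm e).1.2) (c.coord q) :=
    ((hc.2.1 _ (c.coord.map_source hq)).contMDiffAt
      (c.isOpen_target.mem_nhds (c.coord.map_source hq))).mdifferentiableAt (by simp)
  have hinv : c.coord.symm (c.coord q) = q := c.coord.left_inv hq
  have h2 : HasMFDerivAt I 𝓘(ℝ, E₁) (fun z => (f z).2) (c.coord.symm (c.coord q)).1.2
      (diff₁ I E₁ f q.1.2) := by
    rw [hinv]
    exact ((hf.smooth.snd q.1.2).mdifferentiableAt (by simp)).hasMFDerivAt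
  exact (HasMFDerivAt.comp (c.coord q) h2 h1.hasMFDerivAt).mfderiv

/-- The compactness of `Π₁⁺ ∘ Df₁` on the fibre product of the tangent spaces. Given a bounded
sequence `(pₙ, vₙ)`, the vectors `Π₀⁺ Df₀ vₙ = Π₀⁺ Dσ pₙ` have a convergent subsequence, since
`Π₀⁺ ∘ Dσ` is compact. -/
theorem isCompactOperator_fibre_tangent [CompleteSpace E₀] (hσ : IsChain SP F₀ σ)
    (hf : IsCorrespondence I ℓ F₀ F₁ f)
    {x : P} {z : Z} (hxz : σ x = (f z).1) {i : ℕ}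
    {d : HilbertChart.{u, w} {p | SP.codim p = i}} (hd : d ∈ SP.atlas i)
    (hx : x ∈ d.coord.source) {T : Type*} [NormedAddCommGroup T] [NormedSpace ℝ T]
    (D : T →L[ℝ] d.E × EZ)
    (hr : ∀ t, diff E₀ d σ x (D t).1 = diff₀ I E₀ f z (D t).2) :
    IsCompactOperator (F₁.piPlus (f z).2 ∘L diff₁ I E₁ f z ∘L .snd ℝ d.E EZ ∘L D) := by
  refine (isCompactOperator_iff_isCompact_closure_image_closedBall
    ((F₁.piPlus (f z).2 ∘L diff₁ I E₁ f z ∘L .snd ℝ d.E EZ ∘L D : T →L[ℝ] F₁.Tplus (f z).2) :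
      T →ₗ[ℝ] F₁.Tplus (f z).2) one_pos).2 (isCompact_closure_of_subseq fun y hy => ?_)
  choose t ht hty using hy
  have hbound : ∀ n, ‖D (t n)‖ ≤ ‖D‖ := fun n => by
    refine (D.le_opNorm _).trans ?_
    have : ‖t n‖ ≤ 1 := by simpa using ht n
    nlinarith [norm_nonneg D]
  have hK := IsCompactOperator.isCompact_closure_image_closedBall
    (f := ((F₀.piPlus (f z).1 ∘L diff E₀ d σ x : d.E →L[ℝ] F₀.Tplus (f z).1) :
      d.E →ₗ[ℝ] F₀.Tplus (f z).1)) (hσ.algFredholm hd hx hxz).2 ‖D‖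
  obtain ⟨w, -, φ, hφ, hw⟩ := hK.isSeqCompact
    (x := fun n => (F₀.piPlus (f z).1 ∘L diff E₀ d σ x) (D (t n)).1) fun n =>
      subset_closure ⟨(D (t n)).1, by
        simpa using (norm_fst_le _).trans (hbound n), rfl⟩
  have hcomp := hf.compact z (fun n => (D (t (φ n))).2)
    ⟨‖D‖, fun n => (norm_snd_le _).trans (hbound _)⟩ ⟨w, by
      refine hw.congr fun n => ?_
      change F₀.piPlus (f z).1 (diff E₀ d σ x (D (t (φ n))).1) = _
      rw [hr]⟩
  obtain ⟨a, -, ψ, hψ, ha⟩ := hcomp.isSeqCompact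
    (x := fun n => F₁.piPlus (f z).2 (diff₁ I E₁ f z (D (t (φ n))).2)) fun n =>
      subset_closure ⟨n, rfl⟩
  refine ⟨φ ∘ ψ, hφ.comp hψ, a, ha.congr fun n => ?_⟩
  exact hty _

end ChainAxioms

end FloerBordism

theorem mainTheorem6
    -- the Floer spaces
    {E₀ : Type*} [NormedAddCommGroup E₀] [InnerProductSpace ℝ E₀] [CompleteSpace E₀]
    {B₀ : Type*} [TopologicalSpace B₀] [T2Space B₀] [SecondCountableTopology B₀]
    [ChartedSpace E₀ B₀] [IsManifold 𝓘(ℝ, E₀) ∞ B₀] (F₀ : FloerBordism.FloerSpace E₀ B₀)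
    {E₁ : Type*} [NormedAddCommGroup E₁] [InnerProductSpace ℝ E₁] [CompleteSpace E₁]
    {B₁ : Type*} [TopologicalSpace B₁] [T2Space B₁] [SecondCountableTopology B₁]
    [ChartedSpace E₁ B₁] [IsManifold 𝓘(ℝ, E₁) ∞ B₁] (F₁ : FloerBordism.FloerSpace E₁ B₁)
    -- the chain
    {P : Type u} [TopologicalSpace P] [T2Space P] [SecondCountableTopology P]
    (SP : FloerBordism.LCManifold.{u, w} P) (σ : P → B₀)
    (hσ : FloerBordism.IsChain SP F₀ σ)
    -- the correspondence
    {EZ : Type w} [NormedAddCommGroup EZ] [InnerProductSpace ℝ EZ] [CompleteSpace EZ]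
    {HZ : Type*} [TopologicalSpace HZ] (I : ModelWithCorners ℝ EZ HZ)
    (ℓ : EZ →L[ℝ] ℝ) (hI : Set.range I = {v | 0 ≤ ℓ v})
    {Z : Type v} [TopologicalSpace Z] [T2Space Z] [SecondCountableTopology Z]
    [ChartedSpace HZ Z] [IsManifold I ∞ Z] (f : Z → B₀ × B₁)
    (hf : FloerBordism.IsCorrespondence I ℓ F₀ F₁ f) :
    ∃ S : FloerBordism.LCManifold.{max u v, w} (FloerBordism.FibreProduct σ f),
      FloerBordism.IsInducedStructure (E₀ := E₀) I ℓ SP σ f S ∧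
      FloerBordism.IsChain S F₁ (FloerBordism.fibreMap σ f) ∧
      (∀ q : FloerBordism.FibreProduct σ f, S.codim q = 0 →
        ∀ k, FloerBordism.HasIndexAt SP F₀ σ q.1.1 k →
          FloerBordism.HasIndexAt S F₁ (FloerBordism.fibreMap σ f) q
            (FloerBordism.corrIndex I F₀ F₁ f q.1.2 + k)) ∧
      (∀ k l, FloerBordism.HasIndex SP F₀ σ k →
        (∀ z, I.IsInteriorPoint z → FloerBordism.corrIndex I F₀ F₁ f z = l) →
          FloerBordism.HasIndex S F₁ (FloerBordism.fibreMap σ f) (l + k)) := by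
  have hf₀ : ContMDiff I 𝓘(ℝ, E₀) ∞ fun z => (f z).1 := hf.smooth.fst
  have hf₁ : ContMDiff I 𝓘(ℝ, E₁) ∞ fun z => (f z).2 := hf.smooth.snd
  have hQ : ∀ q : FloerBordism.FibreProduct σ f,
      ∃ L : FloerBordism.LocalChart E₀ E₁ I SP σ f q.1.1 q.1.2,
        Nonempty (FloerBordism.FibreChart L) := fun q => by
    obtain ⟨L⟩ := FloerBordism.exists_localChart (E₁ := E₁) hI hσ.smooth hf.smooth.continuous
      q.1.1 q.1.2
    exact ⟨L, FloerBordism.exists_fibreChart hI hσ hf q.2 L⟩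
  let S := FloerBordism.fibreLC I hI hσ.smooth hf₀ hQ
  -- the operators of the fibre product at a point
  have key : ∀ q, ∀ c ∈ S.atlas (S.codim q), q ∈ c.coord.source →
      ((F₁.piMinus (FloerBordism.fibreMap σ f q)).comp
        (FloerBordism.diff E₁ c (FloerBordism.fibreMap σ f) q)).IsFredholm ∧
      IsCompactOperator ((F₁.piPlus (FloerBordism.fibreMap σ f q)).comp
        (FloerBordism.diff E₁ c (FloerBordism.fibreMap σ f) q)) ∧
      (¬ I.IsBoundaryPoint q.1.2 → ∀ k, FloerBordism.HasIndexAt SP F₀ σ q.1.1 k →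
        ((F₁.piMinus (FloerBordism.fibreMap σ f q)).comp
          (FloerBordism.diff E₁ c (FloerBordism.fibreMap σ f) q)).toLinearMap.index =
            FloerBordism.corrIndex I F₀ F₁ f q.1.2 + k) := by
    intro q c hc hq
    obtain ⟨d, hd, hds⟩ := SP.exists_chart q.1.1
    obtain ⟨hinj, hrange⟩ := hc.2.2 q hq d hd hds
    obtain ⟨h1, h2⟩ := FloerBordism.algFredholm_fibre_tangent hσ hf q.2 hd hds _ hinj hrange
    have h3 := FloerBordism.isCompactOperator_fibre_tangent hσ hf q.2 hd hds _
      fun t => (hrange.subset (mem_range_self t)).2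
    have := F₁.completeSpace_Tminus (f q.1.2).2
    have hD : FloerBordism.diff E₁ c (FloerBordism.fibreMap σ f) q = _ :=
      FloerBordism.diff_fibreMap hf hc hq
    rw [hD]
    exact ⟨h1.isFredholm, h3, fun hz k hk => (h2 hz).trans (by rw [← hk d hd hds])⟩
  have hcod : ∀ q, S.codim q = 0 → SP.codim q.1.1 = 0 ∧ ¬ I.IsBoundaryPoint q.1.2 := by
    intro q hq
    have h : SP.codim q.1.1 + FloerBordism.boundaryCodim I q.1.2 = 0 := hq
    refine ⟨by omega, fun hb => ?_⟩
    have : FloerBordism.boundaryCodim I q.1.2 = 1 := if_pos hb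
    omega
  refine ⟨S, FloerBordism.isInducedStructure_fibreLC, ?_, ?_, ?_⟩
  · exact
      { smooth := FloerBordism.isLCSmooth_fibreMap hf₁
        bddBelow := FloerBordism.csd_fibreMap_bddBelow hσ hf
        lsc := FloerBordism.fibreMap_lsc hσ hf
        strong_conv := FloerBordism.fibreMap_strong_conv hσ hf
        precompact := FloerBordism.fibreMap_precompact hσ hf
        fredholm := fun q c hc hq => (key q c hc hq).1
        compact := fun q c hc hq => (key q c hc hq).2.1 }
  · exact fun q hq k hk c hc hqc => (key q c hc hqc).2.2 (hcod q hq).2 k hk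
  · intro k l hk hl q hq c hc hqc
    obtain ⟨h1, h2⟩ := hcod q hq
    rw [← hl _ ((I.isInteriorPoint_iff_not_isBoundaryPoint _).2 h2)]
    exact (key q c hc hqc).2.2 h2 k (hk _ h1)
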